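/- Let $V=\bigoplus_{\Delta\in\mathbb Z}V_\Delta$ be a commutative $\mathbb Z$-graded vertex algebra over $\mathbb C$ (with $|0\rangle\in V_0$, $a_{(n)}b\in V_{\Delta+\Delta'-n-1}$ for $a\in V_\Delta$, $b\in V_{\Delta'}$, and $[Y(a,z),Y(b,w)]=0$) such that $V_\Delta=0$ for $\Delta\ll 0$ and $\dim V_\Delta<\infty$ for all $\Delta$. Let $T$ be its translation operator. **The algebra $\overline V$.** Put $\overline V=\prod_\Delta V_\Delta$ with the product topology and with the multiplication $(ab)_\Delta=\sum_{\Delta'}(a_{\Delta'})_{(-1)}b_{\Delta-\Delta'}$; it is a commutative topological $\mathbb C$-algebra with unit $|0\rangle$. An element $(q,z)$ of the group $S^1\ltimes\mathbb C$ of motions $w\mapsto qw+z$ of $\mathbb C$ acts on $\overline V$ by the algebra automorphism $e^{zT}q^{L_0}$, where $(q^{L_0}a)_\Delta=q^\Delta a_\Delta$ and $(e^{zT}a)_\Delta=\sum_{n\ge0}\frac{z^n}{n!}T^na_{\Delta-n}$. **The factorization algebra.** Locally convex spaces over $\mathbb C$ are not required to be Hausdorff. Let $\mathfrak B$ be the set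 of finite disjoint unions $L=D_{r_1}(z_1)\sqcup\dots\sqcup D_{r_l}(z_l)$, $l\ge 0$, of open discs of positive radius. Put $F(L)=\overline V^{\otimes l}$ ($=\mathbb C$ for $l=0$) with the projective tensor product topology; for $L\subset M$ in $\mathfrak B$ let $F(L)\to F(M)$ multiply the tensor factors belonging to discs of $L$ that lie in the same disc of $M$ (and insert $1$ in the remaining discs of $M$); for disjoint $L,M$ let $F(L)\otimes F(M)= F(L\sqcup M)$ be the canonical identification; let $(q,z)$ act by $F(L)\to F((q,z)L)$, $\bigotimes a_i\mapsto \bigotimes e^{zT}q^{L_0}a_i$. For an open set $U\subset\mathbb C$ let $\mathbf F^{\mathrm{loc}}_{\overline V}(U)=\varinjlim_{L\in\mathfrak B,\,L\subset U}F(L)$, the inductive limit in the category of locally convex spaces (that is, with the finest locally convex topology making all the canonical maps continuous), with the induced maps $\mathbf F^{\mathrm{loc}}_{\overline V}(U)\to\mathbf F^{\mathrm{loc}}_{\overline V}(W)$ for $U\subset W$, multiplications $\mathbf F^{\mathrm{loc}}_{\overline V}(U)\otimes\mathbf F^{\mathrm{loc}}_{\overline V}(V')\to\mathbf F^{\mathrm{loc}}_{\overline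 V}(W)$ for disjoint open $U,V'$ with $U\sqcup V'\subset W$, unit $\mathbb C\to\mathbf F^{\mathrm{loc}}_{\overline V}(\varnothing)$, and equivariance maps $\sigma_{(q,z),U}$. For locally convex spaces $X,Y$ let $X\otimes_\iota Y$ (resp. $X\otimes_\pi Y$) be $X\otimes Y$ with the finest locally convex topology making $X\times Y\to X\otimes Y$ separately (resp. jointly) continuous. **Claim.** Write $\mathcal F=\mathbf F^{\mathrm{loc}}_{\overline V}$. 1. $\mathcal F$ is an $S^1\ltimes\mathbb C$-equivariant factorization algebra on $\mathbb C$ with values in the symmetric monoidal category of locally convex spaces, continuous linear maps and $\otimes_\iota$. That is: all the maps above are continuous; $\mathcal F$ is a precosheaf; the multiplications are natural, commutative, associative and unital; $\sigma_{ab,U}=\sigma_{a,bU}\sigma_{b,U}$, $\sigma_{1,U}=\mathrm{id}$, and the $\sigma_{a,U}$ are compatible with the structure maps, the multiplications and the unit; for every Weiss cover $\{U_i\}$ of an open set $U$ (an open cover such that every finite subset of $U$ lies in some $U_i$) the diagram $\bigoplus_{i,j}\mathcal F(U_i\cap U_j)\rightrightarrows\bigoplus_i\mathcal F(U_i)\to\mathcal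 F(U)$ is a coequalizer of locally convex spaces; and for disjoint open $U,V'$ the multiplication $\mathcal F(U)\otimes_\iota\mathcal F(V')\to\mathcal F(U\sqcup V')$ is an isomorphism of locally convex spaces. 2. $\mathcal F$ is locally constant: for $0<r<R\le\infty$ and $D_r(z)\subset D_R(w)$ the map $\mathcal F(D_r(z))\to\mathcal F(D_R(w))$ is an isomorphism of locally convex spaces, where $D_\infty(w)=\mathbb C$. 3. $\mathcal F$ is holomorphic. With $\mathcal F(D_R(0))_\Delta=\{a\in\mathcal F(D_R(0)) : \sigma_{(q,0)}a=q^\Delta a \text{ for all } q\in S^1\}$, this means: (i) for $0<r<R$ and $\Delta\in\mathbb Z$ the structure map restricts to a bijection $\mathcal F(D_r(0))_\Delta\to\mathcal F(D_R(0))_\Delta$; (ii) for each $R>0$, $\mathcal F(D_R(0))_\Delta=0$ for $\Delta\ll0$; (iii) for each $R>0$, $\mathcal F(D_R(0))$ is quasi-complete and Hausdorff; (iv) for $R>0$ and families $a_i=(a_{i,s})_{s>0}$, $1\le i\le l$, $l\geq 1$, with $a_{i,s}\in\mathcal F(D_s(0))_{\Delta_i}$ compatible with the structure maps $\mathcal F(D_s(0))\to\mathcal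 F(D_t(0))$, $s<t$, the function sending a tuple $(z_1,\dots,z_l)$ of distinct points of $D_R(0)$ to the product in $\mathcal F(D_R(0))$ of the elements $\sigma_{(1,z_i)}a_{i,r}\in\mathcal F(D_r(z_i))$, for any $r>0$ such that the discs $D_r(z_i)$ are disjoint and contained in $D_R(0)$, is holomorphic (that is, complex differentiable at every point, as a function of several complex variables with values in a locally convex space). 4. For open sets with finitely many connected components $\otimes_\iota$ may be replaced by $\otimes_\pi$: if $U,V'$ are disjoint open sets, each with finitely many connected components, then $\mathcal F(U)\otimes_\pi\mathcal F(V')\to\mathcal F(W)$ is continuous for every open $W\supset U\sqcup V'$, and $\mathcal F(U)\otimes_\pi\mathcal F(V')\to\mathcal F(U\sqcup V')$ is an isomorphism of locally convex spaces. -/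

import Mathlib

universe u

open TopologicalSpace Topology Filter
open scoped TensorProduct Pointwise

noncomputable section

/-- A vertex algebra structure on a complex vector space `V`. A Mathlib `VertexOperator ℂ V` is a
linear map from `V` to the Laurent series `V((z))`, that is, a field on `V`, and `VertexOperator.ncoeff A n` is the
mode `A₍ₙ₎` in `A(z) = ∑ A₍ₙ₎ z ^ (-n-1)`. -/
structure VertexAlgebra (V : Type u) [AddCommGroup V] [Module ℂ V] where
  /-- the vacuum -/
  vac : V
  /-- the translation operator -/
  T : V →ₗ[ℂ] V
  /-- the state-field correspondence -/
  Y : V →ₗ[ℂ] VertexOperator ℂ V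
  /-- `Y(|0⟩, z) = id` -/
  vac_mode : ∀ n : ℤ, VertexOperator.ncoeff (Y vac) n = if n = -1 then LinearMap.id else 0
  /-- `Y(a, z)|0⟩ ∈ V[[z]]` -/
  mode_vac_nonneg : ∀ (a : V) (n : ℤ), 0 ≤ n → VertexOperator.ncoeff (Y a) n vac = 0
  /-- `Y(a, z)|0⟩` has constant term `a` -/
  mode_vac : ∀ a : V, VertexOperator.ncoeff (Y a) (-1) vac = a
  T_vac : T vac = 0
  /-- `[T, Y(a, z)] = ∂_z Y(a, z)`, mode by mode -/
  T_comm : ∀ (a : V) (n : ℤ) (v : V),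
    T (VertexOperator.ncoeff (Y a) n v) - VertexOperator.ncoeff (Y a) n (T v) = (-(n : ℂ)) • VertexOperator.ncoeff (Y a) (n - 1) v
  /-- `(z - w) ^ N [Y(a, z), Y(b, w)] = 0` for some `N`, coefficient by coefficient -/
  locality : ∀ a b : V, ∃ N : ℕ, ∀ (m n : ℤ) (v : V),
    ∑ j ∈ Finset.range (N + 1), ((-1 : ℂ) ^ j * (N.choose j : ℂ)) •
      (VertexOperator.ncoeff (Y a) (m + (N - j : ℕ)) (VertexOperator.ncoeff (Y b) (n + j) v)
        - VertexOperator.ncoeff (Y b) (n + j) (VertexOperator.ncoeff (Y a) (m + (N - j : ℕ)) v)) = 0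

/-- A `ℤ`-graded vertex algebra. -/
structure GradedVertexAlgebra (V : Type u) [AddCommGroup V] [Module ℂ V] extends
    VertexAlgebra V where
  /-- the weight spaces `V_Δ` -/
  gr : ℤ → Submodule ℂ V
  isInternal : DirectSum.IsInternal gr
  vac_mem : vac ∈ gr 0
  mode_mem : ∀ (Δ Δ' n : ℤ) (a b : V), a ∈ gr Δ → b ∈ gr Δ' → VertexOperator.ncoeff (Y a) n b ∈ gr (Δ + Δ' - n - 1)

/-- A commutative `ℤ`-graded vertex algebra with `V_Δ = 0` for `Δ ≪ 0`. -/
structure CommGradedVertexAlgebra (V : Type u) [AddCommGroup V] [Module ℂ V] extends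
    GradedVertexAlgebra V where
  /-- `[Y(a, z), Y(b, w)] = 0` -/
  mode_comm : ∀ (a b : V) (m n : ℤ) (v : V),
    VertexOperator.ncoeff (Y a) (m) (VertexOperator.ncoeff (Y b) n v) = VertexOperator.ncoeff (Y b) n (VertexOperator.ncoeff (Y a) (m) v)
  bddBelow : ∃ N : ℤ, ∀ Δ < N, gr Δ = ⊥

namespace CommGradedVertexAlgebra

variable {V : Type u} [AddCommGroup V] [Module ℂ V] (A : CommGradedVertexAlgebra V)

/-- The commutative multiplication `ab = a₍₋₁₎b` of a commutative vertex algebra. -/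
def prod (a b : V) : V := VertexOperator.ncoeff (A.Y a) (-1) b

theorem prod_comm (a b : V) : A.prod a b = A.prod b a := by
  have h := A.mode_comm a b (-1) (-1) A.vac
  rwa [A.mode_vac, A.mode_vac] at h

theorem prod_assoc (a b c : V) : A.prod (A.prod a b) c = A.prod a (A.prod b c) := by
  rw [A.prod_comm _ c, A.prod_comm b c]
  exact A.mode_comm c a (-1) (-1) b

theorem prod_add (a b c : V) : A.prod a (b + c) = A.prod a b + A.prod a c := map_add _ _ _

theorem prod_smul (r : ℂ) (a b : V) : A.prod a (r • b) = r • A.prod a b := map_smul _ _ _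

theorem vac_prod (a : V) : A.prod A.vac a = a := by simp [prod, A.vac_mode]

theorem prod_mem {i j k : ℤ} (h : i + j = k) {a b : V} (ha : a ∈ A.gr i) (hb : b ∈ A.gr j) :
    A.prod a b ∈ A.gr k := by
  have := A.mode_mem i j (-1) a b ha hb
  rwa [show i + j - -1 - 1 = k by omega] at this

/-- The commutative ring underlying a commutative vertex algebra. -/
abbrev ring : CommRing V :=
  { (inferInstance : AddCommGroup V) with
    mul := A.prod
    one := A.vac
    mul_assoc := A.prod_assoc
    mul_comm := A.prod_comm
    one_mul := A.vac_prod
    mul_one := fun a => (A.prod_comm a A.vac).trans (A.vac_prod a)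
    left_distrib := A.prod_add
    right_distrib := fun a b c => by
      change A.prod (a + b) c = A.prod a c + A.prod b c
      rw [A.prod_comm, A.prod_add, A.prod_comm c a, A.prod_comm c b]
    zero_mul := fun a => by
      change A.prod 0 a = 0
      rw [A.prod_comm]; exact map_zero _
    mul_zero := fun a => map_zero (VertexOperator.ncoeff (A.Y a) (-1)) }

theorem T_eq (a : V) : A.T a = VertexOperator.ncoeff (A.Y a) (-2) A.vac := by
  have h := A.T_comm a (-1) A.vac
  rw [A.mode_vac, A.T_vac, map_zero, sub_zero] at h
  rw [h]; norm_num

theorem T_prod (a b : V) : A.T (A.prod a b) = A.prod (A.T a) b + A.prod a (A.T b) := by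
  have h := A.T_comm a (-1) b
  have h2 : VertexOperator.ncoeff (A.Y a) (-2) b = A.prod (A.T a) b := by
    have := A.mode_comm a b (-2) (-1) A.vac
    rw [A.mode_vac, ← A.T_eq] at this
    rw [this, A.prod_comm]; rfl
  norm_num at h
  rw [h2] at h
  exact sub_eq_iff_eq_add.mp h

theorem T_mem {i : ℤ} {a : V} (ha : a ∈ A.gr i) : A.T a ∈ A.gr (i + 1) := by
  rw [A.T_eq]
  have := A.mode_mem i 0 (-2) a A.vac ha A.vac_mem
  rwa [show i + 0 - -2 - 1 = i + 1 by omega] at this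

theorem T_pow_mem {i j : ℤ} {n : ℕ} (h : i + n = j) {a : V} (ha : a ∈ A.gr i) :
    (A.T ^ n) a ∈ A.gr j := by
  induction n generalizing j with
  | zero => simpa [← h] using ha
  | succ n ih =>
    rw [pow_succ', Module.End.mul_apply]
    have := A.T_mem (ih rfl)
    rwa [show i + n + 1 = j by push_cast at h; omega] at this

/-- The completion `V̄ = ∏_Δ V_Δ`. -/
def Completion : Type u := ∀ Δ : ℤ, A.gr Δ

namespace Completion

instance : AddCommGroup A.Completion := inferInstanceAs (AddCommGroup (∀ Δ : ℤ, A.gr Δ))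

instance : Module ℂ A.Completion := inferInstanceAs (Module ℂ (∀ Δ : ℤ, A.gr Δ))

variable {A}

@[ext] theorem ext {a b : A.Completion} (h : ∀ Δ, (a Δ : V) = b Δ) : a = b :=
  funext fun Δ => Subtype.ext (h Δ)

@[simp] theorem add_apply (a b : A.Completion) (Δ : ℤ) : ((a + b) Δ : V) = a Δ + b Δ := rfl

@[simp] theorem smul_apply (r : ℂ) (a : A.Completion) (Δ : ℤ) : ((r • a) Δ : V) = r • (a Δ : V) :=
  rfl

/-- The components of an element of the completion vanish in low degree. -/
theorem exists_bound (A : CommGradedVertexAlgebra V) :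
    ∃ N : ℤ, ∀ (a : A.Completion) (Δ : ℤ), Δ < N → (a Δ : V) = 0 := by
  obtain ⟨N, hN⟩ := A.bddBelow
  exact ⟨N, fun a Δ h => by
    have : (a Δ : V) ∈ (⊥ : Submodule ℂ V) := (hN Δ h).le (a Δ).2
    exact (Submodule.mem_bot ℂ).mp this⟩

/-- The multiplication `(ab)_Δ = ∑_Δ' a_Δ' b_(Δ-Δ')` of `V̄`; the sum is finite. -/
instance : Mul A.Completion where
  mul a b := fun Δ => ⟨∑ᶠ Δ' : ℤ, A.prod (a Δ') (b (Δ - Δ')),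
    finsum_induction (· ∈ A.gr Δ) (zero_mem _) (fun _ _ => add_mem)
      (fun Δ' => A.prod_mem (by omega) (a Δ').2 (b (Δ - Δ')).2)⟩

/-- The unit of `V̄` is the vacuum, placed in degree zero. -/
instance : One A.Completion where
  one := fun Δ => if h : Δ = 0 then ⟨A.vac, h ▸ A.vac_mem⟩ else 0

theorem mul_apply (a b : A.Completion) (Δ : ℤ) :
    ((a * b) Δ : V) = ∑ᶠ Δ' : ℤ, A.prod (a Δ') (b (Δ - Δ')) := rfl

theorem one_apply (Δ : ℤ) : ((1 : A.Completion) Δ : V) = if Δ = 0 then A.vac else 0 := by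
  change (((if h : Δ = 0 then ⟨A.vac, h ▸ A.vac_mem⟩ else 0 : A.gr Δ)) : V) = _
  split_ifs <;> rfl

/-- An element of the completion as a Laurent series. -/
def toLaurent (a : A.Completion) : HahnSeries ℤ V where
  coeff Δ := a Δ
  isPWO_support' := by
    obtain ⟨N, hN⟩ := exists_bound A
    exact (BddBelow.isWF ⟨N, fun Δ hΔ => not_lt.mp fun h => (Function.mem_support.mp hΔ) (hN a Δ h)⟩).isPWO

theorem toLaurent_injective : Function.Injective (toLaurent : A.Completion → HahnSeries ℤ V) :=
  fun _ _ h => ext fun Δ => congrArg (fun s => s.coeff Δ) h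

theorem toLaurent_mul (a b : A.Completion) :
    letI := A.ring
    toLaurent (a * b) = toLaurent a * toLaurent b := by
  let := A.ring
  ext Δ
  rw [HahnSeries.coeff_mul]
  change ∑ᶠ Δ' : ℤ, A.prod (a Δ') (b (Δ - Δ')) = _
  rw [finsum_eq_sum_of_support_subset (s := (Finset.antidiagonal
    (toLaurent a).isPWO_support (toLaurent b).isPWO_support Δ).image Prod.fst)]
  · rw [Finset.sum_image]
    · refine Finset.sum_congr rfl fun x hx => ?_
      rw [Finset.mem_antidiagonal] at hx
      rw [show Δ - x.1 = x.2 by omega]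
      rfl
    · intro x hx y hy h
      have hx := (Finset.mem_antidiagonal.mp hx).2.2
      have hy := (Finset.mem_antidiagonal.mp hy).2.2
      exact Prod.ext h (by omega)
  · intro i hi
    have h1 : (a i : V) ≠ 0 := fun h => hi (by
      change A.prod (a i) _ = 0
      rw [h, A.prod_comm]; exact map_zero _)
    have h2 : (b (Δ - i) : V) ≠ 0 := fun h => hi (by
      change A.prod _ (b (Δ - i)) = 0
      rw [h]; exact map_zero _)
    simp only [Finset.coe_image, Set.mem_image, Finset.mem_coe]
    exact ⟨(i, Δ - i), Finset.mem_antidiagonal.mpr ⟨h1, h2, by simp⟩, rfl⟩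

theorem toLaurent_one :
    letI := A.ring
    toLaurent (1 : A.Completion) = 1 := by
  let := A.ring
  ext Δ
  change ((1 : A.Completion) Δ : V) = _
  rw [one_apply, HahnSeries.coeff_one]
  congr

theorem toLaurent_add (a b : A.Completion) :
    letI := A.ring
    toLaurent (a + b) = toLaurent a + toLaurent b := rfl

instance : CommRing A.Completion :=
  letI := A.ring
  { (inferInstance : AddCommGroup A.Completion) with
    mul_assoc := fun a b c => toLaurent_injective (by
      rw [toLaurent_mul, toLaurent_mul, toLaurent_mul, toLaurent_mul, mul_assoc])
    mul_comm := fun a b => toLaurent_injective (by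
      rw [toLaurent_mul, toLaurent_mul, mul_comm])
    one_mul := fun a => toLaurent_injective (by rw [toLaurent_mul, toLaurent_one, one_mul])
    mul_one := fun a => toLaurent_injective (by rw [toLaurent_mul, toLaurent_one, mul_one])
    left_distrib := fun a b c => toLaurent_injective (by
      rw [toLaurent_mul, toLaurent_add, toLaurent_add, toLaurent_mul, toLaurent_mul, mul_add])
    right_distrib := fun a b c => toLaurent_injective (by
      rw [toLaurent_mul, toLaurent_add, toLaurent_add, toLaurent_mul, toLaurent_mul, add_mul])
    zero_mul := fun a => toLaurent_injective (by
      rw [toLaurent_mul]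
      exact zero_mul _)
    mul_zero := fun a => toLaurent_injective (by
      rw [toLaurent_mul]
      exact mul_zero _) }

theorem smul_mul (r : ℂ) (a b : A.Completion) : (r • a) * b = r • (a * b) := by
  ext Δ
  rw [smul_apply, mul_apply, mul_apply, smul_finsum]
  refine finsum_congr fun i => ?_
  rw [smul_apply, A.prod_comm, A.prod_smul, A.prod_comm]

instance : Algebra ℂ A.Completion :=
  Algebra.ofModule smul_mul fun r a b => by rw [mul_comm, smul_mul, mul_comm]


/-- For fixed `k`, only finitely many terms of the sum defining `(ab)_k` are nonzero. -/
theorem prod_support_finite (a b : A.Completion) (k : ℤ) :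
    (Function.support fun i : ℤ => A.prod (a i) (b (k - i))).Finite := by
  obtain ⟨N, hN⟩ := exists_bound A
  refine (Set.finite_Icc N (k - N)).subset fun i hi => ?_
  by_contra h
  rw [Set.mem_Icc, not_and_or, not_le, not_le] at h
  refine hi ?_
  rcases h with h | h
  · change A.prod (a i) _ = 0
    rw [hN a i h, A.prod_comm]; exact map_zero _
  · change A.prod _ (b (k - i)) = 0
    rw [hN b (k - i) (by omega)]; exact map_zero _

theorem sum_apply {ι : Type*} (s : Finset ι) (f : ι → A.Completion) (Δ : ℤ) :
    ((∑ i ∈ s, f i) Δ : V) = ∑ i ∈ s, (f i Δ : V) := by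
  induction s using Finset.cons_induction with
  | empty => rfl
  | cons i s hi ih => rw [Finset.sum_cons, Finset.sum_cons, add_apply, ih]

/-- The translation operator on `V̄`. -/
def shiftT : A.Completion →ₗ[ℂ] A.Completion where
  toFun a := fun Δ => ⟨A.T (a (Δ - 1)), by
    simpa using A.T_mem (a (Δ - 1)).2⟩
  map_add' a b := ext fun Δ => map_add A.T _ _
  map_smul' r a := ext fun Δ => map_smul A.T _ _

theorem shiftT_apply (a : A.Completion) (Δ : ℤ) : (shiftT a Δ : V) = A.T (a (Δ - 1)) := rfl

theorem shiftT_pow_apply (n : ℕ) (a : A.Completion) (Δ : ℤ) :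
    ((shiftT ^ n) a Δ : V) = (A.T ^ n) (a (Δ - n)) := by
  induction n generalizing Δ with
  | zero =>
    simp only [pow_zero, Module.End.one_apply]
    rw [show Δ - ((0 : ℕ) : ℤ) = Δ by simp]
  | succ n ih =>
    rw [pow_succ', pow_succ', Module.End.mul_apply, Module.End.mul_apply, shiftT_apply, ih]
    rw [show Δ - 1 - (n : ℤ) = Δ - (n + 1 : ℕ) by push_cast; ring]

theorem shiftT_mul (a b : A.Completion) : shiftT (a * b) = a * shiftT b + shiftT a * b := by
  ext Δ
  rw [shiftT_apply, add_apply, mul_apply, mul_apply, mul_apply,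
    ← LinearMap.toAddMonoidHom_coe,
    AddMonoidHom.map_finsum _ (prod_support_finite a b _)]
  have h2 : ∑ᶠ i : ℤ, A.prod (shiftT a i) (b (Δ - i)) =
      ∑ᶠ i : ℤ, A.prod (A.T (a i)) (b (Δ - 1 - i)) := by
    rw [← finsum_comp_equiv (Equiv.addRight (1 : ℤ))]
    refine finsum_congr fun i => ?_
    rw [shiftT_apply]
    simp only [Equiv.coe_addRight]
    rw [show i + 1 - 1 = i by ring, show Δ - (i + 1) = Δ - 1 - i by ring]
  have h3 : (Function.support fun i : ℤ => A.prod (A.T (a i)) (b (Δ - 1 - i))).Finite := by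
    have := (prod_support_finite (shiftT a) b Δ).preimage
      (f := fun i : ℤ => i + 1) (add_left_injective 1).injOn
    refine this.subset fun i hi => ?_
    simp only [Set.mem_preimage, Function.mem_support, shiftT_apply] at hi ⊢
    rwa [show i + 1 - 1 = i by ring, show Δ - (i + 1) = Δ - 1 - i by ring]
  have h4 := prod_support_finite a (shiftT b) Δ
  rw [h2, ← finsum_add_distrib h4 h3]
  refine finsum_congr fun i => ?_
  rw [LinearMap.toAddMonoidHom_coe, A.T_prod, shiftT_apply, show Δ - i - 1 = Δ - 1 - i by ring, add_comm]

theorem shiftT_pow_mul (n : ℕ) (a b : A.Completion) :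
    (shiftT ^ n) (a * b) = ∑ p ∈ Finset.HasAntidiagonal.antidiagonal n,
      (n.choose p.1 : ℂ) • ((shiftT ^ p.1) a * (shiftT ^ p.2) b) := by
  let DL : Module.End ℂ (A.Completion ⊗[ℂ] A.Completion) := shiftT.lTensor A.Completion
  let DR : Module.End ℂ (A.Completion ⊗[ℂ] A.Completion) := shiftT.rTensor A.Completion
  let m := LinearMap.mul' ℂ A.Completion
  have hc : Commute DR DL := by ext; simp [DL, DR]
  have h1 : ∀ t, shiftT (m t) = m ((DR + DL) t) := by
    intro t
    induction t with
    | zero => simp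
    | add x y hx hy => simp only [map_add, hx, hy]
    | tmul x y =>
      simp only [m, DL, DR, LinearMap.mul'_apply, LinearMap.add_apply, LinearMap.lTensor_tmul,
        LinearMap.rTensor_tmul, map_add]
      rw [shiftT_mul, add_comm]
  have h2 : ∀ k t, (shiftT ^ k) (m t) = m (((DR + DL) ^ k) t) := by
    intro k
    induction k with
    | zero => intro t; simp
    | succ k ih => intro t; rw [pow_succ, pow_succ, Module.End.mul_apply, h1, ih]; rfl
  have h3 := h2 n (a ⊗ₜ b)
  rw [hc.add_pow'] at h3
  simp only [m, LinearMap.mul'_apply] at h3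
  rw [h3, LinearMap.sum_apply, map_sum]
  refine Finset.sum_congr rfl fun p _ => ?_
  simp only [LinearMap.smul_apply, Module.End.mul_apply, DL, DR, LinearMap.lTensor_pow,
    LinearMap.rTensor_pow, LinearMap.lTensor_tmul, LinearMap.rTensor_tmul, map_nsmul,
    LinearMap.mul'_apply, Nat.cast_smul_eq_nsmul]

/-- The operator `e^{zT}` on `V̄`: `(e^{zT}a)_Δ = ∑_n (z^n/n!) T^n a_(Δ-n)`; the sum is finite. -/
def expT (z : ℂ) (a : A.Completion) : A.Completion := fun Δ =>
  ⟨∑ᶠ n : ℕ, (z ^ n / (n.factorial : ℂ)) • (A.T ^ n) (a (Δ - n)),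
    finsum_induction (· ∈ A.gr Δ) (zero_mem _) (fun _ _ => add_mem)
      (fun n => Submodule.smul_mem _ _ (A.T_pow_mem (by omega) (a (Δ - n)).2))⟩

theorem expT_apply (z : ℂ) (a : A.Completion) (Δ : ℤ) :
    (expT z a Δ : V) = ∑ᶠ n : ℕ, (z ^ n / (n.factorial : ℂ)) • (A.T ^ n) (a (Δ - n)) := rfl

theorem expT_apply_eq_sum {N : ℤ} (hN : ∀ (a : A.Completion) (Δ : ℤ), Δ < N → (a Δ : V) = 0)
    (z : ℂ) (a : A.Completion) {Δ : ℤ} {K : ℕ} (hK : Δ - N ≤ K) :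
    (expT z a Δ : V) =
      (∑ n ∈ Finset.range (K + 1), (z ^ n / (n.factorial : ℂ)) • (shiftT ^ n) a) Δ := by
  rw [expT_apply, sum_apply]
  rw [finsum_eq_sum_of_support_subset (s := Finset.range (K + 1))]
  · refine Finset.sum_congr rfl fun n _ => ?_
    rw [smul_apply, shiftT_pow_apply]
  · intro n hn
    by_contra h
    refine hn ?_
    simp only [Finset.coe_range, Set.mem_Iio, not_lt] at h
    change _ • (A.T ^ n) (a (Δ - n) : V) = 0
    rw [hN a _ (by omega), map_zero, smul_zero]

theorem expT_add (z : ℂ) (a b : A.Completion) : expT z (a + b) = expT z a + expT z b := by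
  obtain ⟨N, hN⟩ := exists_bound A
  ext Δ
  have hK : Δ - N ≤ (Δ - N).toNat := Int.self_le_toNat _
  rw [add_apply, expT_apply_eq_sum hN z _ hK, expT_apply_eq_sum hN z _ hK,
    expT_apply_eq_sum hN z _ hK, ← add_apply, ← Finset.sum_add_distrib]
  simp only [map_add, smul_add]

theorem expT_smul (z r : ℂ) (a : A.Completion) : expT z (r • a) = r • expT z a := by
  ext Δ
  rw [smul_apply, expT_apply, expT_apply, smul_finsum]
  refine finsum_congr fun n => ?_
  rw [smul_apply, map_smul, smul_comm]

theorem expT_one (z : ℂ) : expT z (1 : A.Completion) = 1 := by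
  ext Δ
  rw [expT_apply, finsum_eq_single _ 0]
  · simp only [pow_zero, Nat.factorial_zero, Nat.cast_one, div_one, one_smul,
      Module.End.one_apply]
    rw [show Δ - ((0 : ℕ) : ℤ) = Δ by simp]
  · intro n hn
    rw [one_apply]
    split_ifs
    · obtain ⟨k, rfl⟩ := Nat.exists_eq_succ_of_ne_zero hn
      rw [Nat.succ_eq_add_one, pow_succ A.T, Module.End.mul_apply, A.T_vac, map_zero, smul_zero]
    · rw [map_zero, smul_zero]

theorem expT_mul (z : ℂ) (a b : A.Completion) : expT z (a * b) = expT z a * expT z b := by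
  obtain ⟨N, hN⟩ := exists_bound A
  ext Δ
  let K : ℕ := (max (Δ - N) (Δ - 2 * N)).toNat
  have hK : max (Δ - N) (Δ - 2 * N) ≤ K := Int.self_le_toNat _
  have hK1 : Δ - N ≤ K := (le_max_left _ _).trans hK
  have hK2 : Δ - 2 * N ≤ K := (le_max_right _ _).trans hK
  let c : ℕ → ℂ := fun n => z ^ n / (n.factorial : ℂ)
  let S : A.Completion → A.Completion := fun x =>
    ∑ n ∈ Finset.range (K + 1), c n • (shiftT ^ n) x
  have h1 : ((expT z a * expT z b) Δ : V) = (S a * S b) Δ := by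
    rw [mul_apply, mul_apply]
    refine finsum_congr fun i => ?_
    by_cases hi : i < N
    · rw [hN _ i hi, hN (S a) i hi, A.prod_comm, A.prod_comm 0]
      exact (map_zero _).trans (map_zero _).symm
    by_cases hi2 : Δ - i < N
    · rw [hN _ _ hi2, hN (S b) _ hi2]
      exact (map_zero _).trans (map_zero _).symm
    · rw [expT_apply_eq_sum hN z a (K := K) (by omega),
        expT_apply_eq_sum hN z b (K := K) (by omega)]
  let f : ℕ × ℕ → V := fun p => ((c p.1 * c p.2) • ((shiftT ^ p.1) a * (shiftT ^ p.2) b)) Δ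
  have h2 : ((S a * S b) Δ : V) =
      ∑ p ∈ Finset.range (K + 1) ×ˢ Finset.range (K + 1), f p := by
    rw [Finset.sum_mul_sum, ← Finset.sum_product', sum_apply]
    refine Finset.sum_congr rfl fun p _ => ?_
    simp only [f, smul_mul_smul_comm]
  have h3 : ∀ p : ℕ × ℕ, K < p.1 + p.2 → f p = 0 := by
    intro p hp
    simp only [f]
    rw [smul_apply, mul_apply]
    refine smul_eq_zero_of_right _ ((finsum_congr fun i => ?_).trans finsum_zero)
    rw [shiftT_pow_apply, shiftT_pow_apply]
    by_cases hi : i - p.1 < N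
    · rw [hN a _ hi, map_zero, A.prod_comm]; exact map_zero _
    · rw [hN b _ (by omega), map_zero]; exact map_zero _
  have h4 : (expT z (a * b) Δ : V) =
      ∑ n ∈ Finset.range (K + 1), ∑ p ∈ Finset.HasAntidiagonal.antidiagonal n, f p := by
    rw [expT_apply_eq_sum hN z _ hK1, sum_apply]
    refine Finset.sum_congr rfl fun n _ => ?_
    rw [shiftT_pow_mul, Finset.smul_sum, sum_apply]
    refine Finset.sum_congr rfl fun p hp => ?_
    have hp := Finset.HasAntidiagonal.mem_antidiagonal.mp hp
    have hc : z ^ n / (n.factorial : ℂ) * (n.choose p.1 : ℂ) = c p.1 * c p.2 := by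
      rw [← hp, Nat.choose_symm_add, Nat.add_choose, Nat.cast_div (Nat.factorial_mul_factorial_dvd_factorial_add _ _)
        (Nat.cast_ne_zero.mpr (Nat.mul_ne_zero (Nat.factorial_ne_zero _) (Nat.factorial_ne_zero _)))]
      have := Nat.factorial_ne_zero p.1
      have := Nat.factorial_ne_zero p.2
      have := Nat.factorial_ne_zero (p.1 + p.2)
      simp only [c]
      push_cast
      field_simp
      rw [pow_add]
    rw [smul_smul, hc]
  rw [h4, h1, h2, Finset.sum_sigma']
  refine Finset.sum_bij_ne_zero (fun x _ _ => x.2) ?_ ?_ ?_ ?_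
  · rintro ⟨n, p⟩ h _
    simp only [Finset.mem_sigma, Finset.mem_range, Finset.HasAntidiagonal.mem_antidiagonal, Finset.mem_product]
      at h ⊢
    omega
  · rintro ⟨n, p⟩ h _ ⟨m, q⟩ h' _ e
    simp only [Finset.mem_sigma, Finset.mem_range, Finset.HasAntidiagonal.mem_antidiagonal] at h h' e
    obtain rfl := e
    obtain rfl : n = m := by omega
    rfl
  · intro p hp h
    refine ⟨⟨p.1 + p.2, p⟩, ?_, h, rfl⟩
    simp only [Finset.mem_sigma, Finset.mem_range, Finset.HasAntidiagonal.mem_antidiagonal, and_true]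
    by_contra hh
    exact h (h3 p (by omega))
  · intros; rfl

/-- The operator `q^{L₀}` on `V̄`, multiplying the component of weight `Δ` by `q ^ Δ`. -/
def rotL (q : Circle) (a : A.Completion) : A.Completion := fun Δ => (q : ℂ) ^ Δ • a Δ

theorem rotL_apply (q : Circle) (a : A.Completion) (Δ : ℤ) :
    (rotL q a Δ : V) = (q : ℂ) ^ Δ • (a Δ : V) := rfl

/-- `q^{L₀}` as a homomorphism of algebras. -/
def rotLHom (q : Circle) : A.Completion →ₐ[ℂ] A.Completion :=
  AlgHom.ofLinearMap
    { toFun := rotL q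
      map_add' := fun a b => ext fun Δ => by simp only [rotL_apply, add_apply, smul_add]
      map_smul' := fun r a => ext fun Δ => by
        simp only [rotL_apply, smul_apply, RingHom.id_apply, smul_comm r] }
    (ext fun Δ => by
      change ((rotL q (1 : A.Completion) Δ : A.gr Δ) : V) = _
      rw [rotL_apply, one_apply]
      split_ifs with h
      · rw [h, zpow_zero, one_smul]
      · rw [smul_zero])
    (fun a b => ext fun Δ => by
      change (rotL q (a * b) Δ : V) = ((rotL q a * rotL q b : A.Completion) Δ : V)
      rw [rotL_apply, mul_apply, mul_apply, smul_finsum]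
      refine finsum_congr fun i => ?_
      rw [rotL_apply, rotL_apply, A.prod_smul, A.prod_comm (_ • _), A.prod_smul, A.prod_comm,
        smul_smul, ← zpow_add₀ q.coe_ne_zero, sub_add_cancel])

/-- `e^{zT}` as a homomorphism of algebras. -/
def expTHom (z : ℂ) : A.Completion →ₐ[ℂ] A.Completion :=
  AlgHom.ofLinearMap
    { toFun := expT z
      map_add' := expT_add z
      map_smul' := expT_smul z }
    (expT_one z) (expT_mul z)

/-- The product topology on `V̄ = ∏_Δ V_Δ`, where each `V_Δ` carries its canonical topology. -/
instance : TopologicalSpace A.Completion :=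
  ⨅ Δ : ℤ, TopologicalSpace.induced (fun a : A.Completion => a Δ) (moduleTopology ℂ (A.gr Δ))

end Completion
end CommGradedVertexAlgebra

/-! ### Locally convex spaces and tensor products -/

/-- A locally convex space over `ℂ` (not necessarily Hausdorff). -/
structure LCS where
  /-- the underlying set -/
  carrier : Type u
  [addCommGroup : AddCommGroup carrier]
  [module : Module ℂ carrier]
  [topology : TopologicalSpace carrier]
  [isTopologicalAddGroup : IsTopologicalAddGroup carrier]
  [continuousSMul : ContinuousSMul ℂ carrier]
  [locallyConvex : LocallyConvexSpace ℝ carrier]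

instance : CoeSort LCS.{u} (Type u) := ⟨LCS.carrier⟩

attribute [instance] LCS.addCommGroup LCS.module LCS.topology LCS.isTopologicalAddGroup
  LCS.continuousSMul LCS.locallyConvex

section FinestTopology

variable {E : Type u} [AddCommGroup E] [Module ℂ E]

/-- `t` makes the complex vector space `E` a locally convex space. -/
structure IsLocallyConvexTopology (t : TopologicalSpace E) : Prop where
  isTopologicalAddGroup : @IsTopologicalAddGroup E t _
  continuousSMul : @ContinuousSMul ℂ E _ _ t
  locallyConvex : @LocallyConvexSpace ℝ E _ _ _ _ t

/-- The supremum of all locally convex topologies with the property `P`, that is, the finest one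
whenever `P` is stable under suprema, as is the case in all uses below. In Mathlib's order on
topologies the finest one is the least. -/
@[reducible]
def finestLC (P : TopologicalSpace E → Prop) : TopologicalSpace E :=
  sInf {t | IsLocallyConvexTopology t ∧ P t}

theorem isLocallyConvexTopology_finestLC (P : TopologicalSpace E → Prop) :
    IsLocallyConvexTopology (finestLC P) where
  isTopologicalAddGroup := topologicalAddGroup_sInf fun _ h => h.1.isTopologicalAddGroup
  continuousSMul := continuousSMul_sInf fun _ h => h.1.continuousSMul
  locallyConvex := LocallyConvexSpace.sInf fun _ h => h.1.locallyConvex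

/-- The locally convex space `E` with the topology `finestLC P`. -/
def LCS.ofFinest (P : TopologicalSpace E → Prop) : LCS.{u} :=
  letI := finestLC P
  letI := (isLocallyConvexTopology_finestLC P).isTopologicalAddGroup
  letI := (isLocallyConvexTopology_finestLC P).continuousSMul
  letI := (isLocallyConvexTopology_finestLC P).locallyConvex
  ⟨E⟩

end FinestTopology

/-- The topology of the inductive tensor product `X ⊗_ι Y`: the finest locally convex topology on
`X ⊗ Y` for which `X × Y → X ⊗ Y` is separately continuous. -/
@[reducible]
def inductiveTopology (X Y : LCS.{u}) : TopologicalSpace (X ⊗[ℂ] Y) :=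
  finestLC fun t =>
    (∀ x : X, @Continuous Y (X ⊗[ℂ] Y) _ t fun y => x ⊗ₜ y) ∧
    (∀ y : Y, @Continuous X (X ⊗[ℂ] Y) _ t fun x => x ⊗ₜ y)

/-- The topology of the projective tensor product `X ⊗_π Y`: the finest locally convex topology on
`X ⊗ Y` for which `X × Y → X ⊗ Y` is (jointly) continuous. -/
@[reducible]
def projectiveTopology (X Y : LCS.{u}) : TopologicalSpace (X ⊗[ℂ] Y) :=
  finestLC fun t => @Continuous (X × Y) (X ⊗[ℂ] Y) _ t fun p => p.1 ⊗ₜ p.2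

/-! ### Prefactorization and factorization algebras -/

/-- The data of a prefactorization algebra on `X` with values in locally convex spaces: the spaces
`F(U)`, the maps `F(U) → F(V)` for `U ⊆ V`, the multiplications `F(U) ⊗ F(V) → F(W)` for disjoint
`U, V` with `U ∪ V ⊆ W`, and the unit `ℂ → F(∅)`. -/
structure PrefactorizationData (X : Type) [TopologicalSpace X] where
  obj : Opens X → LCS.{u}
  map : ∀ {U V : Opens X}, U ≤ V → (obj U →ₗ[ℂ] obj V)
  mul : ∀ {U V W : Opens X}, Disjoint U V → U ⊔ V ≤ W → ((obj U) ⊗[ℂ] (obj V) →ₗ[ℂ] obj W)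
  unit : ℂ →ₗ[ℂ] obj ⊥

namespace PrefactorizationData

variable {X : Type} [TopologicalSpace X]

/-- The axioms of a prefactorization algebra with values in the symmetric monoidal category of
locally convex spaces and continuous linear maps, with the inductive tensor product. -/
structure IsPrefactorizationAlgebra (F : PrefactorizationData.{u} X) : Prop where
  continuous_map : ∀ {U V : Opens X} (h : U ≤ V), Continuous (F.map h)
  continuous_mul : ∀ {U V W : Opens X} (h : Disjoint U V) (h' : U ⊔ V ≤ W),
    @Continuous _ _ (inductiveTopology (F.obj U) (F.obj V)) _ (F.mul h h')
  continuous_unit : Continuous F.unit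
  map_id : ∀ U : Opens X, F.map (le_refl U) = LinearMap.id
  map_comp : ∀ {U V W : Opens X} (h : U ≤ V) (h' : V ≤ W),
    F.map h' ∘ₗ F.map h = F.map (h.trans h')
  map_mul : ∀ {U₁ U₂ V W : Opens X} (h : Disjoint U₁ U₂) (h₁ : U₁ ⊔ U₂ ≤ V) (h₂ : V ≤ W),
    F.map h₂ ∘ₗ F.mul h h₁ = F.mul h (h₁.trans h₂)
  mul_map : ∀ {U₁ U₂ V₁ V₂ W : Opens X} (h₁ : U₁ ≤ V₁) (h₂ : U₂ ≤ V₂) (h : Disjoint V₁ V₂)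
    (h' : V₁ ⊔ V₂ ≤ W),
    F.mul h h' ∘ₗ TensorProduct.map (F.map h₁) (F.map h₂) =
      F.mul (h.mono h₁ h₂) ((sup_le_sup h₁ h₂).trans h')
  mul_comm : ∀ {U₁ U₂ V : Opens X} (h : Disjoint U₁ U₂) (h' : U₁ ⊔ U₂ ≤ V),
    F.mul h.symm ((sup_comm U₂ U₁).trans_le h') ∘ₗ
      (TensorProduct.comm ℂ (F.obj U₁) (F.obj U₂)).toLinearMap = F.mul h h'
  mul_assoc : ∀ {U₁ U₂ U₃ V₁ V₂ W : Opens X} (h₁₂ : Disjoint U₁ U₂) (hV₁ : U₁ ⊔ U₂ ≤ V₁)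
    (h₂₃ : Disjoint U₂ U₃) (hV₂ : U₂ ⊔ U₃ ≤ V₂) (h₁ : Disjoint U₁ V₂) (h₁W : U₁ ⊔ V₂ ≤ W)
    (h₃ : Disjoint V₁ U₃) (h₃W : V₁ ⊔ U₃ ≤ W),
    F.mul h₃ h₃W ∘ₗ (F.mul h₁₂ hV₁).rTensor (F.obj U₃) =
      F.mul h₁ h₁W ∘ₗ (F.mul h₂₃ hV₂).lTensor (F.obj U₁) ∘ₗ
        (TensorProduct.assoc ℂ (F.obj U₁) (F.obj U₂) (F.obj U₃)).toLinearMap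
  unit_mul : ∀ U : Opens X,
    F.mul (disjoint_bot_left (a := U)) (bot_sup_eq U).le ∘ₗ F.unit.rTensor (F.obj U) =
      (TensorProduct.lid ℂ (F.obj U)).toLinearMap
  mul_unit : ∀ U : Opens X,
    F.mul (disjoint_bot_right (a := U)) (sup_bot_eq U).le ∘ₗ F.unit.lTensor (F.obj U) =
      (TensorProduct.rid ℂ (F.obj U)).toLinearMap

/-- The open sets `U_i` form a Weiss cover of `U`. -/
def IsWeissCover {I : Type} (U : Opens X) (c : I → Opens X) : Prop :=
  (⨆ i, c i) = U ∧ ∀ s : Finset X, (s : Set X) ⊆ U → ∃ i, (s : Set X) ⊆ c i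

/-- `F` is a factorization algebra with values in the symmetric monoidal category of locally convex
spaces with the inductive tensor product. The field `weiss` says that
`⨁_{i,j} F(U_i ∩ U_j) ⇉ ⨁_i F(U_i) → F(U)` is a coequalizer in the category of locally convex
spaces; here a morphism out of `⨁_i F(U_i)` is written as the family of its components. -/
structure IsFactorizationAlgebra (F : PrefactorizationData.{u} X) : Prop where
  isPrefactorizationAlgebra : F.IsPrefactorizationAlgebra
  weiss : ∀ {I : Type} (U : Opens X) (c : I → Opens X) (hc : IsWeissCover U c) (E : LCS.{u})
    (f : ∀ i, F.obj (c i) →L[ℂ] E),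
    (∀ (i j : I) (x : F.obj (c i ⊓ c j)),
      f i (F.map inf_le_left x) = f j (F.map inf_le_right x)) →
    ∃! g : F.obj U →L[ℂ] E, ∀ (i : I) (x : F.obj (c i)),
      g (F.map ((le_iSup c i).trans hc.1.le) x) = f i x
  mul_iso : ∀ {U V : Opens X} (h : Disjoint U V),
    @IsHomeomorph _ _ (inductiveTopology (F.obj U) (F.obj V)) _ (F.mul h (le_refl (U ⊔ V)))

/-- For open sets with finitely many connected components the multiplications of `F` are continuous
for the projective tensor product, and those into the disjoint union are isomorphisms for it. -/
structure IsProjectiveOnFinite (F : PrefactorizationData.{u} X) : Prop where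
  continuous_mul : ∀ {U V W : Opens X}, Finite (ConnectedComponents U) →
    Finite (ConnectedComponents V) → ∀ (h : Disjoint U V) (h' : U ⊔ V ≤ W),
    @Continuous _ _ (projectiveTopology (F.obj U) (F.obj V)) _ (F.mul h h')
  mul_iso : ∀ {U V : Opens X}, Finite (ConnectedComponents U) →
    Finite (ConnectedComponents V) → ∀ (h : Disjoint U V),
    @IsHomeomorph _ _ (projectiveTopology (F.obj U) (F.obj V)) _ (F.mul h (le_refl (U ⊔ V)))

/-- The multiplication `F(U₀) ⊗ ⋯ ⊗ F(Uₙ) → F(V)` for pairwise disjoint `U₀, …, Uₙ ⊆ V`, evaluated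
at `x₀ ⊗ ⋯ ⊗ xₙ`. -/
def multiMul (F : PrefactorizationData.{u} X) : ∀ (n : ℕ) (U : Fin (n + 1) → Opens X)
    (_ : Pairwise fun i j => Disjoint (U i) (U j)) (W : Opens X) (_ : ∀ i, U i ≤ W)
    (_ : ∀ i, F.obj (U i)), F.obj W
  | 0, _, _, _, hV, x => F.map (hV 0) (x 0)
  | n + 1, U, hU, V, hV, x =>
    F.mul (U := ⨆ i : Fin (n + 1), U i.castSucc) (V := U (Fin.last (n + 1)))
      (iSup_disjoint_iff.mpr fun i => hU (Fin.castSucc_lt_last i).ne)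
      (sup_le (iSup_le fun i => hV i.castSucc) (hV _))
      (F.multiMul n (fun i => U i.castSucc)
          (fun _ _ hij => hU fun h => hij (Fin.castSucc_injective _ h))
          (⨆ i : Fin (n + 1), U i.castSucc) (le_iSup fun i : Fin (n + 1) => U i.castSucc)
          (fun i => x i.castSucc) ⊗ₜ x (Fin.last (n + 1)))

end PrefactorizationData

/-! ### Equivariance -/

section Equivariant

variable {G : Type} [Group G] {X : Type} [TopologicalSpace X] [MulAction G X]
  [ContinuousConstSMul G X]

/-- The translate `aU` of an open set. -/
def smulOpens (a : G) (U : Opens X) : Opens X := ⟨a • (U : Set X), U.isOpen.smul a⟩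

theorem smulOpens_mono (a : G) {U V : Opens X} (h : U ≤ V) : smulOpens a U ≤ smulOpens a V :=
  Set.smul_set_mono (a := a) h

theorem smulOpens_mul (a b : G) (U : Opens X) :
    smulOpens a (smulOpens b U) = smulOpens (a * b) U :=
  Opens.ext (smul_smul a b (U : Set X))

theorem smulOpens_one (U : Opens X) : smulOpens (1 : G) U = U := Opens.ext (one_smul G (U : Set X))

theorem smulOpens_bot (a : G) : smulOpens a (⊥ : Opens X) = ⊥ := Opens.ext (Set.smul_set_empty)

theorem smulOpens_sup (a : G) (U V : Opens X) :
    smulOpens a (U ⊔ V) = smulOpens a U ⊔ smulOpens a V := Opens.ext (Set.smul_set_union)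

theorem smulOpens_disjoint (a : G) {U V : Opens X} (h : Disjoint U V) :
    Disjoint (smulOpens a U) (smulOpens a V) := by
  rw [← Opens.coe_disjoint] at h ⊢
  exact (Set.disjoint_smul_set (a := a)).mpr h

variable (G X) in
/-- A prefactorization datum together with maps `σ_{a,U} : F(U) → F(aU)` for `a ∈ G`. -/
structure EquivariantData extends PrefactorizationData.{u} X where
  act : ∀ (a : G) (U : Opens X), obj U →ₗ[ℂ] obj (smulOpens a U)

/-- The axioms of a `G`-equivariant prefactorization algebra. Where two open sets are equal only
propositionally, such as `a(bU)` and `(ab)U`, they are identified through the structure map of the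
inclusion, which is the identity. -/
structure EquivariantData.IsEquivariantPrefactorizationAlgebra
    (F : EquivariantData.{u} G X) : Prop where
  isPrefactorizationAlgebra : F.IsPrefactorizationAlgebra
  continuous_act : ∀ (a : G) (U : Opens X), Continuous (F.act a U)
  act_map : ∀ (a : G) {U V : Opens X} (h : U ≤ V),
    F.act a V ∘ₗ F.map h = F.map (smulOpens_mono a h) ∘ₗ F.act a U
  act_mul_act : ∀ (a b : G) (U : Opens X),
    F.map (smulOpens_mul a b U).le ∘ₗ F.act a (smulOpens b U) ∘ₗ F.act b U = F.act (a * b) U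
  act_one : ∀ U : Opens X, F.map (smulOpens_one (G := G) U).le ∘ₗ F.act 1 U = LinearMap.id
  act_mul : ∀ (a : G) {U V W : Opens X} (h : Disjoint U V) (h' : U ⊔ V ≤ W),
    F.act a W ∘ₗ F.mul h h' =
      F.mul (smulOpens_disjoint a h) ((smulOpens_sup a U V).ge.trans (smulOpens_mono a h')) ∘ₗ
        TensorProduct.map (F.act a U) (F.act a V)
  act_unit : ∀ a : G, F.map (smulOpens_bot a).le ∘ₗ F.act a ⊥ ∘ₗ F.unit = F.unit

end Equivariant

/-- The group `S¹ ⋉ ℂ` of orientation preserving isometries `w ↦ qw + z` of the plane. -/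
@[ext]
structure RigidMotion where
  rot : Circle
  trans : ℂ

namespace RigidMotion

instance : Mul RigidMotion := ⟨fun a b => ⟨a.rot * b.rot, a.trans + a.rot * b.trans⟩⟩
instance : One RigidMotion := ⟨⟨1, 0⟩⟩
instance : Inv RigidMotion := ⟨fun a => ⟨a.rot⁻¹, -((a.rot⁻¹ : Circle) * a.trans)⟩⟩

theorem mul_def (a b : RigidMotion) : a * b = ⟨a.rot * b.rot, a.trans + a.rot * b.trans⟩ := rfl
theorem one_def : (1 : RigidMotion) = ⟨1, 0⟩ := rfl
theorem inv_def (a : RigidMotion) : a⁻¹ = ⟨a.rot⁻¹, -((a.rot⁻¹ : Circle) * a.trans)⟩ := rfl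

instance : Group RigidMotion :=
  Group.ofLeftAxioms
    (fun a b c => by
      simp only [mul_def, _root_.mul_assoc, Circle.coe_mul]
      congr 1
      ring)
    (fun a => by simp [mul_def, one_def])
    (fun a => by simp [mul_def, one_def, inv_def])

instance : MulAction RigidMotion ℂ where
  smul a w := a.rot * w + a.trans
  one_smul w := by
    change ((1 : Circle) : ℂ) * w + 0 = w
    simp
  mul_smul a b w := by
    change ((a.rot * b.rot : Circle) : ℂ) * w + (a.trans + a.rot * b.trans) =
      a.rot * (b.rot * w + b.trans) + a.trans
    rw [Circle.coe_mul]
    ring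

theorem smul_def (a : RigidMotion) (w : ℂ) : a • w = a.rot * w + a.trans := rfl

instance : ContinuousConstSMul RigidMotion ℂ where
  continuous_const_smul a := by
    simp only [smul_def]
    fun_prop

theorem dist_smul (a : RigidMotion) (w w' : ℂ) : dist (a • w) (a • w') = dist w w' := by
  simp only [smul_def, dist_add_right]
  rw [dist_eq_norm, dist_eq_norm, ← mul_sub, norm_mul, Circle.norm_coe, one_mul]

end RigidMotion

/-! ### Discs, local constancy and holomorphicity -/

/-- The open disc `D_r(z)`. -/
def disc (z : ℂ) (r : ℝ) : Opens ℂ := ⟨Metric.ball z r, Metric.isOpen_ball⟩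

theorem disc_mono (z : ℂ) {r s : ℝ} (h : r ≤ s) : disc z r ≤ disc z s := Metric.ball_subset_ball h

theorem smul_disc (a : RigidMotion) (z : ℂ) (r : ℝ) : smulOpens a (disc z r) = disc (a • z) r := by
  ext w
  change w ∈ a • Metric.ball z r ↔ dist w (a • z) < r
  rw [Set.mem_smul_set_iff_inv_smul_mem, Metric.mem_ball, ← RigidMotion.dist_smul a, smul_inv_smul]

theorem rot_disc (q : Circle) (r : ℝ) : smulOpens (⟨q, 0⟩ : RigidMotion) (disc 0 r) = disc 0 r := by
  rw [smul_disc, RigidMotion.smul_def]; simp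

theorem trans_disc (z : ℂ) (r : ℝ) : smulOpens (⟨1, z⟩ : RigidMotion) (disc 0 r) = disc z r := by
  rw [smul_disc, RigidMotion.smul_def]; simp

/-- `F` is locally constant: `F(D_r(z)) → F(D_R(w))` is an isomorphism of locally convex spaces for
`0 < r < R ≤ ∞` and `D_r(z) ⊆ D_R(w)`, where `D_∞(w) = ℂ`. -/
structure PrefactorizationData.IsLocallyConstant (F : PrefactorizationData.{u} ℂ) : Prop where
  disc_disc : ∀ (z w : ℂ) (r R : ℝ), 0 < r → r < R → ∀ h : disc z r ≤ disc w R,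
    IsHomeomorph (F.map h)
  disc_top : ∀ (z : ℂ) (r : ℝ), 0 < r → IsHomeomorph (F.map (le_top : disc z r ≤ ⊤))

/-- A function with values in a locally convex space is complex differentiable at every point of
the open set `U ⊆ ℂⁿ`. -/
def IsHolomorphicOn {n : ℕ} {E : LCS.{u}} (f : (Fin n → ℂ) → E) (U : Set (Fin n → ℂ)) : Prop :=
  ∀ a ∈ U, ∃ ξ : Fin n → E,
    Tendsto (fun z => (‖WithLp.toLp 2 (z - a)‖⁻¹ : ℂ) • (f z - f a - ∑ i, (z i - a i) • ξ i))
      (𝓝[U \ {a}] a) (𝓝 0)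

namespace EquivariantData

variable (F : EquivariantData.{u} RigidMotion ℂ)

/-- The weight space `F(D_r(0))_Δ`. -/
def weight (r : ℝ) (Δ : ℤ) : Set (F.obj (disc 0 r)) :=
  {a | ∀ q : Circle, F.map (rot_disc q r).le (F.act ⟨q, 0⟩ (disc 0 r) a) = (q : ℂ) ^ Δ • a}

/-- `a` is a homogeneous element of weight `Δ` of the costalk `F⁰` at the origin, that is, a
compatible family of elements of weight `Δ` of the spaces `F(D_r(0))`. -/
def IsHomogeneous (Δ : ℤ) (a : ∀ r : {r : ℝ // 0 < r}, F.obj (disc 0 r)) : Prop :=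
  (∀ r : {r : ℝ // 0 < r}, a r ∈ F.weight r Δ) ∧
    ∀ (r s : {r : ℝ // 0 < r}) (h : r < s), F.map (disc_mono 0 h.le) (a r) = a s

/-- The configuration space of `n` distinct points in `D_R(0)`. -/
def conf (n : ℕ) (R : ℝ) : Set (Fin n → ℂ) :=
  {z | Function.Injective z ∧ ∀ i, z i ∈ disc 0 R}

/-- `r` is a radius for which the discs `D_r(z_i)` are disjoint and contained in `D_R(0)`. -/
def IsAdmissible {n : ℕ} (R : ℝ) (z : Fin n → ℂ) (r : ℝ) : Prop :=
  0 < r ∧ (Pairwise fun i j => Disjoint (disc (z i) r) (disc (z j) r)) ∧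
    ∀ i, disc (z i) r ≤ disc 0 R

open Classical in
/-- The map `μ^R_{z₀,…,zₙ}`, evaluated at `a₀ ⊗ ⋯ ⊗ aₙ`: restrict the `a_i` to `F(D_r(0))`,
translate them to `F(D_r(z_i))` and multiply them in `F(D_R(0))`, where `r` is any admissible
radius. The value `0` is never used when the `z_i` are distinct points of `D_R(0)`. -/
def mu (n : ℕ) (R : ℝ) (a : Fin (n + 1) → ∀ r : {r : ℝ // 0 < r}, F.obj (disc 0 r))
    (z : Fin (n + 1) → ℂ) : F.obj (disc 0 R) :=
  if h : ∃ r, IsAdmissible R z r then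
    F.multiMul n (fun i => disc (z i) h.choose) h.choose_spec.2.1 (disc 0 R) h.choose_spec.2.2
      (fun i => F.map (trans_disc (z i) h.choose).le
        (F.act ⟨1, z i⟩ (disc 0 h.choose) (a i ⟨h.choose, h.choose_spec.1⟩)))
  else 0

/-- `F` is a holomorphic prefactorization algebra. -/
structure IsHolomorphic : Prop where
  isEquivariant : F.IsEquivariantPrefactorizationAlgebra
  weight_bijOn : ∀ (r R : ℝ) (_ : 0 < r) (h : r < R) (Δ : ℤ),
    Set.BijOn (F.map (disc_mono 0 h.le)) (F.weight r Δ) (F.weight R Δ)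
  weight_bddBelow : ∀ R : ℝ, 0 < R → ∃ N : ℤ, ∀ Δ < N, F.weight R Δ = {0}
  quasiComplete : ∀ R : ℝ, 0 < R →
    @QuasiCompleteSpace ℂ (F.obj (disc 0 R)) _ (IsTopologicalAddGroup.rightUniformSpace _) _ _
  t2 : ∀ R : ℝ, 0 < R → T2Space (F.obj (disc 0 R))
  mu_holomorphic : ∀ (R : ℝ) (_ : 0 < R) (n : ℕ) (Δ : Fin (n + 1) → ℤ)
    (a : Fin (n + 1) → ∀ r : {r : ℝ // 0 < r}, F.obj (disc 0 r)),
    (∀ i, F.IsHomogeneous (Δ i) (a i)) → IsHolomorphicOn (F.mu n R a) (conf (n + 1) R)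

end EquivariantData

/-! ### Tensor powers of a commutative algebra -/

section Push

variable {A : Type u} [CommRing A] [Algebra ℂ A] {ι κ ν : Type} [Fintype ι] [Fintype κ]
  [Fintype ν]

open Classical in
theorem push_aux [DecidableEq ι] (f : ι → κ) (a : ι → A) (i : ι) (x : A) :
    (fun k => ∏ j with f j = k, Function.update a i x j) =
      Function.update (fun k => ∏ j with f j = k, a j) (f i)
        (x * ∏ j ∈ ({j | f j = f i} : Finset ι).erase i, a j) := by
  funext k
  by_cases hk : k = f i
  · subst hk
    rw [Function.update_self, ← Finset.mul_prod_erase _ _ (a := i) (by simp), Function.update_self]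
    refine congrArg (x * ·) (Finset.prod_congr rfl fun j hj => ?_)
    rw [Function.update_of_ne (Finset.ne_of_mem_erase hj)]
  · rw [Function.update_of_ne hk]
    refine Finset.prod_congr rfl fun j hj => ?_
    rw [Function.update_of_ne]
    rintro rfl
    exact hk (Finset.mem_filter.mp hj).2.symm

open Classical in
/-- The map `A^{⊗ι} → A^{⊗κ}` induced by `f : ι → κ`, sending `⨂_i a_i` to
`⨂_k ∏_{i ∈ f⁻¹(k)} a_i`. -/
def push (f : ι → κ) : (⨂[ℂ] _ : ι, A) →ₗ[ℂ] (⨂[ℂ] _ : κ, A) :=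
  PiTensorProduct.lift
    { toFun := fun a => PiTensorProduct.tprod ℂ fun k => ∏ i with f i = k, a i
      map_update_add' := fun a i x y => by
        simp only [push_aux, add_mul, MultilinearMap.map_update_add]
      map_update_smul' := fun a i c x => by
        simp only [push_aux, smul_mul_assoc, MultilinearMap.map_update_smul] }

open Classical in
theorem push_tprod (f : ι → κ) (a : ι → A) :
    push f (PiTensorProduct.tprod ℂ a) =
      PiTensorProduct.tprod ℂ fun k => ∏ i with f i = k, a i := by
  rw [push, PiTensorProduct.lift.tprod]
  rfl

theorem push_push (g : κ → ν) (f : ι → κ) (x : ⨂[ℂ] _ : ι, A) :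
    push g (push f x) = push (g ∘ f) x := by
  classical
  suffices h : push g ∘ₗ push f = push (A := A) (g ∘ f) from LinearMap.congr_fun h x
  refine PiTensorProduct.ext (MultilinearMap.ext fun a => ?_)
  simp only [LinearMap.compMultilinearMap_apply, LinearMap.comp_apply, push_tprod]
  congr 1
  funext k
  rw [← Finset.prod_fiberwise_of_maps_to (s := {i | (g ∘ f) i = k}) (t := {j | g j = k}) (g := f)
    (by simp)]
  refine Finset.prod_congr (by congr) fun j hj => Finset.prod_congr ?_ fun _ _ => rfl
  ext i
  simp only [Finset.mem_filter, Finset.mem_univ, true_and, Function.comp_apply] at hj ⊢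
  exact ⟨fun h => ⟨h ▸ hj, h⟩, fun h => h.2⟩

theorem push_map (φ : A →ₐ[ℂ] A) (f : ι → κ) (x : ⨂[ℂ] _ : ι, A) :
    push f (PiTensorProduct.map (fun _ => φ.toLinearMap) x) =
      PiTensorProduct.map (fun _ => φ.toLinearMap) (push f x) := by
  classical
  suffices h : push f ∘ₗ PiTensorProduct.map (fun _ => φ.toLinearMap) =
      PiTensorProduct.map (fun _ => φ.toLinearMap) ∘ₗ push (A := A) f from LinearMap.congr_fun h x
  refine PiTensorProduct.ext (MultilinearMap.ext fun a => ?_)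
  simp only [LinearMap.compMultilinearMap_apply, LinearMap.comp_apply, push_tprod,
    PiTensorProduct.map_tprod, AlgHom.toLinearMap_apply, map_prod]

theorem push_tmul {ι' κ' : Type} [Fintype ι'] [Fintype κ'] (f : ι → ι') (g : κ → κ')
    (x : ⨂[ℂ] _ : ι, A) (y : ⨂[ℂ] _ : κ, A) :
    PiTensorProduct.tmulEquiv ℂ A (push f x ⊗ₜ push g y) =
      push (Sum.map f g) (PiTensorProduct.tmulEquiv ℂ A (x ⊗ₜ y)) := by
  classical
  induction x using PiTensorProduct.induction_on with
  | add x x' hx hx' => simp only [map_add, TensorProduct.add_tmul, hx, hx']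
  | smul_tprod r a =>
    induction y using PiTensorProduct.induction_on with
    | add y y' hy hy' => simp only [map_add, TensorProduct.tmul_add, hy, hy']
    | smul_tprod s b =>
      simp only [map_smul, ← TensorProduct.smul_tmul', TensorProduct.tmul_smul, push_tprod]
      rw [PiTensorProduct.tmulEquiv_apply, PiTensorProduct.tmulEquiv_apply, push_tprod]
      refine congrArg (s • r • PiTensorProduct.tprod ℂ ·) (funext fun k => ?_)
      rw [Finset.prod_filter, Fintype.prod_sum_type]
      cases k <;> simp [Finset.prod_filter]

end Push

/-! ### Finite disjoint unions of discs -/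

/-- A disjoint union `D_{r_1}(z_1) ⊔ ⋯ ⊔ D_{r_l}(z_l)` of finitely many open discs, `l ≥ 0`. -/
structure DiscUnion where
  /-- the centres and radii of the discs -/
  discs : Finset (ℂ × ℝ)
  pos : ∀ d ∈ discs, 0 < d.2
  disjoint : ∀ d ∈ discs, ∀ e ∈ discs, d ≠ e → Disjoint (disc d.1 d.2) (disc e.1 e.2)

namespace DiscUnion

/-- The underlying open set. -/
def carrier (L : DiscUnion) : Opens ℂ := ⨆ d : L.discs, disc d.1.1 d.1.2

instance : Preorder DiscUnion := Preorder.lift carrier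

theorem le_def {L M : DiscUnion} : L ≤ M ↔ L.carrier ≤ M.carrier := Iff.rfl

theorem disc_le (L : DiscUnion) (d : L.discs) : disc d.1.1 d.1.2 ≤ L.carrier :=
  le_iSup (fun d : L.discs => disc d.1.1 d.1.2) d

theorem mem_disc (L : DiscUnion) (d : L.discs) : d.1.1 ∈ disc d.1.1 d.1.2 :=
  Metric.mem_ball_self (L.pos d.1 d.2)

theorem exists_index {L M : DiscUnion} (h : L ≤ M) (d : L.discs) :
    ∃ e : M.discs, disc d.1.1 d.1.2 ≤ disc e.1.1 e.1.2 := by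
  have h1 : d.1.1 ∈ M.carrier := h (L.disc_le d (L.mem_disc d))
  obtain ⟨e, he⟩ := Opens.mem_iSup.mp h1
  refine ⟨e, ?_⟩
  let v : Opens ℂ := ⨆ e' : {e' : M.discs // e' ≠ e}, disc e'.1.1.1 e'.1.1.2
  have hv : Disjoint (disc e.1.1 e.1.2) v := disjoint_iSup_iff.mpr fun e' =>
    M.disjoint e.1 e.2 e'.1.1 e'.1.2 fun h => e'.2 (Subtype.ext h.symm)
  have hsub : disc d.1.1 d.1.2 ≤ disc e.1.1 e.1.2 ⊔ v := by
    refine (L.disc_le d).trans (le_trans (le_def.mp h) (iSup_le fun e' => ?_))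
    by_cases he' : e' = e
    · exact he' ▸ le_sup_left
    · exact le_sup_of_le_right
        (le_iSup (fun e' : {e' : M.discs // e' ≠ e} => disc e'.1.1.1 e'.1.1.2) ⟨e', he'⟩)
  exact IsPreconnected.subset_left_of_subset_union (disc e.1.1 e.1.2).isOpen v.isOpen
    (Opens.coe_disjoint.mpr hv) hsub ⟨d.1.1, L.mem_disc d, he⟩
    (convex_ball d.1.1 d.1.2).isPreconnected

/-- For `L ⊆ M`, the map sending a disc of `L` to the disc of `M` that contains it. -/
def index {L M : DiscUnion} (h : L ≤ M) (d : L.discs) : M.discs := (exists_index h d).choose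

theorem disc_le_index {L M : DiscUnion} (h : L ≤ M) (d : L.discs) :
    disc d.1.1 d.1.2 ≤ disc (index h d).1.1 (index h d).1.2 := (exists_index h d).choose_spec

theorem index_eq {L M : DiscUnion} (h : L ≤ M) (d : L.discs) (e : M.discs)
    (he : disc d.1.1 d.1.2 ≤ disc e.1.1 e.1.2) : index h d = e := by
  by_contra hne
  have h1 := M.disjoint _ (index h d).2 _ e.2 fun h => hne (Subtype.ext h)
  rw [← Opens.coe_disjoint] at h1
  exact Set.disjoint_left.mp h1 (disc_le_index h d (L.mem_disc d)) (he (L.mem_disc d))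

theorem index_refl (L : DiscUnion) : index (le_refl L) = id :=
  funext fun d => index_eq _ d d le_rfl

theorem index_comp {L M N : DiscUnion} (h : L ≤ M) (h' : M ≤ N) :
    index h' ∘ index h = index (h.trans h') :=
  funext fun d => (index_eq _ d _ ((disc_le_index h d).trans (disc_le_index h' _))).symm

/-- The empty union of discs. -/
def empty : DiscUnion := ⟨∅, by simp, by simp⟩

theorem carrier_empty : empty.carrier = ⊥ :=
  le_bot_iff.mp (iSup_le fun d => absurd d.2 (Finset.notMem_empty _))

open Classical in
/-- The disjoint union of `L` and `M`. -/
def union (L M : DiscUnion) (h : Disjoint L.carrier M.carrier) : DiscUnion where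
  discs := L.discs ∪ M.discs
  pos d hd := (Finset.mem_union.mp hd).elim (L.pos d) (M.pos d)
  disjoint d hd e he hde := by
    rcases Finset.mem_union.mp hd with hd | hd <;> rcases Finset.mem_union.mp he with he | he
    · exact L.disjoint d hd e he hde
    · exact h.mono (L.disc_le ⟨d, hd⟩) (M.disc_le ⟨e, he⟩)
    · exact (h.mono (L.disc_le ⟨e, he⟩) (M.disc_le ⟨d, hd⟩)).symm
    · exact M.disjoint d hd e he hde

theorem carrier_union (L M : DiscUnion) (h : Disjoint L.carrier M.carrier) :
    (L.union M h).carrier = L.carrier ⊔ M.carrier := by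
  classical
  refine le_antisymm (iSup_le fun d => ?_) (sup_le (iSup_le fun d => ?_) (iSup_le fun d => ?_))
  · rcases Finset.mem_union.mp d.2 with hd | hd
    · exact le_sup_of_le_left (L.disc_le ⟨d, hd⟩)
    · exact le_sup_of_le_right (M.disc_le ⟨d, hd⟩)
  · exact (L.union M h).disc_le ⟨d, Finset.mem_union_left _ d.2⟩
  · exact (L.union M h).disc_le ⟨d, Finset.mem_union_right _ d.2⟩

theorem left_le_union (L M : DiscUnion) (h : Disjoint L.carrier M.carrier) : L ≤ L.union M h :=
  le_sup_left.trans (carrier_union L M h).ge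

theorem right_le_union (L M : DiscUnion) (h : Disjoint L.carrier M.carrier) : M ≤ L.union M h :=
  le_sup_right.trans (carrier_union L M h).ge

open Classical in
/-- The translate `aL`. -/
def smul (a : RigidMotion) (L : DiscUnion) : DiscUnion where
  discs := L.discs.image fun d => (a • d.1, d.2)
  pos d hd := by
    obtain ⟨d', hd', rfl⟩ := Finset.mem_image.mp hd
    exact L.pos d' hd'
  disjoint d hd e he hde := by
    obtain ⟨d', hd', rfl⟩ := Finset.mem_image.mp hd
    obtain ⟨e', he', rfl⟩ := Finset.mem_image.mp he
    simp only [← smul_disc]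
    exact smulOpens_disjoint a (L.disjoint d' hd' e' he' fun h => hde (by rw [h]))

open Classical in
/-- The bijection from the discs of `L` to those of `aL`. -/
def smulIndex (a : RigidMotion) (L : DiscUnion) (d : L.discs) : (L.smul a).discs :=
  ⟨(a • d.1.1, d.1.2), Finset.mem_image_of_mem _ d.2⟩

theorem carrier_smul (a : RigidMotion) (L : DiscUnion) :
    (L.smul a).carrier = smulOpens a L.carrier := by
  classical
  refine le_antisymm (iSup_le ?_) ?_
  · rintro ⟨d, hd⟩
    obtain ⟨d', hd', rfl⟩ := Finset.mem_image.mp hd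
    rw [← smul_disc]
    exact smulOpens_mono a (L.disc_le ⟨d', hd'⟩)
  · rintro w ⟨w, hw, rfl⟩
    obtain ⟨d, hd⟩ := Opens.mem_iSup.mp hw
    refine (L.smul a).disc_le (L.smulIndex a d) ?_
    change a • w ∈ disc (a • d.1.1) d.1.2
    rw [← smul_disc]
    exact Set.smul_mem_smul_set hd

theorem smul_mono (a : RigidMotion) {L M : DiscUnion} (h : L ≤ M) : L.smul a ≤ M.smul a := by
  rw [le_def, carrier_smul, carrier_smul]
  exact smulOpens_mono a h

theorem index_smulIndex (a : RigidMotion) {L M : DiscUnion} (h : L ≤ M) :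
    index (smul_mono a h) ∘ L.smulIndex a = M.smulIndex a ∘ index h :=
  funext fun d => index_eq _ _ _ (by
    change disc (a • _) _ ≤ disc (a • _) _
    rw [← smul_disc, ← smul_disc]
    exact smulOpens_mono a (disc_le_index h d))

end DiscUnion

/-! ### The locally constant factorization algebra of a commutative algebra -/

namespace FLoc

variable (R : Type u) [CommRing R] [Algebra ℂ R]

/-- The space `F(L) = R^{⊗l}` attached to a disjoint union `L` of `l` discs. -/
abbrev Base (L : DiscUnion) : Type u := ⨂[ℂ] _ : L.discs, R

/-- The map `F(L) → F(M)` for `L ⊆ M`: elements in discs of `L` that lie in the same disc of `M`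
are multiplied. -/
def baseMap {L M : DiscUnion} (h : L ≤ M) : Base R L →ₗ[ℂ] Base R M := push (DiscUnion.index h)

theorem baseMap_baseMap {L M N : DiscUnion} (h : L ≤ M) (h' : M ≤ N) (x : Base R L) :
    baseMap R h' (baseMap R h x) = baseMap R (h.trans h') x := by
  rw [baseMap, baseMap, push_push, DiscUnion.index_comp, baseMap]

/-- The map `F(L) ⊗ F(M) → F(N)` for disjoint `L`, `M` with `L ∪ M ⊆ N`. -/
def baseMul {L M N : DiscUnion} (h : L ≤ N) (h' : M ≤ N) :
    (Base R L) ⊗[ℂ] (Base R M) →ₗ[ℂ] Base R N :=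
  push (Sum.elim (DiscUnion.index h) (DiscUnion.index h')) ∘ₗ
    (PiTensorProduct.tmulEquiv ℂ R).toLinearMap

theorem baseMul_baseMap {L L' M M' N : DiscUnion} (hL : L ≤ L') (hM : M ≤ M') (h : L' ≤ N)
    (h' : M' ≤ N) (x : Base R L) (y : Base R M) :
    baseMul R h h' (baseMap R hL x ⊗ₜ baseMap R hM y) =
      baseMul R (hL.trans h) (hM.trans h') (x ⊗ₜ y) := by
  simp only [baseMul, LinearMap.comp_apply, LinearEquiv.coe_coe, baseMap]
  rw [push_tmul, push_push, Sum.elim_comp_map, DiscUnion.index_comp, DiscUnion.index_comp]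

theorem baseMap_baseMul {L M N N' : DiscUnion} (h : L ≤ N) (h' : M ≤ N) (hN : N ≤ N')
    (x : (Base R L) ⊗[ℂ] (Base R M)) :
    baseMap R hN (baseMul R h h' x) = baseMul R (h.trans hN) (h'.trans hN) x := by
  simp only [baseMul, LinearMap.comp_apply, LinearEquiv.coe_coe, baseMap]
  rw [push_push, Sum.comp_elim, DiscUnion.index_comp, DiscUnion.index_comp]

variable {R} in
/-- The map `F(L) → F(aL)` given by an algebra endomorphism `φ` in each tensor factor. -/
def baseAct (φ : R →ₐ[ℂ] R) (a : RigidMotion) (L : DiscUnion) :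
    Base R L →ₗ[ℂ] Base R (L.smul a) :=
  push (L.smulIndex a) ∘ₗ PiTensorProduct.map fun _ => φ.toLinearMap

variable {R} in
theorem baseMap_baseAct (φ : R →ₐ[ℂ] R) (a : RigidMotion) {L M : DiscUnion} (h : L ≤ M)
    (x : Base R L) :
    baseMap R (DiscUnion.smul_mono a h) (baseAct φ a L x) = baseAct φ a M (baseMap R h x) := by
  simp only [baseAct, LinearMap.comp_apply, baseMap]
  rw [push_push, DiscUnion.index_smulIndex, ← push_map, push_push]

/-- The disjoint unions of discs contained in `U`, ordered by inclusion. -/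
structure In (U : Opens ℂ) where
  val : DiscUnion
  le : val.carrier ≤ U

instance (U : Opens ℂ) : Preorder (In U) := Preorder.lift In.val

instance (U : Opens ℂ) : DecidableEq (In U) := Classical.decEq _

/-- The space `F(U)`, the colimit of the spaces `F(L)` over the unions of discs `L ⊆ U`. -/
abbrev Obj (U : Opens ℂ) : Type u :=
  Module.DirectLimit (fun L : In U => Base R L.val) fun _ _ h => baseMap R h

/-- The canonical map `F(L) → F(U)`. -/
def of {U : Opens ℂ} (L : DiscUnion) (h : L.carrier ≤ U) : Base R L →ₗ[ℂ] Obj R U :=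
  Module.DirectLimit.of ℂ (In U) (fun L : In U => Base R L.val) (fun _ _ h => baseMap R h) ⟨L, h⟩

theorem of_baseMap {U : Opens ℂ} {L M : DiscUnion} (hM : M.carrier ≤ U) (h : L ≤ M)
    (x : Base R L) : of R M hM (baseMap R h x) = of R L (le_trans h hM) x :=
  Module.DirectLimit.of_f (G := fun L : In U => Base R L.val) (f := fun _ _ h => baseMap R h)
    (i := ⟨L, le_trans h hM⟩) (j := ⟨M, hM⟩) (hij := h)

section Lift

variable {R} {U : Opens ℂ} {P : Type u} [AddCommMonoid P] [Module ℂ P]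

/-- The universal property of the colimit. -/
def lift (g : ∀ L : DiscUnion, L.carrier ≤ U → (Base R L →ₗ[ℂ] P))
    (hg : ∀ (L M : DiscUnion) (h : L ≤ M) (hM : M.carrier ≤ U) (x : Base R L),
      g M hM (baseMap R h x) = g L (le_trans h hM) x) : Obj R U →ₗ[ℂ] P :=
  Module.DirectLimit.lift ℂ (In U) (fun L : In U => Base R L.val) (fun _ _ h => baseMap R h)
    (fun L => g L.val L.le) fun L M h x => hg L.val M.val h M.le x

theorem lift_of (g : ∀ L : DiscUnion, L.carrier ≤ U → (Base R L →ₗ[ℂ] P))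
    (hg : ∀ (L M : DiscUnion) (h : L ≤ M) (hM : M.carrier ≤ U) (x : Base R L),
      g M hM (baseMap R h x) = g L (le_trans h hM) x) (L : DiscUnion) (hL : L.carrier ≤ U)
    (x : Base R L) : lift g hg (of R L hL x) = g L hL x :=
  Module.DirectLimit.lift_of (G := fun L : In U => Base R L.val) (f := fun _ _ h => baseMap R h)
    (i := ⟨L, hL⟩) (fun L => g L.val L.le) (fun L M h x => hg L.val M.val h M.le x) x

theorem hom_ext {f g : Obj R U →ₗ[ℂ] P}
    (h : ∀ (L : DiscUnion) (hL : L.carrier ≤ U) (x : Base R L),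
      f (of R L hL x) = g (of R L hL x)) : f = g :=
  Module.DirectLimit.hom_ext fun L => LinearMap.ext fun x => h L.val L.le x

end Lift

/-- The structure map `F(U) → F(W)` for `U ⊆ W`. -/
def map {U W : Opens ℂ} (h : U ≤ W) : Obj R U →ₗ[ℂ] Obj R W :=
  lift (fun L hL => of R L (hL.trans h)) fun _ _ hLM hM x => of_baseMap R (hM.trans h) hLM x

section Mul

variable {U V W : Opens ℂ} (h : Disjoint U V) (h' : U ⊔ V ≤ W)

/-- The multiplication `F(L) ⊗ F(M) → F(L ⊔ M) → F(W)` for `L ⊆ U` and `M ⊆ V`. -/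
def mulBase (L M : DiscUnion) (hL : L.carrier ≤ U) (hM : M.carrier ≤ V) :
    (Base R L) ⊗[ℂ] (Base R M) →ₗ[ℂ] Obj R W :=
  of R (L.union M (h.mono hL hM))
      ((DiscUnion.carrier_union L M _).trans_le ((sup_le_sup hL hM).trans h')) ∘ₗ
    baseMul R (DiscUnion.left_le_union L M _) (DiscUnion.right_le_union L M _)

theorem mulBase_baseMap {L L' M M' : DiscUnion} (hL' : L'.carrier ≤ U) (hM' : M'.carrier ≤ V)
    (hL : L ≤ L') (hM : M ≤ M') (x : Base R L) (y : Base R M) :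
    mulBase R h h' L' M' hL' hM' (baseMap R hL x ⊗ₜ baseMap R hM y) =
      mulBase R h h' L M (le_trans hL hL') (le_trans hM hM') (x ⊗ₜ y) := by
  have hu : L.union M (h.mono (le_trans hL hL') (le_trans hM hM')) ≤
      L'.union M' (h.mono hL' hM') := by
    rw [DiscUnion.le_def, DiscUnion.carrier_union, DiscUnion.carrier_union]
    exact sup_le_sup hL hM
  simp only [mulBase, LinearMap.comp_apply]
  rw [baseMul_baseMap, ← of_baseMap R _ hu, baseMap_baseMul]

theorem baseMap_refl (L : DiscUnion) (x : Base R L) : baseMap R (le_refl L) x = x := by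
  suffices h : baseMap R (le_refl L) = LinearMap.id from LinearMap.congr_fun h x
  classical
  refine PiTensorProduct.ext (MultilinearMap.ext fun a => ?_)
  simp only [LinearMap.compMultilinearMap_apply, baseMap, push_tprod, DiscUnion.index_refl,
    LinearMap.id_apply, id]
  congr 1
  funext k
  rw [Finset.prod_filter]
  simp

/-- The multiplication `F(L) ⊗ F(V) → F(W)` for `L ⊆ U`. -/
def mulLeft (L : DiscUnion) (hL : L.carrier ≤ U) : Base R L →ₗ[ℂ] Obj R V →ₗ[ℂ] Obj R W :=
  (lift (P := Base R L →ₗ[ℂ] Obj R W)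
    (fun M hM => (TensorProduct.curry (mulBase R h h' L M hL hM)).flip)
    fun M M' hMM' hM' y => LinearMap.ext fun x => by
      have := mulBase_baseMap R h h' hL hM' (le_refl L) hMM' x y
      rwa [baseMap_refl] at this).flip

theorem mulLeft_of (L M : DiscUnion) (hL : L.carrier ≤ U) (hM : M.carrier ≤ V) (x : Base R L)
    (y : Base R M) :
    mulLeft R h h' L hL x (of R M hM y) = mulBase R h h' L M hL hM (x ⊗ₜ y) := by
  rw [mulLeft, LinearMap.flip_apply, lift_of, LinearMap.flip_apply, TensorProduct.curry_apply]

/-- The multiplication `F(U) ⊗ F(V) → F(W)` for disjoint `U`, `V` with `U ∪ V ⊆ W`. -/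
def mul : (Obj R U) ⊗[ℂ] (Obj R V) →ₗ[ℂ] Obj R W :=
  TensorProduct.lift <| lift (fun L hL => mulLeft R h h' L hL)
    fun L L' hLL' hL' x => hom_ext fun M hM y => by
      rw [mulLeft_of, mulLeft_of]
      have := mulBase_baseMap R h h' hL' hM hLL' (le_refl M) x y
      rwa [baseMap_refl] at this

theorem mul_of_tmul_of (L M : DiscUnion) (hL : L.carrier ≤ U) (hM : M.carrier ≤ V) (x : Base R L)
    (y : Base R M) :
    mul R h h' (of R L hL x ⊗ₜ of R M hM y) = mulBase R h h' L M hL hM (x ⊗ₜ y) := by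
  rw [mul, TensorProduct.lift.tmul, lift_of, mulLeft_of]

end Mul

/-- The unit `ℂ → F(∅)`, which on `F(∅) = ℂ` is the identity: it sends `1` to the empty tensor. -/
def unit : ℂ →ₗ[ℂ] Obj R ⊥ :=
  LinearMap.toSpanSingleton ℂ _
    (of R DiscUnion.empty DiscUnion.carrier_empty.le (PiTensorProduct.tprod ℂ fun _ => 1))

variable {R} in
/-- The map `F(U) → F(aU)` induced by an algebra endomorphism `φ`. -/
def act (φ : R →ₐ[ℂ] R) (a : RigidMotion) (U : Opens ℂ) : Obj R U →ₗ[ℂ] Obj R (smulOpens a U) :=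
  lift
    (fun L hL => of R (L.smul a) ((L.carrier_smul a).trans_le (smulOpens_mono a hL)) ∘ₗ
      baseAct φ a L)
    fun L M hLM hM x => by
      simp only [LinearMap.comp_apply]
      rw [← baseMap_baseAct, of_baseMap]

variable [TopologicalSpace R]

/-- The projective tensor product topology on `F(L) = R^{⊗l}`. -/
@[reducible]
def baseTopology (L : DiscUnion) : TopologicalSpace (Base R L) :=
  finestLC fun t => @Continuous (L.discs → R) (Base R L) _ t (PiTensorProduct.tprod ℂ)

/-- `F(U)` as a locally convex space, with the topology of an inductive limit: the finest locally
convex topology for which all `F(L) → F(U)` are continuous. -/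
def lcs (U : Opens ℂ) : LCS.{u} :=
  LCS.ofFinest (E := Obj R U) fun t => ∀ (L : DiscUnion) (hL : L.carrier ≤ U),
    @Continuous (Base R L) (Obj R U) (baseTopology R L) t (of R L hL)

end FLoc

/-- The factorization algebra attached to a commutative algebra `R` with a topology and
to endomorphisms `φ_a` of `R`, `a ∈ S¹ ⋉ ℂ`. -/
def FLoc (R : Type u) [CommRing R] [Algebra ℂ R] [TopologicalSpace R]
    (φ : RigidMotion → (R →ₐ[ℂ] R)) : EquivariantData.{u} RigidMotion ℂ where
  obj := FLoc.lcs R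
  map := FLoc.map R
  mul h h' := FLoc.mul R h h'
  unit := FLoc.unit R
  act a := FLoc.act (φ a) a

/-- The factorization algebra attached to the completion `V̄`, with values in locally
convex spaces and with the equivariant structure in which `(q, z)` acts on `V̄` by `e^{zT} q^{L₀}`. -/
def CommGradedVertexAlgebra.FLoc {V : Type u} [AddCommGroup V] [Module ℂ V]
    (A : CommGradedVertexAlgebra V) : EquivariantData.{u} RigidMotion ℂ :=
  _root_.FLoc A.Completion fun a =>
    (Completion.expTHom a.trans).comp (Completion.rotLHom a.rot)

end

noncomputable section

set_option linter.unusedSectionVars false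

/-! ### The finest locally convex topology with a given property -/

section Finest

variable {E : Type u} [AddCommGroup E] [Module ℂ E]

/-! Write `R` for the completion. A finite set `s` of points of `U` with labels in `R` gives an
element `pt R U s a` of `F(U)`: small discs around the points, carrying the labels as tensor
factors. These elements span `F(U)`, so a linear map is determined by its values on them
(`hom_ext_pt`), and the algebraic axioms become identities between labelled finite sets. Conversely,
`liftPt` turns a function of labelled configurations into a linear map as soon as it is linear in
each label and does not change when points near given ones are merged, their labels being multiplied
(`IsMerging`).

The geometric input is `IsMerging.eq_of_components`: such a function depends only on the products of
the labels over the connected components of `U`. Indeed a connected open subset of the plane stays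
connected after removal of finitely many points, so a point can slide within its component until it
is close to another one, and then be merged with it. This is how invariance under merging in small
discs implies compatibility with inclusions of discs of any size.

Three structural statements follow. For a Weiss cover, every configuration lies in some member,
together with a small neighbourhood, so compatible functionals glue (`exists_glue`). For disjoint
`U`, `V` a configuration in the union splits into its two parts, which inverts the multiplication
(`split`). If `U` has finitely many components, `F(U)` is the tensor power of `R` over the set of
components (`toBase`), whence local constancy.

On the topological side, finite-dimensionality of the weight spaces makes `R` a countable product of
lines (`coordEquiv`). On such a space a continuous linear map sees only finitely many coordinates
modulo a given continuous seminorm, and a Baire category argument extends this to separately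
continuous multilinear maps (`exists_finset_seminorm_sub_eq_zero`). Modulo the seminorm the map
factors through a finite-rank truncation, so it is jointly continuous. Hence continuity of a linear
map on `F(U)` can be tested one label at a time (`continuous_obj_of_separately`), and separately
continuous bilinear maps on two tensor powers are jointly continuous
(`continuous_tensorPower_prod_of_separately`). The latter allows the projective tensor product when
there are finitely many components.

On a disc, multiplying all labels is an isomorphism onto `R` (`totalEquiv`). It carries weight
vectors to eigenvectors of `q^{L₀}`, and the product of translated elements to `∏ e^{z_i T} α_i`.
The coordinates of the latter are polynomials in the `z_i`, because the weights are bounded below.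
-/

theorem IsLocallyConvexTopology.induced {E' : Type*} [AddCommGroup E'] [Module ℂ E']
    [t : TopologicalSpace E'] [IsTopologicalAddGroup E'] [ContinuousSMul ℂ E']
    [LocallyConvexSpace ℝ E'] (f : E →ₗ[ℂ] E') : IsLocallyConvexTopology (t.induced f) where
  isTopologicalAddGroup := topologicalAddGroup_induced f
  continuousSMul := continuousSMul_induced f
  locallyConvex := LocallyConvexSpace.induced (f.restrictScalars ℝ)

/-- The topology pulled back along `f` is locally convex, so once it has the property `P` it is one
of the topologies that `finestLC P` refines. -/
theorem continuous_finestLC_dom {E' : Type*} [AddCommGroup E'] [Module ℂ E']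
    [t : TopologicalSpace E'] [IsTopologicalAddGroup E'] [ContinuousSMul ℂ E']
    [LocallyConvexSpace ℝ E'] {P : TopologicalSpace E → Prop} (f : E →ₗ[ℂ] E')
    (h : P (t.induced f)) : Continuous[finestLC P, t] f :=
  continuous_iff_le_induced.mpr (sInf_le ⟨IsLocallyConvexTopology.induced f, h⟩)

theorem continuous_finestLC_rng {X : Type*} [t : TopologicalSpace X] {P : TopologicalSpace E → Prop}
    {f : X → E} (h : ∀ t', P t' → Continuous[t, t'] f) : Continuous[t, finestLC P] f :=
  continuous_sInf_rng.mpr fun t' ht' => h t' ht'.2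

end Finest

/-! ### The projective topology on tensor powers -/

section TensorPower

variable {R : Type u} [AddCommGroup R] [Module ℂ R] [TopologicalSpace R] {ι κ : Type} [Fintype ι]
  [Fintype κ]

/-- For the discs of a `DiscUnion` this is `baseTopology` by definition. -/
instance tensorPowerTopology : TopologicalSpace (⨂[ℂ] _ : ι, R) :=
  finestLC fun t => @Continuous (ι → R) (⨂[ℂ] _ : ι, R) _ t (PiTensorProduct.tprod ℂ)

theorem isLocallyConvexTopology_tensorPower :
    IsLocallyConvexTopology (tensorPowerTopology : TopologicalSpace (⨂[ℂ] _ : ι, R)) :=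
  isLocallyConvexTopology_finestLC _

instance : IsTopologicalAddGroup (⨂[ℂ] _ : ι, R) :=
  isLocallyConvexTopology_tensorPower.isTopologicalAddGroup

instance : ContinuousSMul ℂ (⨂[ℂ] _ : ι, R) :=
  isLocallyConvexTopology_tensorPower.continuousSMul

instance : LocallyConvexSpace ℝ (⨂[ℂ] _ : ι, R) :=
  isLocallyConvexTopology_tensorPower.locallyConvex

theorem continuous_tprod :
    Continuous (PiTensorProduct.tprod ℂ : MultilinearMap ℂ (fun _ : ι => R) _) :=
  continuous_finestLC_rng fun _ h => h

variable {E : Type*} [AddCommGroup E] [Module ℂ E] [TopologicalSpace E]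
  [IsTopologicalAddGroup E] [ContinuousSMul ℂ E] [LocallyConvexSpace ℝ E]

theorem continuous_tensorPower_iff {f : (⨂[ℂ] _ : ι, R) →ₗ[ℂ] E} :
    Continuous f ↔ Continuous fun a : ι → R => f (PiTensorProduct.tprod ℂ a) :=
  ⟨fun h => h.comp continuous_tprod,
    fun h => continuous_finestLC_dom f (continuous_induced_rng.mpr h)⟩

end TensorPower

/-! ### Separately continuous maps on tensor powers of a product of lines -/

section Separate

variable {R : Type u} [AddCommGroup R] [Module ℂ R] [TopologicalSpace R] {I : Type*}
  {E : Type*} [AddCommGroup E] [Module ℂ E] {ι κ : Type}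

/-- A neighbourhood of zero in a product contains the subspace where finitely many coordinates
vanish, and a seminorm that is bounded on a subspace vanishes on it. -/
theorem exists_finset_seminorm_eq_zero (e : R ≃L[ℂ] (I → ℂ)) (p : Seminorm ℂ E) (g : R →ₗ[ℂ] E)
    (hg : Continuous fun x => p (g x)) :
    ∃ J : Finset I, ∀ x, (∀ k ∈ J, e x k = 0) → p (g x) = 0 := by
  have h1 : {x : I → ℂ | p (g (e.symm x)) < 1} ∈ 𝓝 (0 : I → ℂ) :=
    (isOpen_lt (hg.comp e.symm.continuous) continuous_const).mem_nhds (by simp)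
  rw [nhds_pi, Filter.mem_pi] at h1
  obtain ⟨J, hJ, t, ht, hsub⟩ := h1
  refine ⟨hJ.toFinset, fun x hx => ?_⟩
  have key : ∀ n : ℕ, n * p (g x) < 1 := fun n => by
    have : e ((n : ℂ) • x) ∈ {x : I → ℂ | p (g (e.symm x)) < 1} := hsub fun i hi => by
      rw [map_smul, Pi.smul_apply, hx i (hJ.mem_toFinset.mpr hi), smul_zero]
      exact mem_of_mem_nhds (ht i)
    simp only [Set.mem_ofPred_eq, e.symm_apply_apply, map_smul] at this
    rwa [map_smul_eq_mul, Complex.norm_natCast] at this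
  by_contra h
  obtain ⟨n, hn⟩ := exists_nat_gt (1 / p (g x))
  have hpos : 0 < p (g x) := lt_of_le_of_ne (apply_nonneg p _) (Ne.symm h)
  rw [div_lt_iff₀ hpos] at hn
  exact (key n).not_gt hn

variable [DecidableEq ι]

/-- Induction on the set `s` of arguments that may vary besides the `i`-th. If all other arguments
are fixed, this is the linear case. To free one more argument, the finite sets `J` obtained for its
individual values have to be replaced by a single one, which Baire category provides. -/
theorem exists_finset_seminorm_eq_zero_of_vary [Countable I] (e : R ≃L[ℂ] (I → ℂ))
    (p : Seminorm ℂ E)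
    (f : MultilinearMap ℂ (fun _ : ι => R) E)
    (hf : ∀ a i, Continuous fun x => p (f (Function.update a i x))) (i : ι) (s : Finset ι)
    (a : ι → R) :
    ∃ J : Finset I, ∀ x : ι → R, (∀ j, j ∉ s → j ≠ i → x j = a j) → (∀ k ∈ J, e (x i) k = 0) →
      p (f x) = 0 := by
  classical
  have : IsTopologicalAddGroup R := by
    have : Topology.IsInducing (e : R →+ (I → ℂ)) := e.toHomeomorph.isInducing
    exact this.topologicalAddGroup
  have : ContinuousSMul ℂ R := e.toHomeomorph.isInducing.continuousSMul continuous_id (by simp)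
  have : BaireSpace R := e.toHomeomorph.symm.baireSpace
  induction s using Finset.induction_on generalizing a with
  | empty =>
    obtain ⟨J, hJ⟩ := exists_finset_seminorm_eq_zero e p (f.toLinearMap a i) (hf a i)
    refine ⟨J, fun x hx hxi => ?_⟩
    have : x = Function.update a i (x i) := by
      funext j
      by_cases hj : j = i
      · subst hj; simp
      · rw [Function.update_of_ne hj, hx j (Finset.notMem_empty _) hj]
    rw [this]
    exact hJ _ hxi
  | insert k s hk ih =>
    -- The `i`-th argument is free already, so nothing is gained by adding `i` to `s`.
    by_cases hki : k = i
    · obtain ⟨J, hJ⟩ := ih a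
      exact ⟨J, fun x hx hxi => hJ x (fun j hj hji => hx j (by
        rw [Finset.mem_insert, not_or]; exact ⟨hki ▸ hji, hj⟩) hji) hxi⟩
    -- The values `r` of the `k`-th argument for which `J` works. These closed subspaces are
    -- countably many, because `I` is countable, and they cover `R` by induction. One of them has
    -- interior points, so it is all of `R`.
    let K (J : Finset I) : Submodule ℂ R :=
      { carrier := {r | ∀ x : ι → R, (∀ j, j ∉ insert k s → j ≠ i → x j = a j) →
          (∀ l ∈ J, e (x i) l = 0) → p (f (Function.update x k r)) = 0}
        zero_mem' := fun x _ _ => by rw [f.map_update_zero, map_zero]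
        add_mem' := fun {r r'} hr hr' x h1 h2 => by
          rw [f.map_update_add]
          refine le_antisymm ((map_add_le_add p _ _).trans ?_) (apply_nonneg p _)
          rw [hr x h1 h2, hr' x h1 h2, add_zero]
        smul_mem' := fun c r hr x h1 h2 => by
          rw [f.map_update_smul, map_smul_eq_mul, hr x h1 h2, mul_zero] }
    have hclosed : ∀ J, IsClosed (K J : Set R) := fun J => by
      have : (K J : Set R) = ⋂ (x : ι → R) (_ : ∀ j, j ∉ insert k s → j ≠ i → x j = a j)
          (_ : ∀ l ∈ J, e (x i) l = 0), {r | p (f (Function.update x k r)) = 0} := by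
        ext r; simp [K]
      rw [this]
      exact isClosed_iInter fun x => isClosed_iInter fun _ => isClosed_iInter fun _ =>
        isClosed_eq (hf x k) continuous_const
    have hunion : ⋃ J, (K J : Set R) = Set.univ := by
      refine Set.eq_univ_of_forall fun r => ?_
      obtain ⟨J, hJ⟩ := ih (Function.update a k r)
      refine Set.mem_iUnion.mpr ⟨J, fun x h1 h2 => hJ _ (fun j hj hji => ?_) ?_⟩
      · by_cases hjk : j = k
        · subst hjk; simp
        · rw [Function.update_of_ne hjk, Function.update_of_ne hjk]
          exact h1 j (by simp [hj, hjk]) hji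
      · rwa [Function.update_of_ne (Ne.symm hki)]
    obtain ⟨J, hJ⟩ := nonempty_interior_of_iUnion_of_closed hclosed hunion
    have htop := Submodule.eq_top_of_nonempty_interior' (K J) hJ
    refine ⟨J, fun x h1 h2 => ?_⟩
    have : x k ∈ K J := htop ▸ Submodule.mem_top
    have := this x h1 h2
    rwa [Function.update_eq_self] at this

/-- A separately continuous multilinear map on a product of lines only depends, up to a given
continuous seminorm, on finitely many coordinates. -/
theorem exists_finset_seminorm_sub_eq_zero [Countable I] [Fintype ι] (e : R ≃L[ℂ] (I → ℂ))
    (p : Seminorm ℂ E) (f : MultilinearMap ℂ (fun _ : ι => R) E)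
    (hf : ∀ a i, Continuous fun x => p (f (Function.update a i x))) :
    ∃ J : Finset I, ∀ x y : ι → R, (∀ i, ∀ k ∈ J, e (x i) k = e (y i) k) →
      p (f x - f y) = 0 := by
  classical
  choose J hJ using fun i => exists_finset_seminorm_eq_zero_of_vary e p f hf i Finset.univ 0
  refine ⟨Finset.univ.biUnion J, fun x y h => ?_⟩
  -- Pass from `y` to `x` one argument at a time. Each step changes `f` by its value at a tuple
  -- whose `i`-th entry is `x i - y i`, all of whose coordinates in `J` vanish.
  suffices H : ∀ s : Finset ι, p (f (s.piecewise x y) - f y) = 0 by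
    simpa using H Finset.univ
  intro s
  induction s using Finset.induction_on with
  | empty => simp
  | insert i s hi ih =>
    have h1 : p (f ((insert i s).piecewise x y) - f (s.piecewise x y)) = 0 := by
      have hy : s.piecewise x y = Function.update (s.piecewise x y) i (y i) := by
        rw [eq_comm, Function.update_eq_self_iff, Finset.piecewise_eq_of_notMem _ _ _ hi]
      conv_lhs => rw [hy, Finset.piecewise_insert, ← f.map_update_sub]
      refine hJ i _ (fun j hj => absurd (Finset.mem_univ j) hj) fun k hk => ?_
      rw [Function.update_self, map_sub, Pi.sub_apply, sub_eq_zero]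
      exact h i k (Finset.mem_biUnion.mpr ⟨i, Finset.mem_univ _, hk⟩)
    refine le_antisymm ?_ (apply_nonneg p _)
    rw [← sub_add_sub_cancel _ (f (s.piecewise x y))]
    exact (map_add_le_add p _ _).trans (by rw [h1, ih, add_zero])

end Separate

/-! ### Finite-rank truncation: separate continuity implies joint continuity on tensor powers. -/

section Truncation

variable {E : Type*} [AddCommGroup E] [Module ℂ E] [TopologicalSpace E]
  [IsTopologicalAddGroup E] [ContinuousSMul ℂ E] [LocallyConvexSpace ℝ E]

open scoped ComplexOrder in
theorem LocallyConvexSpace.complex_of_real : LocallyConvexSpace ℂ E :=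
  ⟨fun x => (LocallyConvexSpace.convex_basis (𝕜 := ℝ) x).congr
    (fun _ => and_congr_right fun _ =>
      ⟨fun h => convex_of_nonneg_surjective_algebraMap _
        (fun _ hx => RCLike.nonneg_iff_exists_ofReal.mp hx) h, fun h => h.lift ℝ⟩) fun _ _ => rfl⟩

-- Continuous seminorms generate the topology, and each of them cannot tell `h` from `h'`; the
-- comparison map may depend on the seminorm.
open scoped ComplexOrder in
theorem continuous_of_forall_seminorm {X : Type*} [TopologicalSpace X] (h : X → E)
    (H : ∀ p : Seminorm ℂ E, Continuous p → ∃ h' : X → E, Continuous h' ∧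
      ∀ x, p (h x - h' x) = 0) : Continuous h := by
  have : ContinuousSMul ℝ E := IsScalarTower.continuousSMul ℂ
  have : LocallyConvexSpace ℂ E := LocallyConvexSpace.complex_of_real
  have hws := with_gaugeSeminormFamily (𝕜 := ℂ) (E := E)
  refine continuous_iff_continuousAt.mpr fun x₀ => ?_
  rw [ContinuousAt, hws.tendsto_nhds]
  intro i ε hε
  set p := gaugeSeminormFamily ℂ E i with hp
  have hpc : Continuous p := hws.continuous_seminorm i
  obtain ⟨h', hc, hz⟩ := H p hpc
  have h1 : Continuous fun x => p (h' x - h' x₀) := hpc.comp (hc.sub continuous_const)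
  have h2 : ∀ᶠ x in 𝓝 x₀, p (h' x - h' x₀) < ε :=
    (isOpen_lt h1 continuous_const).mem_nhds (by simpa using hε)
  filter_upwards [h2] with x hx
  have e1 : h x - h x₀ = (h x - h' x) + (h' x - h' x₀) - (h x₀ - h' x₀) := by abel
  rw [e1]
  refine (map_sub_le_add p _ _).trans_lt ?_
  rw [hz x₀, add_zero]
  refine (map_add_le_add p _ _).trans_lt ?_
  rwa [hz x, zero_add]

variable {R : Type u} [AddCommGroup R] [Module ℂ R] [TopologicalSpace R] {I : Type*}
  {ι κ : Type} [Fintype ι] [Fintype κ]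

/-- The `k`-th coordinate with respect to an isomorphism with a product of lines. -/
def coordForm (e : R ≃L[ℂ] (I → ℂ)) (k : I) : R →ₗ[ℂ] ℂ := LinearMap.proj k ∘ₗ e.toLinearMap

theorem coordForm_apply (e : R ≃L[ℂ] (I → ℂ)) (k : I) (x : R) : coordForm e k x = e x k := rfl

theorem continuous_coordForm (e : R ≃L[ℂ] (I → ℂ)) (k : I) : Continuous (coordForm e k) :=
  (continuous_apply k).comp e.continuous

open Classical in
/-- The element with `k`-th coordinate one, all other coordinates being zero. -/
def coordVec (e : R ≃L[ℂ] (I → ℂ)) (k : I) : R := e.symm (Pi.single k 1)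

/-- The projection onto the span of finitely many coordinate vectors. -/
def truncate (e : R ≃L[ℂ] (I → ℂ)) (J : Finset I) : R →ₗ[ℂ] R :=
  ∑ k ∈ J, (coordForm e k).smulRight (coordVec e k)

theorem truncate_apply (e : R ≃L[ℂ] (I → ℂ)) (J : Finset I) (x : R) :
    truncate e J x = ∑ k ∈ J, e x k • coordVec e k := by
  simp [truncate, LinearMap.sum_apply, coordForm_apply]

theorem coord_truncate (e : R ≃L[ℂ] (I → ℂ)) (J : Finset I) (x : R) {k : I} (hk : k ∈ J) :
    e (truncate e J x) k = e x k := by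
  classical
  simp only [truncate_apply, map_sum, map_smul, coordVec, e.apply_symm_apply, Finset.sum_apply,
    Pi.smul_apply, Pi.single_apply, smul_eq_mul, mul_ite, mul_one, mul_zero]
  simp [hk]

/-- The product of coordinate forms on a tensor power. -/
def tensorCoord (e : R ≃L[ℂ] (I → ℂ)) (r : ι → I) : (⨂[ℂ] _ : ι, R) →ₗ[ℂ] ℂ :=
  PiTensorProduct.lift
    ((MultilinearMap.mkPiAlgebra ℂ ι ℂ).compLinearMap fun i => coordForm e (r i))

theorem tensorCoord_tprod (e : R ≃L[ℂ] (I → ℂ)) (r : ι → I) (a : ι → R) :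
    tensorCoord e r (PiTensorProduct.tprod ℂ a) = ∏ i, e (a i) (r i) := by
  simp [tensorCoord, coordForm_apply]

theorem continuous_tensorCoord (e : R ≃L[ℂ] (I → ℂ)) (r : ι → I) :
    Continuous (tensorCoord e r) := by
  rw [continuous_tensorPower_iff]
  simp only [tensorCoord_tprod]
  exact continuous_finsetProd _ fun i _ =>
    (continuous_coordForm e (r i)).comp (continuous_apply i)

-- Truncation has finite rank, so its tensor power is a finite sum of continuous functionals times
-- fixed vectors. Any linear map becomes continuous after composition with it.
open Classical in
theorem map_truncate (e : R ≃L[ℂ] (I → ℂ)) (J : Finset I) (u : ⨂[ℂ] _ : ι, R) :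
    PiTensorProduct.map (fun _ => truncate e J) u =
      ∑ r ∈ Fintype.piFinset fun _ : ι => J,
        tensorCoord e r u • PiTensorProduct.tprod ℂ fun i => coordVec e (r i) := by
  suffices h : PiTensorProduct.map (fun _ => truncate e J) =
      ∑ r ∈ Fintype.piFinset fun _ : ι => J, (tensorCoord e r).smulRight
        (PiTensorProduct.tprod ℂ fun i => coordVec e (r i)) by
    rw [h]; simp [LinearMap.sum_apply]
  refine PiTensorProduct.ext (MultilinearMap.ext fun a => ?_)
  simp only [LinearMap.compMultilinearMap_apply, PiTensorProduct.map_tprod, LinearMap.sum_apply,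
    LinearMap.smulRight_apply, tensorCoord_tprod, truncate_apply]
  rw [MultilinearMap.map_sum_finset]
  refine Finset.sum_congr rfl fun r _ => ?_
  rw [MultilinearMap.map_smul_univ]

/-- A separately continuous map on a tensor power of a countable product of lines is continuous. -/
theorem continuous_tensorPower_of_separately [Countable I] [DecidableEq ι] (e : R ≃L[ℂ] (I → ℂ))
    (g : (⨂[ℂ] _ : ι, R) →ₗ[ℂ] E)
    (hg : ∀ a i, Continuous fun x => g (PiTensorProduct.tprod ℂ (Function.update a i x))) :
    Continuous g := by
  refine continuous_of_forall_seminorm g fun p hp => ?_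
  obtain ⟨J, hJ⟩ := exists_finset_seminorm_sub_eq_zero e p
    (g.compMultilinearMap (PiTensorProduct.tprod ℂ)) fun a i => hp.comp (hg a i)
  -- A vector and its truncation have the same coordinates in `J`, so truncating all tensor factors
  -- does not change `g` modulo `p`.
  refine ⟨fun u => g (PiTensorProduct.map (fun _ => truncate e J) u), ?_, fun u => ?_⟩
  · simp only [map_truncate, map_sum, map_smul]
    exact continuous_finsetSum _ fun r _ => (continuous_tensorCoord e r).smul continuous_const
  · refine le_antisymm ?_ (apply_nonneg p _)
    dsimp only
    induction u using PiTensorProduct.induction_on with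
    | smul_tprod c a =>
      rw [map_smul, map_smul, map_smul, ← smul_sub, map_smul_eq_mul, PiTensorProduct.map_tprod]
      have := hJ a (fun i => truncate e J (a i)) fun i k hk => (coord_truncate e J _ hk).symm
      exact (mul_eq_zero_of_right _ this).le
    | add u v hu hv =>
      rw [map_add, map_add, map_add, add_sub_add_comm]
      exact (map_add_le_add p _ _).trans (add_nonpos hu hv)

/-- A separately continuous bilinear map on a product of two tensor powers of a countable product
of lines is jointly continuous. -/
theorem continuous_tensorPower_prod_of_separately [Countable I] [DecidableEq ι]
    [DecidableEq κ] (e : R ≃L[ℂ] (I → ℂ))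
    (B : (⨂[ℂ] _ : ι, R) →ₗ[ℂ] (⨂[ℂ] _ : κ, R) →ₗ[ℂ] E)
    (hB : ∀ (a : ι ⊕ κ → R) (i : ι ⊕ κ), Continuous fun x =>
      B (PiTensorProduct.tprod ℂ fun j => Function.update a i x (Sum.inl j))
      (PiTensorProduct.tprod ℂ fun j => Function.update a i x (Sum.inr j))) :
    Continuous fun u : (⨂[ℂ] _ : ι, R) × (⨂[ℂ] _ : κ, R) => B u.1 u.2 := by
  refine continuous_of_forall_seminorm _ fun p hp => ?_
  -- Read as a multilinear map in the arguments indexed by `ι ⊕ κ`, the map `B` yields one finite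
  -- set `J` that serves both factors.
  obtain ⟨J, hJ⟩ := exists_finset_seminorm_sub_eq_zero e p
    ((TensorProduct.lift B ∘ₗ (PiTensorProduct.tmulEquiv ℂ R).symm.toLinearMap).compMultilinearMap
      (PiTensorProduct.tprod ℂ)) fun a i => by
        simpa [PiTensorProduct.tmulEquiv_symm_apply, Function.comp_def] using hp.comp (hB a i)
  simp only [LinearMap.compMultilinearMap_apply, LinearMap.comp_apply, LinearEquiv.coe_coe,
    PiTensorProduct.tmulEquiv_symm_apply, TensorProduct.lift.tmul] at hJ
  refine ⟨fun u => B (PiTensorProduct.map (fun _ => truncate e J) u.1)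
    (PiTensorProduct.map (fun _ => truncate e J) u.2), ?_, fun ⟨u, v⟩ => ?_⟩
  · simp only [map_truncate, map_sum, map_smul, LinearMap.sum_apply, LinearMap.smul_apply]
    exact continuous_finsetSum _ fun r _ => ((continuous_tensorCoord e r).comp continuous_snd).smul
      (continuous_finsetSum _ fun r' _ =>
        ((continuous_tensorCoord e r').comp continuous_fst).smul continuous_const)
  · refine le_antisymm ?_ (apply_nonneg p _)
    dsimp only
    induction u using PiTensorProduct.induction_on with
    | smul_tprod c a =>
      induction v using PiTensorProduct.induction_on with
      | smul_tprod d b =>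
        simp only [map_smul, LinearMap.smul_apply, ← smul_sub, map_smul_eq_mul,
          PiTensorProduct.map_tprod]
        have := hJ (Sum.elim a b) (fun i => truncate e J (Sum.elim a b i))
          fun i k hk => (coord_truncate e J _ hk).symm
        exact (mul_eq_zero_of_right _ (mul_eq_zero_of_right _ this)).le
      | add u v hu hv =>
        rw [map_add, map_add, map_add, add_sub_add_comm]
        exact (map_add_le_add p _ _).trans (add_nonpos hu hv)
    | add u v hu hv =>
      rw [map_add, map_add, map_add, LinearMap.add_apply, LinearMap.add_apply, add_sub_add_comm]
      exact (map_add_le_add p _ _).trans (add_nonpos hu hv)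

end Truncation

/-! ### Complements of finite sets in connected open subsets of the plane -/

/-- A punctured disc is the image of a half-plane under the exponential function, shifted by the
centre. -/
theorem isPreconnected_ball_diff_center (x : ℂ) (r : ℝ) :
    IsPreconnected (Metric.ball x r \ {x}) := by
  rcases le_or_gt r 0 with hr | hr
  · rw [Metric.ball_eq_empty.mpr hr, Set.empty_sdiff]
    exact isPreconnected_empty
  · have h : Metric.ball x r \ {x} = (fun w => x + Complex.exp w) '' {w | w.re < Real.log r} := by
      ext z
      simp only [Set.mem_sdiff, Metric.mem_ball, Set.mem_singleton_iff, Set.mem_image,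
        Set.mem_ofPred_eq]
      constructor
      · rintro ⟨h1, h2⟩
        have h3 : z - x ≠ 0 := sub_ne_zero.mpr h2
        refine ⟨Complex.log (z - x), ?_, by rw [Complex.exp_log h3]; ring⟩
        rw [Complex.log_re]
        exact Real.log_lt_log (norm_pos_iff.mpr h3) (by rwa [← dist_eq_norm])
      · rintro ⟨w, hw, rfl⟩
        refine ⟨?_, by simp [Complex.exp_ne_zero]⟩
        rw [dist_eq_norm, add_sub_cancel_left, Complex.norm_exp]
        exact (Real.lt_log_iff_exp_lt hr).mp hw
    rw [h]
    exact (convex_halfSpace_re_lt _).isPreconnected.image _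
      (continuous_const.add Complex.continuous_exp).continuousOn

/-- If `u` and `v` separate `C \ {x}`, a punctured disc around `x` lies in one of them, say `u`.
Filling in the disc, `u ∪ ball` and `v \ {x}` separate `C`. -/
theorem IsPreconnected.diff_singleton_of_isOpen {C : Set ℂ} (hC : IsPreconnected C) (ho : IsOpen C)
    (x : ℂ) : IsPreconnected (C \ {x}) := by
  by_cases hx : x ∈ C
  swap
  · rwa [Set.sdiff_singleton_eq_self hx]
  obtain ⟨r, hr, hball⟩ := Metric.isOpen_iff.mp ho x hx
  rw [isPreconnected_iff_subset_of_disjoint]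
  have main : ∀ u v : Set ℂ, IsOpen u → IsOpen v → C \ {x} ⊆ u ∪ v → C \ {x} ∩ (u ∩ v) = ∅ →
      Metric.ball x r \ {x} ⊆ u → C \ {x} ⊆ u ∨ C \ {x} ⊆ v := by
    intro u v hu hv huv hd hb
    have hd' : ∀ z ∈ C, z ≠ x → z ∈ u → z ∉ v := fun z hz hzx h1 h2 =>
      Set.notMem_empty z (hd ▸ ⟨⟨hz, hzx⟩, h1, h2⟩)
    left
    have h1 : C ⊆ (u ∪ Metric.ball x r) ∪ (v \ {x}) := fun z hz => by
      by_cases hzx : z = x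
      · exact Or.inl (Or.inr (hzx ▸ Metric.mem_ball_self hr))
      · exact (huv ⟨hz, hzx⟩).elim (fun h => Or.inl (Or.inl h)) fun h => Or.inr ⟨h, hzx⟩
    have h2 : C ∩ ((u ∪ Metric.ball x r) ∩ (v \ {x})) = ∅ := by
      refine Set.eq_empty_of_forall_notMem ?_
      rintro z ⟨hz, h3 | h3, h4, h5⟩
      · exact hd' z hz h5 h3 h4
      · exact hd' z hz h5 (hb ⟨h3, h5⟩) h4
    rcases isPreconnected_iff_subset_of_disjoint.mp hC _ _ (hu.union Metric.isOpen_ball)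
      (hv.sdiff isClosed_singleton) h1 h2 with h | h
    · rintro z ⟨hz, hzx⟩
      exact (h hz).elim id fun h3 => hb ⟨h3, hzx⟩
    · exact absurd rfl (h hx).2
  intro u v hu hv huv hd
  have hsub : Metric.ball x r \ {x} ⊆ C \ {x} := Set.sdiff_subset_sdiff_left hball
  rcases isPreconnected_iff_subset_of_disjoint.mp (isPreconnected_ball_diff_center x r) u v hu hv
    (hsub.trans huv) (Set.eq_empty_of_subset_empty (hd ▸ Set.inter_subset_inter_left _ hsub))
    with h | h
  · exact main u v hu hv huv hd h
  · exact (main v u hv hu (Set.union_comm u v ▸ huv) (Set.inter_comm u v ▸ hd) h).symm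

theorem IsPreconnected.diff_finset_of_isOpen {C : Set ℂ} (hC : IsPreconnected C) (ho : IsOpen C)
    (s : Finset ℂ) : IsPreconnected (C \ s) := by
  induction s using Finset.cons_induction with
  | empty => simpa using hC
  | cons x s hx ih =>
    have h : C \ (Finset.cons x s hx : Finset ℂ) = (C \ s) \ {x} := by
      ext z; simp; tauto
    rw [h]
    exact ih.diff_singleton_of_isOpen (ho.sdiff s.finite_toSet.isClosed) x

/-! ### Configurations of labelled points -/

section Configuration

open Classical

/-- The discs of radius `ε` around the points of `s` are pairwise disjoint and contained in `U`. -/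
structure IsAdmissibleRadius (U : Opens ℂ) (s : Finset ℂ) (ε : ℝ) : Prop where
  pos : 0 < ε
  disjoint : ∀ z ∈ s, ∀ w ∈ s, z ≠ w → Disjoint (disc z ε) (disc w ε)
  le : ∀ z ∈ s, disc z ε ≤ U

theorem mem_disc_self {z : ℂ} {ε : ℝ} (h : 0 < ε) : z ∈ disc z ε := Metric.mem_ball_self h

theorem notMem_of_disjoint {U V : Opens ℂ} (h : Disjoint U V) {z : ℂ} (hU : z ∈ U) : z ∉ V :=
  Set.disjoint_left.mp (Opens.coe_disjoint.mpr h) hU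

namespace IsAdmissibleRadius

variable {U : Opens ℂ} {s : Finset ℂ} {ε δ : ℝ}

theorem mono_radius (h : IsAdmissibleRadius U s ε) (hδ : 0 < δ) (hle : δ ≤ ε) :
    IsAdmissibleRadius U s δ :=
  ⟨hδ, fun z hz w hw hzw => (h.disjoint z hz w hw hzw).mono (disc_mono _ hle) (disc_mono _ hle),
    fun z hz => (disc_mono _ hle).trans (h.le z hz)⟩

theorem mono {V : Opens ℂ} (h : IsAdmissibleRadius U s ε) (hU : U ≤ V) :
    IsAdmissibleRadius V s ε :=
  ⟨h.pos, h.disjoint, fun z hz => (h.le z hz).trans hU⟩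

theorem eq_of_mem (h : IsAdmissibleRadius U s ε) {z w x : ℂ} (hz : z ∈ s) (hw : w ∈ s)
    (h1 : x ∈ disc z ε) (h2 : x ∈ disc w ε) : z = w := by
  by_contra hzw
  exact notMem_of_disjoint (h.disjoint z hz w hw hzw) h1 h2

end IsAdmissibleRadius

theorem exists_isAdmissibleRadius {U : Opens ℂ} {s : Finset ℂ} (hs : (s : Set ℂ) ⊆ U) :
    ∃ ε, IsAdmissibleRadius U s ε := by
  induction s using Finset.cons_induction with
  | empty => exact ⟨1, one_pos, by simp, by simp⟩
  | cons x s hx ih =>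
    rw [Finset.coe_cons, Set.insert_subset_iff] at hs
    obtain ⟨ε, hε⟩ := ih hs.2
    obtain ⟨δ, hδ, hball⟩ := Metric.isOpen_iff.mp
      (U.isOpen.sdiff s.finite_toSet.isClosed) x ⟨hs.1, hx⟩
    have hdist : ∀ z ∈ s, δ ≤ dist z x := fun z hz => not_lt.mp fun h => (hball h).2 hz
    -- The points of `s` have distance at least `δ` from `x`, so discs of radius at most `δ / 2`
    -- around them miss the one around `x`.
    set η := min ε (δ / 2) with hη
    have hηpos : 0 < η := lt_min hε.pos (half_pos hδ)
    have h1 : ∀ z ∈ s, Disjoint (disc z η) (disc x η) := fun z hz => by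
      rw [← Opens.coe_disjoint]
      refine Metric.ball_disjoint_ball ((add_le_add (min_le_right _ _) (min_le_right _ _)).trans ?_)
      rw [add_halves]
      exact hdist z hz
    have h2 := hε.mono_radius hηpos (min_le_left _ _)
    refine ⟨η, hηpos, fun z hz w hw hzw => ?_, fun z hz => ?_⟩
    · rw [Finset.mem_cons] at hz hw
      rcases hz with rfl | hz <;> rcases hw with rfl | hw
      · exact absurd rfl hzw
      · exact (h1 w hw).symm
      · exact h1 z hz
      · exact h2.disjoint z hz w hw hzw
    · rw [Finset.mem_cons] at hz
      rcases hz with rfl | hz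
      · exact (Metric.ball_subset_ball ((min_le_right _ _).trans (half_le_self hδ.le))).trans
          fun w hw => (hball hw).1
      · exact h2.le z hz

variable {M : Type*} [CommMonoid M] {X : Type*} {U : Opens ℂ}

/-- A function of configurations of labelled points of `U` does not change when the points of a
configuration close to given points are merged. -/
def IsMerging (U : Opens ℂ) (P : Finset ℂ → (ℂ → M) → X) : Prop :=
  ∀ t : Finset ℂ, (t : Set ℂ) ⊆ U → ∃ ε, IsAdmissibleRadius U t ε ∧
    ∀ (s : Finset ℂ) (a b : ℂ → M), (∀ z ∈ s, ∃ w ∈ t, z ∈ disc w ε) →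
      (∀ w ∈ t, b w = ∏ z ∈ s with z ∈ disc w ε, a z) → P s a = P t b

namespace IsMerging

variable {P : Finset ℂ → (ℂ → M) → X} (hP : IsMerging U P) {s t : Finset ℂ} {a b : ℂ → M}
include hP

/-- A point of `t` without points of `s` in its small disc receives the empty product. -/
theorem insert_one (ht : (t : Set ℂ) ⊆ U) (hst : s ⊆ t) :
    P s a = P t fun z => if z ∈ s then a z else 1 := by
  obtain ⟨ε, hε, h⟩ := hP t ht
  refine h s a _ (fun z hz => ⟨z, hst hz, mem_disc_self hε.pos⟩) fun w hw => ?_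
  have : ({z ∈ s | z ∈ disc w ε} : Finset ℂ) = if w ∈ s then {w} else ∅ := by
    ext z
    rw [Finset.mem_filter]
    constructor
    · rintro ⟨h1, h2⟩
      obtain rfl := hε.eq_of_mem hw (hst h1) h2 (mem_disc_self hε.pos)
      simp [h1]
    · split_ifs with hws
      · rw [Finset.mem_singleton]; rintro rfl
        exact ⟨hws, mem_disc_self hε.pos⟩
      · simp
  rw [this]
  split_ifs <;> simp

/-- Inserting no points at all already replaces the labels off `s` by one. -/
theorem congr (hs : (s : Set ℂ) ⊆ U) (h : ∀ z ∈ s, a z = b z) : P s a = P s b := by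
  rw [hP.insert_one hs (Finset.Subset.refl s), hP.insert_one (a := b) hs (Finset.Subset.refl s)]
  congr 1
  funext z
  split_ifs with hz
  exacts [h z hz, rfl]

/-- For `y` close to `x`, the configuration with `y` merges into the one with `x`. So the value is
locally constant in the moving point along `C`, which is connected and avoids `t`. -/
theorem move (ht : (t : Set ℂ) ⊆ U) {C : Set ℂ} (hC : IsPreconnected C) (hCU : C ⊆ U)
    (hCt : Disjoint C t) {x y : ℂ} (hx : x ∈ C) (hy : y ∈ C) (r : M) :
    P (insert x t) (Function.update a x r) = P (insert y t) (Function.update a y r) := by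
  refine hC.induction₂ (fun x y => P (insert x t) (Function.update a x r) =
    P (insert y t) (Function.update a y r)) (fun x hx => ?_) (fun _ _ _ _ _ _ => Eq.trans)
    (fun _ _ _ _ => Eq.symm) hx hy
  have hxt : x ∉ t := fun h => Set.disjoint_left.mp hCt hx h
  obtain ⟨ε, hε, h⟩ := hP (insert x t) (by
    rw [Finset.coe_insert]; exact Set.insert_subset (hCU hx) ht)
  have hxt' : x ∈ insert x t := Finset.mem_insert_self x t
  filter_upwards [mem_nhdsWithin_of_mem_nhds ((disc x ε).isOpen.mem_nhds (mem_disc_self hε.pos)),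
    self_mem_nhdsWithin] with y hy hyC
  have hyt : y ∉ t := fun h => Set.disjoint_left.mp hCt hyC h
  refine (h (insert y t) _ _ (fun z hz => ?_) fun w hw => ?_).symm
  · rcases Finset.mem_insert.mp hz with rfl | hz
    · exact ⟨x, hxt', hy⟩
    · exact ⟨z, Finset.mem_insert_of_mem hz, mem_disc_self hε.pos⟩
  · have key : ({z ∈ insert y t | z ∈ disc w ε} : Finset ℂ) = {if w = x then y else w} := by
      ext z
      rw [Finset.mem_filter, Finset.mem_singleton]
      constructor
      · rintro ⟨h1, h2⟩
        rcases Finset.mem_insert.mp h1 with rfl | h1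
        · rw [if_pos (hε.eq_of_mem hw hxt' h2 hy)]
        · obtain rfl := hε.eq_of_mem hw (Finset.mem_insert_of_mem h1) h2 (mem_disc_self hε.pos)
          rw [if_neg]; rintro rfl; exact hxt h1
      · rintro rfl
        split_ifs with hwx
        · subst hwx; exact ⟨Finset.mem_insert_self _ _, hy⟩
        · exact ⟨Finset.mem_insert_of_mem ((Finset.mem_insert.mp hw).resolve_left hwx),
            mem_disc_self hε.pos⟩
    rw [key, Finset.prod_singleton]
    split_ifs with hwx
    · subst hwx; simp
    · have hwt := (Finset.mem_insert.mp hw).resolve_left hwx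
      rw [Function.update_of_ne hwx, Function.update_of_ne]
      rintro rfl; exact hyt hwt

/-- The component of `y` stays connected when the points of `t` are removed, so `x` can be moved
inside it to a point next to `y` and merged there. -/
theorem merge (ht : (t : Set ℂ) ⊆ U) {x y : ℂ} (hy : y ∈ t) (hxt : x ∉ t)
    (hx : x ∈ connectedComponentIn (U : Set ℂ) y) :
    P (insert x t) a = P t (Function.update a y (a x * a y)) := by
  obtain ⟨ε, hε, h⟩ := hP t ht
  set C := connectedComponentIn (U : Set ℂ) y \ t with hCdef
  have hC : IsPreconnected C :=
    isPreconnected_connectedComponentIn.diff_finset_of_isOpen U.isOpen.connectedComponentIn t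
  -- The target of the move: a point of the small disc around `y` other than `y`, hence not in `t`,
  -- since the disc contains no other point of `t`.
  set x' : ℂ := y + (ε / 2 : ℝ) with hx'
  have hx'y : x' ≠ y := by
    rw [hx', Ne, add_eq_left, Complex.ofReal_eq_zero]; exact (half_pos hε.pos).ne'
  have hx'd : x' ∈ disc y ε := by
    change dist x' y < ε
    rw [hx', dist_eq_norm, add_sub_cancel_left, Complex.norm_real, Real.norm_of_nonneg
      (half_pos hε.pos).le]
    exact half_lt_self hε.pos
  have hx't : x' ∉ t := fun h' =>
    hx'y (hε.eq_of_mem h' hy (mem_disc_self hε.pos) hx'd)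
  have hsub : (disc y ε : Set ℂ) ⊆ connectedComponentIn (U : Set ℂ) y :=
    (convex_ball y ε).isPreconnected.subset_connectedComponentIn (mem_disc_self hε.pos)
      (hε.le y hy)
  have h1 := hP.move (a := a) ht hC (Set.sdiff_subset.trans (connectedComponentIn_subset _ _))
    Set.disjoint_sdiff_left (x := x) (y := x') ⟨hx, hxt⟩ ⟨hsub hx'd, hx't⟩ (a x)
  rw [Function.update_eq_self] at h1
  rw [h1]
  refine h _ _ _ (fun z hz => ?_) fun w hw => ?_
  · rcases Finset.mem_insert.mp hz with rfl | hz
    · exact ⟨y, hy, hx'd⟩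
    · exact ⟨z, hz, mem_disc_self hε.pos⟩
  · have key : ({z ∈ insert x' t | z ∈ disc w ε} : Finset ℂ) = if w = y then {x', w} else {w} := by
      ext z
      rw [Finset.mem_filter]
      constructor
      · rintro ⟨h1, h2⟩
        rcases Finset.mem_insert.mp h1 with rfl | h1
        · rw [if_pos (hε.eq_of_mem hw hy h2 hx'd)]; simp
        · obtain rfl := hε.eq_of_mem hw h1 h2 (mem_disc_self hε.pos)
          split_ifs <;> simp
      · split_ifs with hwy
        · subst hwy
          rw [Finset.mem_insert, Finset.mem_singleton]
          rintro (rfl | rfl)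
          · exact ⟨Finset.mem_insert_self _ _, hx'd⟩
          · exact ⟨Finset.mem_insert_of_mem hw, mem_disc_self hε.pos⟩
        · rw [Finset.mem_singleton]; rintro rfl
          exact ⟨Finset.mem_insert_of_mem hw, mem_disc_self hε.pos⟩
    have hwx' : w ≠ x' := fun h' => hx't (h' ▸ hw)
    rw [key]
    split_ifs with hwy
    · subst hwy
      rw [Finset.prod_pair hwx'.symm, Function.update_self, Function.update_self,
        Function.update_of_ne hwx']
    · rw [Finset.prod_singleton, Function.update_of_ne hwy, Function.update_of_ne hwx']

/-- Apply `merge` to the points `z` of `s` one by one, each being absorbed by the representative `ρ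
z` of its component. -/
theorem absorb {T : Finset ℂ} {ρ : ℂ → ℂ} (hT : (T : Set ℂ) ⊆ U)
    (hρ : ∀ z ∈ U, z ∈ connectedComponentIn (U : Set ℂ) (ρ z)) (hs : (s : Set ℂ) ⊆ U)
    (hsT : Disjoint s T) (hρs : ∀ z ∈ s, ρ z ∈ T) :
    P (s ∪ T) a = P T fun c => a c * ∏ z ∈ s with ρ z = c, a z := by
  induction s using Finset.induction_on generalizing a with
  | empty => simp
  | insert x s hx ih =>
    rw [Finset.coe_insert, Set.insert_subset_iff] at hs
    rw [Finset.disjoint_insert_left] at hsT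
    have hρx := hρs x (Finset.mem_insert_self x s)
    rw [Finset.insert_union, hP.merge (y := ρ x) (by
      rw [Finset.coe_union]; exact Set.union_subset hs.2 hT)
      (Finset.mem_union_right _ hρx) (by rw [Finset.mem_union, not_or]; exact ⟨hx, hsT.1⟩)
      (hρ x hs.1), ih hs.2 hsT.2 fun z hz => hρs z (Finset.mem_insert_of_mem hz)]
    congr 1
    funext c
    have h1 : ∏ z ∈ s with ρ z = c, Function.update a (ρ x) (a x * a (ρ x)) z =
        ∏ z ∈ s with ρ z = c, a z := Finset.prod_congr rfl fun z hz => by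
      rw [Function.update_of_ne]
      rintro rfl
      exact Finset.disjoint_left.mp hsT.2 (Finset.mem_filter.mp hz).1 hρx
    rw [h1, Finset.filter_insert]
    by_cases hc : ρ x = c
    · subst hc
      rw [if_pos rfl, Finset.prod_insert (fun h => hx (Finset.mem_filter.mp h).1),
        Function.update_self, mul_comm (a x), mul_assoc]
    · rw [if_neg hc, Function.update_of_ne (Ne.symm hc)]

/-- A merging function only depends on the products of the labels over the connected
components. -/
theorem eq_of_components (hs : (s : Set ℂ) ⊆ U) (ht : (t : Set ℂ) ⊆ U)
    (h : ∀ z ∈ U, (∏ x ∈ s with connectedComponentIn (U : Set ℂ) x =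
        connectedComponentIn (U : Set ℂ) z, a x) =
      ∏ x ∈ t with connectedComponentIn (U : Set ℂ) x = connectedComponentIn (U : Set ℂ) z, b x) :
    P s a = P t b := by
  let κ : ℂ → Set ℂ := connectedComponentIn (U : Set ℂ)
  -- The choice depends only on the component of `z`, so points of the same component have literally
  -- the same representative.
  let ρ : ℂ → ℂ := fun z => Classical.epsilon fun w => w ∈ U ∧ κ w = κ z
  have hρ : ∀ z ∈ U, ρ z ∈ U ∧ κ (ρ z) = κ z := fun z hz =>
    Classical.epsilon_spec (p := fun w => w ∈ U ∧ κ w = κ z) ⟨z, hz, rfl⟩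
  have hρκ : ∀ z w, κ z = κ w → ρ z = ρ w := fun z w hzw => by simp only [ρ, hzw]
  have hρmem : ∀ z ∈ U, z ∈ κ (ρ z) := fun z hz => by
    rw [(hρ z hz).2]; exact mem_connectedComponentIn hz
  let T : Finset ℂ := (s ∪ t).image ρ
  have hT : (T : Set ℂ) ⊆ U := fun c hc => by
    obtain ⟨z, hz, rfl⟩ := Finset.mem_image.mp (Finset.mem_coe.mp hc)
    exact (hρ z ((Finset.mem_union.mp hz).elim (fun h => hs h) fun h => ht h)).1
  have hρT : ∀ c ∈ T, ρ c = c := fun c hc => by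
    obtain ⟨z, hz, rfl⟩ := Finset.mem_image.mp hc
    exact hρκ _ _ (hρ z ((Finset.mem_union.mp hz).elim (fun h => hs h) fun h => ht h)).2
  -- Both sides are brought to the normal form on `T`, the representatives of all components that
  -- meet `s` or `t`.
  have main : ∀ (s : Finset ℂ) (a : ℂ → M), (s : Set ℂ) ⊆ U → (∀ z ∈ s, ρ z ∈ T) →
      P s a = P T fun c => ∏ z ∈ s with κ z = κ c, a z := by
    intro s a hs hsT
    have hsTU : ((s ∪ T : Finset ℂ) : Set ℂ) ⊆ U := by
      rw [Finset.coe_union]; exact Set.union_subset hs hT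
    -- As `s` may meet `T`, all of `T` is first inserted with label one, and only the points of `s \
    -- T` are then absorbed.
    rw [hP.insert_one hsTU Finset.subset_union_left, ← Finset.sdiff_union_self_eq_union,
      hP.absorb hT hρmem (fun z hz => hs (Finset.mem_sdiff.mp (Finset.mem_coe.mp hz)).1)
        Finset.sdiff_disjoint fun z hz => hsT z (Finset.mem_sdiff.mp hz).1]
    refine hP.congr hT fun c hc => ?_
    have h1 : ({z ∈ s | κ z = κ c} : Finset ℂ) =
        {z ∈ s \ T | ρ z = c} ∪ if c ∈ s then {c} else ∅ := by
      ext z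
      simp only [Finset.mem_filter, Finset.mem_union, Finset.mem_sdiff]
      constructor
      · rintro ⟨hz, hzc⟩
        have hzc' : ρ z = c := (hρκ _ _ hzc).trans (hρT c hc)
        by_cases hzT : z ∈ T
        · right
          obtain rfl : z = c := (hρT z hzT).symm.trans hzc'
          simp [hz]
        · exact Or.inl ⟨⟨hz, hzT⟩, hzc'⟩
      · rintro (⟨⟨hz, -⟩, rfl⟩ | hz)
        · exact ⟨hz, (hρ z (hs hz)).2.symm⟩
        · split_ifs at hz with hcs
          · rw [Finset.mem_singleton] at hz
            subst hz
            exact ⟨hcs, rfl⟩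
          · exact absurd hz (Finset.notMem_empty z)
    have h2 : Disjoint ({z ∈ s \ T | ρ z = c} : Finset ℂ) (if c ∈ s then {c} else ∅) := by
      rw [Finset.disjoint_left]
      intro z hz hz'
      split_ifs at hz'
      · rw [Finset.mem_singleton] at hz'
        exact (Finset.mem_sdiff.mp (Finset.mem_filter.mp hz).1).2 (hz' ▸ hc)
      · exact Finset.notMem_empty z hz'
    rw [h1, Finset.prod_union h2, mul_comm]
    congr 1
    · refine Finset.prod_congr rfl fun z hz => ?_
      rw [if_pos (Finset.mem_sdiff.mp (Finset.mem_filter.mp hz).1).1]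
    · split_ifs <;> simp
  rw [main s a hs fun z hz => Finset.mem_image_of_mem _ (Finset.mem_union_left _ hz),
    main t b ht fun z hz => Finset.mem_image_of_mem _ (Finset.mem_union_right _ hz)]
  exact hP.congr hT fun c hc => h c (hT hc)

end IsMerging

end Configuration

/-! ### Labelled points in the factorization algebra -/

theorem push_tprod_of_decidableEq {A : Type u} [CommRing A] [Algebra ℂ A] {ι κ : Type} [Fintype ι]
    [Fintype κ] [DecidableEq κ] (f : ι → κ) (a : ι → A) :
    push f (PiTensorProduct.tprod ℂ a) =
      PiTensorProduct.tprod ℂ fun k => ∏ i with f i = k, a i := by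
  rw [push_tprod]
  congr! 4

section Points

open Classical

namespace DiscUnion

variable {L M : DiscUnion}

theorem eq_of_mem (L : DiscUnion) {d e : L.discs} {x : ℂ} (hd : x ∈ disc d.1.1 d.1.2)
    (he : x ∈ disc e.1.1 e.1.2) : d = e := by
  by_contra h
  exact notMem_of_disjoint (L.disjoint d.1 d.2 e.1 e.2 fun h' => h (Subtype.ext h')) hd he

theorem index_eq_iff (h : L ≤ M) (d : L.discs) (e : M.discs) :
    index h d = e ↔ d.1.1 ∈ disc e.1.1 e.1.2 :=
  ⟨fun h' => h' ▸ disc_le_index h d (L.mem_disc d),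
    fun h' => M.eq_of_mem (disc_le_index h d (L.mem_disc d)) h'⟩

theorem center_injective (L : DiscUnion) : Function.Injective fun d : L.discs => d.1.1 :=
  fun d e h => L.eq_of_mem (L.mem_disc d) (by rw [show d.1.1 = e.1.1 from h]; exact L.mem_disc e)

/-- The centres of the discs of `L`. -/
def centers (L : DiscUnion) : Finset ℂ := L.discs.image Prod.fst

theorem mem_centers {z : ℂ} : z ∈ L.centers ↔ ∃ d : L.discs, d.1.1 = z := by
  simp [centers]

theorem centers_subset (L : DiscUnion) : (L.centers : Set ℂ) ⊆ L.carrier := fun z hz => by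
  obtain ⟨d, rfl⟩ := mem_centers.mp (Finset.mem_coe.mp hz)
  exact L.disc_le d (L.mem_disc d)

/-- The labels of the centres of the discs of `L` given by labels of the discs. -/
def label {M : Type*} [One M] (L : DiscUnion) (a : L.discs → M) (z : ℂ) : M :=
  if h : ∃ d : L.discs, d.1.1 = z then a h.choose else 1

theorem label_center {M : Type*} [One M] (L : DiscUnion) (a : L.discs → M) (d : L.discs) :
    L.label a d.1.1 = a d := by
  have h : ∃ e : L.discs, e.1.1 = d.1.1 := ⟨d, rfl⟩
  rw [label, dif_pos h, L.center_injective h.choose_spec]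

theorem filter_centers (L : DiscUnion) (d : L.discs) :
    ({z ∈ L.centers | z ∈ disc d.1.1 d.1.2} : Finset ℂ) = {d.1.1} := by
  ext z
  rw [Finset.mem_filter, Finset.mem_singleton, mem_centers]
  constructor
  · rintro ⟨⟨e, rfl⟩, h⟩
    rw [L.eq_of_mem h (L.mem_disc e)]
  · rintro rfl
    exact ⟨⟨d, rfl⟩, L.mem_disc d⟩

end DiscUnion

namespace IsAdmissibleRadius

variable {U : Opens ℂ} {s : Finset ℂ} {ε : ℝ}

theorem filter_mem_disc (h : IsAdmissibleRadius U s ε) {w : ℂ} (hw : w ∈ s) :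
    ({z ∈ s | z ∈ disc w ε} : Finset ℂ) = {w} := by
  ext z
  rw [Finset.mem_filter, Finset.mem_singleton]
  constructor
  · rintro ⟨h1, h2⟩
    exact h.eq_of_mem h1 hw (mem_disc_self h.pos) h2
  · rintro rfl
    exact ⟨hw, mem_disc_self h.pos⟩

/-- The union of the discs of radius `ε` around the points of `s`. -/
def discUnion (h : IsAdmissibleRadius U s ε) : DiscUnion where
  discs := s.image fun z => (z, ε)
  pos d hd := by
    obtain ⟨z, -, rfl⟩ := Finset.mem_image.mp hd
    exact h.pos
  disjoint d hd e he hde := by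
    obtain ⟨z, hz, rfl⟩ := Finset.mem_image.mp hd
    obtain ⟨w, hw, rfl⟩ := Finset.mem_image.mp he
    exact h.disjoint z hz w hw fun h' => hde (by rw [h'])

theorem mem_discs (h : IsAdmissibleRadius U s ε) {d : ℂ × ℝ} :
    d ∈ h.discUnion.discs ↔ d.1 ∈ s ∧ d.2 = ε := by
  obtain ⟨z, r⟩ := d
  simp only [discUnion, Finset.mem_image, Prod.mk.injEq]
  constructor
  · rintro ⟨w, hw, rfl, rfl⟩; exact ⟨hw, rfl⟩
  · rintro ⟨hw, rfl⟩; exact ⟨z, hw, rfl, rfl⟩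

theorem discUnion_carrier_le (h : IsAdmissibleRadius U s ε) {W : Opens ℂ}
    (hW : ∀ z ∈ s, disc z ε ≤ W) : h.discUnion.carrier ≤ W :=
  iSup_le fun d => by
    obtain ⟨h1, h2⟩ := h.mem_discs.mp d.2
    rw [h2]; exact hW _ h1

theorem discUnion_le (h : IsAdmissibleRadius U s ε) : h.discUnion.carrier ≤ U :=
  h.discUnion_carrier_le h.le

theorem disc_le_discUnion (h : IsAdmissibleRadius U s ε) {z : ℂ} (hz : z ∈ s) :
    disc z ε ≤ h.discUnion.carrier :=
  h.discUnion.disc_le ⟨(z, ε), h.mem_discs.mpr ⟨hz, rfl⟩⟩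

end IsAdmissibleRadius

namespace FLoc

variable (R : Type u) [CommRing R] [Algebra ℂ R] {U V W : Opens ℂ} {s t : Finset ℂ} {a b : ℂ → R}

theorem baseMap_tprod {L M : DiscUnion} (h : L ≤ M) (a : ℂ → R) :
    baseMap R h (PiTensorProduct.tprod ℂ fun d => a d.1.1) =
      PiTensorProduct.tprod ℂ fun d => ∏ z ∈ L.centers with z ∈ disc d.1.1 d.1.2, a z := by
  rw [baseMap, push_tprod_of_decidableEq]
  congr 1
  funext k
  refine Finset.prod_bij (fun d _ => d.1.1) (fun d hd => ?_) (fun d _ e _ h => L.center_injective h)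
    (fun z hz => ?_) fun _ _ => rfl
  · rw [Finset.mem_filter, DiscUnion.index_eq_iff] at hd
    exact Finset.mem_filter.mpr ⟨DiscUnion.mem_centers.mpr ⟨d, rfl⟩, hd.2⟩
  · obtain ⟨h1, h2⟩ := Finset.mem_filter.mp hz
    obtain ⟨d, rfl⟩ := DiscUnion.mem_centers.mp h1
    exact ⟨d, Finset.mem_filter.mpr ⟨Finset.mem_univ _, (DiscUnion.index_eq_iff h d k).mpr h2⟩, rfl⟩

theorem centers_discUnion {ε : ℝ} (h : IsAdmissibleRadius U s ε) : h.discUnion.centers = s := by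
  ext z
  simp only [DiscUnion.centers, Finset.mem_image, h.mem_discs]
  constructor
  · rintro ⟨d, hd, rfl⟩; exact hd.1
  · intro hz; exact ⟨(z, ε), ⟨hz, rfl⟩, rfl⟩

/-- The class in `F(U)` of small discs around the points of `s ⊆ U` with labels `a`. -/
def pt (U : Opens ℂ) (s : Finset ℂ) (a : ℂ → R) : Obj R U :=
  if h : ∃ ε, IsAdmissibleRadius U s ε then
    of R h.choose_spec.discUnion h.choose_spec.discUnion_le
      (PiTensorProduct.tprod ℂ fun d => a d.1.1)
  else 0

/-- Discs around the points of `s` that are small enough lie both in those used for `pt` and in `L`,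
and can be compared with either through the colimit. In particular the radius chosen in `pt` is
immaterial. -/
theorem pt_eq_of {L : DiscUnion} (hL : L.carrier ≤ U) (hs : (s : Set ℂ) ⊆ L.carrier) :
    pt R U s a = of R L hL (PiTensorProduct.tprod ℂ fun d =>
      ∏ z ∈ s with z ∈ disc d.1.1 d.1.2, a z) := by
  have h : ∃ ε, IsAdmissibleRadius U s ε := exists_isAdmissibleRadius (hs.trans hL)
  rw [pt, dif_pos h]
  obtain ⟨δ, hδ⟩ := exists_isAdmissibleRadius hs
  have h1 := h.choose_spec
  have h2 := hδ.mono_radius (lt_min h1.pos hδ.pos) (min_le_right h.choose δ)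
  have h3 : h2.discUnion ≤ h1.discUnion := h2.discUnion_carrier_le fun z hz =>
    (disc_mono z (min_le_left _ _)).trans (h1.disc_le_discUnion hz)
  have h4 : h2.discUnion ≤ L := h2.discUnion_le
  have e1 := baseMap_tprod R h3 a
  have e2 := baseMap_tprod R h4 a
  rw [centers_discUnion] at e1 e2
  rw [← e2, of_baseMap, ← of_baseMap R h1.discUnion_le h3, e1]
  congr 2
  funext d
  obtain ⟨hd1, hd2⟩ := h1.mem_discs.mp d.2
  rw [hd2, h1.filter_mem_disc hd1, Finset.prod_singleton]

theorem pt_eq_of_centers {L : DiscUnion} (hL : L.carrier ≤ U) (a : ℂ → R) :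
    pt R U L.centers a = of R L hL (PiTensorProduct.tprod ℂ fun d => a d.1.1) := by
  rw [pt_eq_of R hL L.centers_subset]
  simp only [DiscUnion.filter_centers, Finset.prod_singleton]

theorem of_tprod {L : DiscUnion} (hL : L.carrier ≤ U) (a : L.discs → R) :
    of R L hL (PiTensorProduct.tprod ℂ a) = pt R U L.centers (L.label a) := by
  rw [pt_eq_of_centers R hL]
  simp only [DiscUnion.label_center]

/-- Both configurations lie in the same union of discs around `t`, where they give the same pure
tensor. -/
theorem isMerging_pt (U : Opens ℂ) : IsMerging U (pt R U) := fun t ht => by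
  obtain ⟨ε, hε⟩ := exists_isAdmissibleRadius ht
  refine ⟨ε, hε, fun s a b hs hb => ?_⟩
  have h1 : (s : Set ℂ) ⊆ hε.discUnion.carrier := fun z hz => by
    obtain ⟨w, hw, hzw⟩ := hs z hz
    exact hε.disc_le_discUnion hw hzw
  have e := pt_eq_of_centers R hε.discUnion_le b
  rw [centers_discUnion] at e
  rw [pt_eq_of R hε.discUnion_le h1, e]
  congr 2
  funext d
  obtain ⟨hd1, hd2⟩ := hε.mem_discs.mp d.2
  rw [hb _ hd1, hd2]

-- By `of_tprod`, a pure tensor on a union of discs is the configuration of their centres with the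
-- tensor factors as labels.
variable {R} in
theorem hom_ext_pt {P : Type u} [AddCommGroup P] [Module ℂ P] {f g : Obj R U →ₗ[ℂ] P}
    (h : ∀ (s : Finset ℂ) (a : ℂ → R), (s : Set ℂ) ⊆ U → f (pt R U s a) = g (pt R U s a)) :
    f = g :=
  hom_ext fun L hL x => by
    suffices H : f ∘ₗ of R L hL = g ∘ₗ of R L hL from LinearMap.congr_fun H x
    refine PiTensorProduct.ext (MultilinearMap.ext fun a => ?_)
    simp only [LinearMap.compMultilinearMap_apply, LinearMap.comp_apply]
    rw [of_tprod]
    exact h _ _ (L.centers_subset.trans hL)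

-- The projection to the quotient by the span of the point elements vanishes on them, hence
-- vanishes. No separate case for zero is needed: it is zero times the empty configuration.
variable {R} in
@[elab_as_elim]
theorem induction_pt {p : Obj R U → Prop} (x : Obj R U)
    (hpt : ∀ (s : Finset ℂ) (a : ℂ → R), (s : Set ℂ) ⊆ U → p (pt R U s a))
    (hadd : ∀ x y, p x → p y → p (x + y)) (hsmul : ∀ (c : ℂ) x, p x → p (c • x)) : p x := by
  let S : Submodule ℂ (Obj R U) :=
    Submodule.span ℂ {x | ∃ (s : Finset ℂ) (a : ℂ → R), (s : Set ℂ) ⊆ U ∧ x = pt R U s a}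
  have hS : S.mkQ = 0 := hom_ext_pt fun s a hs => by
    rw [LinearMap.zero_apply, Submodule.mkQ_apply, Submodule.Quotient.mk_eq_zero]
    exact Submodule.subset_span ⟨s, a, hs, rfl⟩
  have hx : x ∈ S := by
    rw [← Submodule.Quotient.mk_eq_zero, ← Submodule.mkQ_apply, hS, LinearMap.zero_apply]
  refine Submodule.span_induction (p := fun x _ => p x) ?_ ?_ (fun x y _ _ => hadd x y)
    (fun c x _ => hsmul c x) hx
  · rintro x ⟨s, a, hs, rfl⟩
    exact hpt s a hs
  · have := hsmul 0 _ (hpt ∅ 1 (by simp))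
    rwa [zero_smul] at this

theorem tensor_hom_ext_pt {P : Type u} [AddCommGroup P] [Module ℂ P]
    {f g : (Obj R U) ⊗[ℂ] (Obj R V) →ₗ[ℂ] P}
    (h : ∀ (s t : Finset ℂ) (a b : ℂ → R), (s : Set ℂ) ⊆ U → (t : Set ℂ) ⊆ V →
      f (pt R U s a ⊗ₜ pt R V t b) = g (pt R U s a ⊗ₜ pt R V t b)) : f = g :=
  TensorProduct.ext (hom_ext_pt fun s a hs => hom_ext_pt fun t b ht => h s t a b hs ht)

theorem exists_of_eq_pt (hs : (s : Set ℂ) ⊆ U) (a : ℂ → R) :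
    ∃ (L : DiscUnion) (hL : L.carrier ≤ U), L.centers = s ∧
      pt R U s a = of R L hL (PiTensorProduct.tprod ℂ fun d => a d.1.1) := by
  obtain ⟨ε, hε⟩ := exists_isAdmissibleRadius hs
  refine ⟨hε.discUnion, hε.discUnion_le, centers_discUnion hε, ?_⟩
  rw [← pt_eq_of_centers R, centers_discUnion]

theorem map_pt (h : U ≤ W) (hs : (s : Set ℂ) ⊆ U) : map R h (pt R U s a) = pt R W s a := by
  obtain ⟨L, hL, rfl, e⟩ := exists_of_eq_pt R hs a
  rw [e, map, lift_of, pt_eq_of_centers R (hL.trans h)]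

theorem mul_pt (h : Disjoint U V) (h' : U ⊔ V ≤ W) (hs : (s : Set ℂ) ⊆ U) (ht : (t : Set ℂ) ⊆ V) :
    mul R h h' (pt R U s a ⊗ₜ pt R V t b) =
      pt R W (s ∪ t) fun z => if z ∈ s then a z else b z := by
  obtain ⟨L, hL, rfl, e⟩ := exists_of_eq_pt R hs a
  obtain ⟨M, hM, rfl, e'⟩ := exists_of_eq_pt R ht b
  have hLM := h.mono hL hM
  rw [e, e', mul_of_tmul_of, mulBase, LinearMap.comp_apply, baseMul, LinearMap.comp_apply,
    LinearEquiv.coe_coe, PiTensorProduct.tmulEquiv_apply, push_tprod_of_decidableEq, pt_eq_of R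
      ((DiscUnion.carrier_union L M hLM).trans_le ((sup_le_sup hL hM).trans h'))]
  · congr 2
    funext k
    rw [Finset.prod_filter, Fintype.prod_sum_type, Finset.filter_union, Finset.prod_union]
    · have key : ∀ (N : DiscUnion) (hN : N ≤ L.union M hLM) (c f : ℂ → R),
          (∀ z ∈ N.centers, c z = f z) →
          (∏ d : N.discs, if DiscUnion.index hN d = k then c d.1.1 else 1) =
            ∏ z ∈ N.centers with z ∈ disc k.1.1 k.1.2, f z := by
        intro N hN c f hcf
        rw [← Finset.prod_filter]
        refine Finset.prod_bij (fun d _ => d.1.1) (fun d hd => ?_)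
          (fun d _ e _ h => N.center_injective h) (fun z hz => ?_)
          fun d _ => hcf _ (DiscUnion.mem_centers.mpr ⟨d, rfl⟩)
        · rw [Finset.mem_filter, DiscUnion.index_eq_iff] at hd
          exact Finset.mem_filter.mpr ⟨DiscUnion.mem_centers.mpr ⟨d, rfl⟩, hd.2⟩
        · obtain ⟨h1, h2⟩ := Finset.mem_filter.mp hz
          obtain ⟨d, rfl⟩ := DiscUnion.mem_centers.mp h1
          exact ⟨d, Finset.mem_filter.mpr
            ⟨Finset.mem_univ _, (DiscUnion.index_eq_iff hN d k).mpr h2⟩, rfl⟩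
      congr 1
      · exact key L (DiscUnion.left_le_union L M hLM) a (fun z => if z ∈ L.centers then a z else b z)
          fun z hz => by rw [if_pos hz]
      · exact key M (DiscUnion.right_le_union L M hLM) b (fun z => if z ∈ L.centers then a z else b z)
          fun z hz => by
            rw [if_neg fun hz' : z ∈ L.centers =>
              notMem_of_disjoint hLM (L.centers_subset hz') (M.centers_subset hz)]
    · rw [Finset.disjoint_left]
      intro z hz hz'
      exact notMem_of_disjoint hLM (L.centers_subset (Finset.mem_filter.mp hz).1)
        (M.centers_subset (Finset.mem_filter.mp hz').1)
  · rw [DiscUnion.carrier_union, Finset.coe_union]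
    exact Set.union_subset (L.centers_subset.trans (le_sup_left : L.carrier ≤ _))
      (M.centers_subset.trans (le_sup_right : M.carrier ≤ _))

theorem mul_pt_same (h : Disjoint U V) (h' : U ⊔ V ≤ W) (hs : (s : Set ℂ) ⊆ U)
    (ht : (t : Set ℂ) ⊆ V) : mul R h h' (pt R U s a ⊗ₜ pt R V t a) = pt R W (s ∪ t) a := by
  rw [mul_pt R h h' hs ht]
  simp

theorem unit_one (a : ℂ → R) : unit R 1 = pt R ⊥ ∅ a := by
  have h : DiscUnion.empty.centers = ∅ := by simp [DiscUnion.centers, DiscUnion.empty]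
  rw [← h, pt_eq_of_centers R DiscUnion.carrier_empty.le, unit, LinearMap.toSpanSingleton_apply,
    one_smul]
  congr 2
  funext d
  exact absurd d.2 (Finset.notMem_empty _)

variable {R} in
theorem act_pt (φ : R →ₐ[ℂ] R) (g : RigidMotion) (hs : (s : Set ℂ) ⊆ U) :
    act φ g U (pt R U s a) =
      pt R (smulOpens g U) (s.image fun z => g • z) fun z => φ (a (g⁻¹ • z)) := by
  obtain ⟨L, hL, rfl, e⟩ := exists_of_eq_pt R hs a
  have h : L.centers.image (fun z => g • z) = (L.smul g).centers := by
    simp only [DiscUnion.centers, DiscUnion.smul, Finset.image_image]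
    rfl
  rw [e, act, lift_of, LinearMap.comp_apply, h,
    pt_eq_of_centers R ((L.carrier_smul g).trans_le (smulOpens_mono g hL)), baseAct,
    LinearMap.comp_apply, PiTensorProduct.map_tprod, push_tprod_of_decidableEq]
  congr 2
  funext k
  obtain ⟨k, hk⟩ := k
  obtain ⟨d, hd, rfl⟩ := Finset.mem_image.mp hk
  rw [Finset.prod_eq_single_of_mem (⟨d, hd⟩ : L.discs)]
  · simp
  · exact Finset.mem_filter.mpr ⟨Finset.mem_univ _, rfl⟩
  · intro e he hne
    refine absurd ?_ hne
    have := congrArg (fun x => x.1.1) (Finset.mem_filter.mp he).2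
    exact L.center_injective (MulAction.injective g this)

end FLoc

end Points

/-! ### The algebraic axioms -/

namespace FLoc

section Algebraic

open Classical

variable (R : Type u) [CommRing R] [Algebra ℂ R] {s t : Finset ℂ} {a b : ℂ → R}

theorem pt_congr {U : Opens ℂ} (hs : (s : Set ℂ) ⊆ U) (hst : s = t) (h : ∀ z ∈ s, a z = b z) :
    pt R U s a = pt R U t b :=
  hst ▸ (isMerging_pt R U).congr hs h

theorem map_id (U : Opens ℂ) : map R (le_refl U) = LinearMap.id :=
  hom_ext_pt fun _ _ hs => map_pt R _ hs

theorem map_comp {U V W : Opens ℂ} (h : U ≤ V) (h' : V ≤ W) :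
    map R h' ∘ₗ map R h = map R (h.trans h') :=
  hom_ext_pt fun s a hs => by
    rw [LinearMap.comp_apply, map_pt R h hs, map_pt R h' (hs.trans h), map_pt R _ hs]

theorem map_mul {U₁ U₂ V W : Opens ℂ} (h : Disjoint U₁ U₂) (h₁ : U₁ ⊔ U₂ ≤ V) (h₂ : V ≤ W) :
    map R h₂ ∘ₗ mul R h h₁ = mul R h (h₁.trans h₂) :=
  tensor_hom_ext_pt R fun s t a b hs ht => by
    rw [LinearMap.comp_apply, mul_pt R h h₁ hs ht, mul_pt R h _ hs ht, map_pt]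
    rw [Finset.coe_union]
    exact Set.union_subset (hs.trans (le_sup_left.trans h₁)) (ht.trans (le_sup_right.trans h₁))

theorem mul_map {U₁ U₂ V₁ V₂ W : Opens ℂ} (h₁ : U₁ ≤ V₁) (h₂ : U₂ ≤ V₂) (h : Disjoint V₁ V₂)
    (h' : V₁ ⊔ V₂ ≤ W) :
    mul R h h' ∘ₗ TensorProduct.map (map R h₁) (map R h₂) =
      mul R (h.mono h₁ h₂) ((sup_le_sup h₁ h₂).trans h') :=
  tensor_hom_ext_pt R fun s t a b hs ht => by
    rw [LinearMap.comp_apply, TensorProduct.map_tmul, map_pt R h₁ hs, map_pt R h₂ ht,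
      mul_pt R h h' (hs.trans h₁) (ht.trans h₂), mul_pt R _ _ hs ht]

theorem mul_comm {U₁ U₂ V : Opens ℂ} (h : Disjoint U₁ U₂) (h' : U₁ ⊔ U₂ ≤ V) :
    mul R h.symm ((sup_comm U₂ U₁).trans_le h') ∘ₗ
      (TensorProduct.comm ℂ (Obj R U₁) (Obj R U₂)).toLinearMap = mul R h h' :=
  tensor_hom_ext_pt R fun s t a b hs ht => by
    rw [LinearMap.comp_apply, LinearEquiv.coe_coe, TensorProduct.comm_tmul, mul_pt R _ _ ht hs,
      mul_pt R _ _ hs ht]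
    refine pt_congr R ?_ (Finset.union_comm _ _) fun z hz => ?_
    · rw [Finset.coe_union]
      exact Set.union_subset (ht.trans (le_sup_right.trans h')) (hs.trans (le_sup_left.trans h'))
    · rcases Finset.mem_union.mp hz with hz | hz
      · rw [if_pos hz, if_neg fun hz' : z ∈ s => notMem_of_disjoint h (hs hz') (ht hz)]
      · rw [if_pos hz, if_neg fun hz' : z ∈ t => notMem_of_disjoint h (hs hz) (ht hz')]

theorem mul_assoc {U₁ U₂ U₃ V₁ V₂ W : Opens ℂ} (h₁₂ : Disjoint U₁ U₂) (hV₁ : U₁ ⊔ U₂ ≤ V₁)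
    (h₂₃ : Disjoint U₂ U₃) (hV₂ : U₂ ⊔ U₃ ≤ V₂) (h₁ : Disjoint U₁ V₂) (h₁W : U₁ ⊔ V₂ ≤ W)
    (h₃ : Disjoint V₁ U₃) (h₃W : V₁ ⊔ U₃ ≤ W) :
    mul R h₃ h₃W ∘ₗ (mul R h₁₂ hV₁).rTensor (Obj R U₃) =
      mul R h₁ h₁W ∘ₗ (mul R h₂₃ hV₂).lTensor (Obj R U₁) ∘ₗ
        (TensorProduct.assoc ℂ (Obj R U₁) (Obj R U₂) (Obj R U₃)).toLinearMap :=
  TensorProduct.ext <| tensor_hom_ext_pt R fun s t a b hs ht => hom_ext_pt fun u c hu => by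
    have h1 : ((s ∪ t : Finset ℂ) : Set ℂ) ⊆ V₁ := by
      rw [Finset.coe_union]
      exact Set.union_subset (hs.trans (le_sup_left.trans hV₁)) (ht.trans (le_sup_right.trans hV₁))
    have h2 : ((t ∪ u : Finset ℂ) : Set ℂ) ⊆ V₂ := by
      rw [Finset.coe_union]
      exact Set.union_subset (ht.trans (le_sup_left.trans hV₂)) (hu.trans (le_sup_right.trans hV₂))
    change mul R h₃ h₃W (mul R h₁₂ hV₁ (pt R U₁ s a ⊗ₜ pt R U₂ t b) ⊗ₜ pt R U₃ u c) =
      mul R h₁ h₁W (pt R U₁ s a ⊗ₜ mul R h₂₃ hV₂ (pt R U₂ t b ⊗ₜ pt R U₃ u c))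
    rw [mul_pt R h₁₂ hV₁ hs ht, mul_pt R h₂₃ hV₂ ht hu, mul_pt R h₃ h₃W h1 hu,
      mul_pt R h₁ h₁W hs h2]
    refine pt_congr R ?_ (Finset.union_assoc _ _ _) fun z _ => ?_
    · rw [Finset.coe_union]
      exact Set.union_subset (h1.trans (le_sup_left.trans h₃W)) (hu.trans (le_sup_right.trans h₃W))
    · simp only [Finset.mem_union]
      by_cases hz : z ∈ s <;> simp [hz]

theorem unit_mul (U : Opens ℂ) :
    mul R (disjoint_bot_left (a := U)) (bot_sup_eq U).le ∘ₗ (unit R).rTensor (Obj R U) =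
      (TensorProduct.lid ℂ (Obj R U)).toLinearMap :=
  TensorProduct.ext <| LinearMap.ext_ring <| hom_ext_pt fun s a hs => by
    change mul R _ _ (unit R 1 ⊗ₜ pt R U s a) = (1 : ℂ) • pt R U s a
    rw [one_smul]
    rw [unit_one R a, mul_pt_same R _ _ (by simp) hs, Finset.empty_union]

theorem mul_unit (U : Opens ℂ) :
    mul R (disjoint_bot_right (a := U)) (sup_bot_eq U).le ∘ₗ (unit R).lTensor (Obj R U) =
      (TensorProduct.rid ℂ (Obj R U)).toLinearMap :=
  TensorProduct.ext <| hom_ext_pt (P := ℂ →ₗ[ℂ] Obj R U) fun s a hs => LinearMap.ext_ring <| by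
    change mul R _ _ (pt R U s a ⊗ₜ unit R 1) = (1 : ℂ) • pt R U s a
    rw [one_smul]
    rw [unit_one R a, mul_pt_same R _ _ hs (by simp), Finset.union_empty]

variable {R}

theorem coe_image_smul_subset {U : Opens ℂ} (g : RigidMotion) (hs : (s : Set ℂ) ⊆ U) :
    ((s.image fun z => g • z : Finset ℂ) : Set ℂ) ⊆ smulOpens g U := by
  rw [Finset.coe_image]
  exact Set.image_mono hs

theorem act_map (φ : R →ₐ[ℂ] R) (g : RigidMotion) {U V : Opens ℂ} (h : U ≤ V) :
    act φ g V ∘ₗ map R h = map R (smulOpens_mono g h) ∘ₗ act φ g U :=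
  hom_ext_pt fun s a hs => by
    rw [LinearMap.comp_apply, LinearMap.comp_apply, map_pt R h hs, act_pt φ g (hs.trans h),
      act_pt φ g hs, map_pt R _ (coe_image_smul_subset g hs)]

theorem act_mul_act {φ : RigidMotion → (R →ₐ[ℂ] R)} (hφ : ∀ g h x, φ (g * h) x = φ g (φ h x))
    (g h : RigidMotion) (U : Opens ℂ) :
    map R (smulOpens_mul g h U).le ∘ₗ act (φ g) g (smulOpens h U) ∘ₗ act (φ h) h U =
      act (φ (g * h)) (g * h) U :=
  hom_ext_pt fun s a hs => by
    have h1 := coe_image_smul_subset h hs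
    have h2 := coe_image_smul_subset g h1
    simp only [LinearMap.comp_apply]
    rw [act_pt _ h hs, act_pt _ g h1, map_pt R _ h2, act_pt _ _ hs]
    refine pt_congr R (h2.trans (smulOpens_mul g h U).le) ?_ fun z _ => ?_
    · simp only [Finset.image_image, Function.comp_def, smul_smul]
    · rw [hφ, mul_inv_rev, mul_smul]

theorem act_one {φ : RigidMotion → (R →ₐ[ℂ] R)} (hφ : ∀ x, φ 1 x = x) (U : Opens ℂ) :
    map R (smulOpens_one (G := RigidMotion) U).le ∘ₗ act (φ 1) 1 U = LinearMap.id :=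
  hom_ext_pt fun s a hs => by
    have h1 := coe_image_smul_subset 1 hs
    rw [LinearMap.comp_apply, act_pt _ _ hs, map_pt R _ h1]
    refine pt_congr R (h1.trans (smulOpens_one (G := RigidMotion) U).le) (by simp) fun z _ => ?_
    rw [hφ, inv_one, one_smul]

theorem act_mul (φ : R →ₐ[ℂ] R) (g : RigidMotion) {U V W : Opens ℂ} (h : Disjoint U V)
    (h' : U ⊔ V ≤ W) :
    act φ g W ∘ₗ mul R h h' =
      mul R (smulOpens_disjoint g h) ((smulOpens_sup g U V).ge.trans (smulOpens_mono g h')) ∘ₗ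
        TensorProduct.map (act φ g U) (act φ g V) :=
  tensor_hom_ext_pt R fun s t a b hs ht => by
    have h1 : ((s ∪ t : Finset ℂ) : Set ℂ) ⊆ W := by
      rw [Finset.coe_union]
      exact Set.union_subset (hs.trans (le_sup_left.trans h')) (ht.trans (le_sup_right.trans h'))
    rw [LinearMap.comp_apply, LinearMap.comp_apply, mul_pt R h h' hs ht, act_pt φ g h1,
      TensorProduct.map_tmul, act_pt φ g hs, act_pt φ g ht,
      mul_pt R _ _ (coe_image_smul_subset g hs) (coe_image_smul_subset g ht)]
    refine pt_congr R (coe_image_smul_subset g h1) (Finset.image_union _ _) fun z _ => ?_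
    have : z ∈ s.image (fun z => g • z) ↔ g⁻¹ • z ∈ s := by
      rw [Finset.mem_image]
      exact ⟨by rintro ⟨w, hw, rfl⟩; rwa [inv_smul_smul], fun h => ⟨_, h, smul_inv_smul g z⟩⟩
    simp only [this]
    split_ifs <;> rfl

theorem act_unit (φ : R →ₐ[ℂ] R) (g : RigidMotion) :
    map R (smulOpens_bot g).le ∘ₗ act φ g ⊥ ∘ₗ unit R = unit R :=
  LinearMap.ext_ring <| by
    have h := coe_image_smul_subset g (s := ∅) (U := ⊥) (by simp)
    simp only [LinearMap.comp_apply]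
    rw [unit_one R 0, act_pt φ g (by simp), map_pt R _ h]
    exact pt_congr R (h.trans (smulOpens_bot g).le) (by simp) (by simp)

end Algebraic

end FLoc

/-! ### Linear maps out of the factorization algebra -/

section LiftPoints

open Classical

/-- The discs around `t` are disjoint, so a point that lies in the `ε`-disc of `w` and in some
`δ`-disc lies in the `δ`-disc of `w` itself. This lets several merging conditions share one radius.
-/
theorem IsMerging.of_le_radius {M X : Type*} [CommMonoid M] {U : Opens ℂ}
    {P : Finset ℂ → (ℂ → M) → X} {t : Finset ℂ} {ε δ : ℝ} (hε : IsAdmissibleRadius U t ε)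
    (h : ∀ (s : Finset ℂ) (a b : ℂ → M), (∀ z ∈ s, ∃ w ∈ t, z ∈ disc w ε) →
      (∀ w ∈ t, b w = ∏ z ∈ s with z ∈ disc w ε, a z) → P s a = P t b) (hle : δ ≤ ε)
    (s : Finset ℂ) (a b : ℂ → M) (hs : ∀ z ∈ s, ∃ w ∈ t, z ∈ disc w δ)
    (hb : ∀ w ∈ t, b w = ∏ z ∈ s with z ∈ disc w δ, a z) : P s a = P t b := by
  refine h s a b (fun z hz => ?_) fun w hw => ?_
  · obtain ⟨w, hw, hzw⟩ := hs z hz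
    exact ⟨w, hw, disc_mono _ hle hzw⟩
  · rw [hb w hw]
    refine Finset.prod_congr (Finset.filter_congr fun z hz => ⟨fun h => disc_mono _ hle h,
      fun h' => ?_⟩) fun _ _ => rfl
    obtain ⟨w', hw', hzw'⟩ := hs z hz
    rwa [hε.eq_of_mem hw hw' h' (disc_mono _ hle hzw')]

theorem DiscUnion.label_update {M : Type*} [One M] (L : DiscUnion) [DecidableEq L.discs]
    (a : L.discs → M) (d : L.discs)
    (x : M) : L.label (Function.update a d x) = Function.update (L.label a) d.1.1 x := by
  funext z
  by_cases h : ∃ e : L.discs, e.1.1 = z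
  · obtain ⟨e, rfl⟩ := h
    rw [L.label_center]
    by_cases hed : e = d
    · subst hed; simp
    · rw [Function.update_of_ne hed, Function.update_of_ne fun h => hed (L.center_injective h),
        L.label_center]
  · rw [Function.update_of_ne fun h' => h ⟨d, h'.symm⟩, label, label, dif_neg h, dif_neg h]

theorem connectedComponentIn_eq_of_mem_disc {U : Opens ℂ} {z w : ℂ} {r : ℝ} (h : disc w r ≤ U)
    (hz : z ∈ disc w r) :
    connectedComponentIn (U : Set ℂ) z = connectedComponentIn (U : Set ℂ) w := by
  have hr : 0 < r := Metric.pos_of_mem_ball hz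
  refine (connectedComponentIn_eq ?_).symm
  exact (convex_ball w r).isPreconnected.subset_connectedComponentIn (mem_disc_self hr) h hz

namespace FLoc

variable {R : Type u} [CommRing R] [Algebra ℂ R] {U V : Opens ℂ} {E : Type u} [AddCommGroup E]
  [Module ℂ E]

/-- `Q` is the value of a linear map at the elements `pt R U s a`. -/
structure IsPointFunctional (U : Opens ℂ) (Q : Finset ℂ → (ℂ → R) → E) : Prop where
  isMerging : IsMerging U Q
  map_update_add : ∀ (s : Finset ℂ) (a : ℂ → R) (z : ℂ) (x y : R), (s : Set ℂ) ⊆ U → z ∈ s →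
    Q s (Function.update a z (x + y)) = Q s (Function.update a z x) + Q s (Function.update a z y)
  map_update_smul : ∀ (s : Finset ℂ) (a : ℂ → R) (z : ℂ) (c : ℂ) (x : R), (s : Set ℂ) ⊆ U →
    z ∈ s → Q s (Function.update a z (c • x)) = c • Q s (Function.update a z x)

namespace IsPointFunctional

variable {Q : Finset ℂ → (ℂ → R) → E} (hQ : IsPointFunctional U Q)

/-- The restriction of the linear map to `F(L)`. -/
def liftBase (L : DiscUnion) (hL : L.carrier ≤ U) : Base R L →ₗ[ℂ] E :=
  PiTensorProduct.lift
    { toFun := fun a => Q L.centers (L.label a)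
      map_update_add' := fun a d x y => by
        have := hQ.map_update_add L.centers (L.label a) d.1.1 x y (L.centers_subset.trans hL)
          (DiscUnion.mem_centers.mpr ⟨d, rfl⟩)
        rwa [← L.label_update, ← L.label_update, ← L.label_update] at this
      map_update_smul' := fun a d c x => by
        have := hQ.map_update_smul L.centers (L.label a) d.1.1 c x (L.centers_subset.trans hL)
          (DiscUnion.mem_centers.mpr ⟨d, rfl⟩)
        rwa [← L.label_update, ← L.label_update] at this }

theorem liftBase_tprod (L : DiscUnion) (hL : L.carrier ≤ U) (a : ℂ → R) :
    hQ.liftBase L hL (PiTensorProduct.tprod ℂ fun d => a d.1.1) = Q L.centers a := by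
  rw [liftBase, PiTensorProduct.lift.tprod]
  refine hQ.isMerging.congr (L.centers_subset.trans hL) fun z hz => ?_
  obtain ⟨d, rfl⟩ := DiscUnion.mem_centers.mp hz
  exact L.label_center (fun d => a d.1.1) d

/-- The linear map with given values at the elements `pt R U s a`. -/
def liftPt : Obj R U →ₗ[ℂ] E :=
  lift hQ.liftBase fun L M h hM x => by
    suffices H : hQ.liftBase M hM ∘ₗ baseMap R h = hQ.liftBase L (le_trans h hM) from
      LinearMap.congr_fun H x
    refine PiTensorProduct.ext (MultilinearMap.ext fun a => ?_)
    simp only [LinearMap.compMultilinearMap_apply, LinearMap.comp_apply]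
    have ha : a = fun d => L.label a d.1.1 := funext fun d => (L.label_center a d).symm
    rw [ha]
    generalize L.label a = a
    rw [baseMap_tprod]
    set b : M.discs → R := fun d => ∏ z ∈ L.centers with z ∈ disc d.1.1 d.1.2, a z with hb
    have hb' : b = fun d => M.label b d.1.1 := funext fun d => (M.label_center b d).symm
    rw [hb', liftBase_tprod, liftBase_tprod]
    have hLU : (L.centers : Set ℂ) ⊆ U := L.centers_subset.trans (le_trans h hM)
    -- The discs of `M` need not be small, so `IsMerging` does not apply to them directly. But a
    -- disc lies in a single component of `U`, and only the products over components matter.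
    refine hQ.isMerging.eq_of_components (M.centers_subset.trans hM) hLU fun z hz => ?_
    -- Sends the centre of a disc of `L` to the centre of the disc of `M` around it; the value
    -- elsewhere plays no role. The product over a component is then grouped along the fibres of
    -- `f`.
    let f : ℂ → ℂ := fun x => if hx : ∃ d : L.discs, d.1.1 = x then
      (DiscUnion.index h hx.choose).1.1 else x
    have hf : ∀ d : L.discs, f d.1.1 = (DiscUnion.index h d).1.1 := fun d => by
      have hx : ∃ e : L.discs, e.1.1 = d.1.1 := ⟨d, rfl⟩
      simp only [f, dif_pos hx, L.center_injective hx.choose_spec]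
    rw [← Finset.prod_fiberwise_of_maps_to (s := {x ∈ L.centers |
      connectedComponentIn (U : Set ℂ) x = connectedComponentIn (U : Set ℂ) z})
      (t := {x ∈ M.centers |
      connectedComponentIn (U : Set ℂ) x = connectedComponentIn (U : Set ℂ) z}) (g := f)]
    · refine Finset.prod_congr rfl fun w hw => ?_
      obtain ⟨hw, hwz⟩ := Finset.mem_filter.mp hw
      obtain ⟨e, rfl⟩ := DiscUnion.mem_centers.mp hw
      rw [M.label_center, hb, Finset.filter_filter]
      refine Finset.prod_congr (Finset.filter_congr fun x hx => ?_) fun _ _ => rfl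
      obtain ⟨d, rfl⟩ := DiscUnion.mem_centers.mp hx
      rw [hf, ← DiscUnion.index_eq_iff h]
      constructor
      · rintro rfl
        exact ⟨(connectedComponentIn_eq_of_mem_disc ((M.disc_le _).trans hM)
          (DiscUnion.disc_le_index h d (L.mem_disc d))).trans hwz, rfl⟩
      · rintro ⟨-, h2⟩
        exact M.center_injective h2
    · intro x hx
      obtain ⟨hx, hxz⟩ := Finset.mem_filter.mp hx
      obtain ⟨d, rfl⟩ := DiscUnion.mem_centers.mp hx
      rw [hf]
      refine Finset.mem_filter.mpr ⟨DiscUnion.mem_centers.mpr ⟨_, rfl⟩, ?_⟩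
      rw [← hxz]
      exact (connectedComponentIn_eq_of_mem_disc ((M.disc_le _).trans hM)
          (DiscUnion.disc_le_index h d (L.mem_disc d))).symm

theorem liftPt_pt {s : Finset ℂ} (hs : (s : Set ℂ) ⊆ U) (a : ℂ → R) :
    hQ.liftPt (pt R U s a) = Q s a := by
  obtain ⟨L, hL, rfl, e⟩ := exists_of_eq_pt R hs a
  rw [e, liftPt, lift_of, liftBase_tprod]

end IsPointFunctional

/-- The converse of `liftPt`. For fixed `s` all labellings live on the same union of discs, where
the labels enter through a pure tensor. -/
theorem isPointFunctional_map (f : Obj R U →ₗ[ℂ] E) :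
    IsPointFunctional U fun s a => f (pt R U s a) where
  isMerging t ht := by
    obtain ⟨ε, hε, h⟩ := isMerging_pt R U t ht
    exact ⟨ε, hε, fun s a b hs hb => congrArg f (h s a b hs hb)⟩
  map_update_add s a z x y hs hz := by
    obtain ⟨ε, hε⟩ := exists_isAdmissibleRadius hs
    have e := fun a : ℂ → R => pt_eq_of_centers R hε.discUnion_le a
    simp only [centers_discUnion] at e
    let d : hε.discUnion.discs := ⟨(z, ε), hε.mem_discs.mpr ⟨hz, rfl⟩⟩
    have h1 : ∀ x, (fun d : hε.discUnion.discs => Function.update a z x d.1.1) =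
        Function.update (fun d => a d.1.1) d x := fun x => by
      funext d'
      by_cases h : d' = d
      · subst h; simp [d]
      · rw [Function.update_of_ne h, Function.update_of_ne]
        exact fun h' => h (hε.discUnion.center_injective h')
    rw [e, e, e, h1, h1, h1, MultilinearMap.map_update_add, map_add, map_add]
  map_update_smul s a z c x hs hz := by
    obtain ⟨ε, hε⟩ := exists_isAdmissibleRadius hs
    have e := fun a : ℂ → R => pt_eq_of_centers R hε.discUnion_le a
    simp only [centers_discUnion] at e
    let d : hε.discUnion.discs := ⟨(z, ε), hε.mem_discs.mpr ⟨hz, rfl⟩⟩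
    have h1 : ∀ x, (fun d : hε.discUnion.discs => Function.update a z x d.1.1) =
        Function.update (fun d => a d.1.1) d x := fun x => by
      funext d'
      by_cases h : d' = d
      · subst h; simp [d]
      · rw [Function.update_of_ne h, Function.update_of_ne]
        exact fun h' => h (hε.discUnion.center_injective h')
    rw [e, e, h1, h1, MultilinearMap.map_update_smul, map_smul, map_smul]

theorem isPointFunctional_pt : IsPointFunctional U (pt R U) :=
  isPointFunctional_map (LinearMap.id : Obj R U →ₗ[ℂ] Obj R U)

end FLoc

end LiftPoints

/-! ### Continuity -/

namespace FLoc

section Continuity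

open Classical

variable {R : Type u} [CommRing R] [Algebra ℂ R] [TopologicalSpace R] {U V W : Opens ℂ}
  {s t : Finset ℂ} {a b : ℂ → R}

/-- The topology of `lcs R U`, by definition. -/
instance objTopology : TopologicalSpace (Obj R U) :=
  finestLC fun t => ∀ (L : DiscUnion) (hL : L.carrier ≤ U),
    @Continuous (Base R L) (Obj R U) (baseTopology R L) t (of R L hL)

theorem isLocallyConvexTopology_obj :
    IsLocallyConvexTopology (objTopology : TopologicalSpace (Obj R U)) :=
  isLocallyConvexTopology_finestLC _

instance : IsTopologicalAddGroup (Obj R U) := isLocallyConvexTopology_obj.isTopologicalAddGroup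

instance : ContinuousSMul ℂ (Obj R U) := isLocallyConvexTopology_obj.continuousSMul

instance : LocallyConvexSpace ℝ (Obj R U) := isLocallyConvexTopology_obj.locallyConvex

theorem continuous_of (L : DiscUnion) (hL : L.carrier ≤ U) : Continuous (of R L hL) :=
  continuous_finestLC_rng fun _ h => h L hL

/-- With the product topology on all labels `ℂ → R`; only the finitely many labels on `s` enter,
through a pure tensor. -/
theorem continuous_pt (hs : (s : Set ℂ) ⊆ U) : Continuous (pt R U s) := by
  obtain ⟨ε, hε⟩ := exists_isAdmissibleRadius hs
  have e := fun a : ℂ → R => pt_eq_of_centers R hε.discUnion_le a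
  simp only [centers_discUnion] at e
  rw [funext e]
  exact (continuous_of _ _).comp
    (continuous_tprod.comp (continuous_pi fun d => continuous_apply d.1.1))

variable {E : Type*} [AddCommGroup E] [Module ℂ E] [TopologicalSpace E] [IsTopologicalAddGroup E]
  [ContinuousSMul ℂ E] [LocallyConvexSpace ℝ E]

theorem continuous_obj_of_forall {f : Obj R U →ₗ[ℂ] E}
    (h : ∀ (L : DiscUnion) (hL : L.carrier ≤ U), Continuous (f ∘ₗ of R L hL)) : Continuous f :=
  continuous_finestLC_dom f fun L hL => continuous_induced_rng.mpr (h L hL)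

variable {I : Type*} [Countable I]

/-- A linear map on `F(U)` is continuous if it depends continuously on each label. -/
theorem continuous_obj_of_separately (e : R ≃L[ℂ] (I → ℂ)) {f : Obj R U →ₗ[ℂ] E}
    (h : ∀ (s : Finset ℂ) (a : ℂ → R) (z : ℂ), (s : Set ℂ) ⊆ U → z ∈ s →
      Continuous fun x => f (pt R U s (Function.update a z x))) : Continuous f :=
  continuous_obj_of_forall fun L hL => continuous_tensorPower_of_separately e _ fun a d => by
    simp only [LinearMap.comp_apply, of_tprod, L.label_update]
    exact h _ _ _ (L.centers_subset.trans hL) (DiscUnion.mem_centers.mpr ⟨d, rfl⟩)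

theorem continuous_update_label {R : Type*} [TopologicalSpace R] (a : ℂ → R) (z : ℂ) :
    Continuous fun x : R => Function.update a z x :=
  continuous_const.update z continuous_id

variable (e : R ≃L[ℂ] (I → ℂ))
include e

theorem continuous_map (h : U ≤ W) : Continuous (map R h) :=
  continuous_obj_of_separately e fun s a z hs _ => by
    simp only [map_pt R h hs]
    exact (continuous_pt (hs.trans h)).comp (continuous_update_label a z)

theorem continuous_act (φ : R →ₐ[ℂ] R) (hφ : Continuous φ) (g : RigidMotion) :
    Continuous (act φ g U) :=
  continuous_obj_of_separately e fun s a z hs _ => by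
    simp only [act_pt φ g hs]
    exact (continuous_pt (coe_image_smul_subset g hs)).comp (continuous_pi fun w =>
      hφ.comp ((continuous_apply (g⁻¹ • w)).comp (continuous_update_label a z)))

/-- The fixed element `x` is a finite combination of point elements, and for each of these one label
of the other factor is varied at a time. -/
theorem continuous_mul_right (h : Disjoint U V) (h' : U ⊔ V ≤ W) (x : Obj R U) :
    Continuous fun y : Obj R V => mul R h h' (x ⊗ₜ y) := by
  induction x using induction_pt with
  | hpt s a hs =>
    refine continuous_obj_of_separately e
      (f := (TensorProduct.curry (mul R h h')) (pt R U s a)) fun t b z ht _ => ?_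
    simp only [TensorProduct.curry_apply, mul_pt R h h' hs ht]
    refine (continuous_pt ?_).comp (continuous_pi fun w => ?_)
    · rw [Finset.coe_union]
      exact Set.union_subset (hs.trans (le_sup_left.trans h')) (ht.trans (le_sup_right.trans h'))
    · split_ifs
      · exact continuous_const
      · exact (continuous_apply w).comp (continuous_update_label b z)
  | hadd x y hx hy =>
    simp only [TensorProduct.add_tmul, map_add]
    exact hx.add hy
  | hsmul c x hx =>
    simp only [← TensorProduct.smul_tmul', map_smul]
    exact hx.const_smul c

theorem continuous_mul_left (h : Disjoint U V) (h' : U ⊔ V ≤ W) (y : Obj R V) :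
    Continuous fun x : Obj R U => mul R h h' (x ⊗ₜ y) := by
  have := continuous_mul_right e h.symm ((sup_comm V U).trans_le h') y
  refine this.congr fun x => ?_
  rw [← mul_comm R h h']
  rfl

end Continuity

end FLoc

/-! ### Descent and multiplicativity -/

namespace FLoc

section Descent

open Classical

variable {R : Type u} [CommRing R] [Algebra ℂ R] [TopologicalSpace R] {U V W : Opens ℂ}
  {I : Type*} [Countable I] (e : R ≃L[ℂ] (I → ℂ))

include e in
/-- Maps from the members of a Weiss cover that agree on intersections glue. -/
theorem exists_glue {J : Type} (c : J → Opens ℂ) (hc : PrefactorizationData.IsWeissCover U c)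
    {E : Type u} [AddCommGroup E] [Module ℂ E] [TopologicalSpace E] [IsTopologicalAddGroup E]
    [ContinuousSMul ℂ E] [LocallyConvexSpace ℝ E] (f : ∀ i, Obj R (c i) →ₗ[ℂ] E)
    (hf : ∀ i, Continuous (f i))
    (hcompat : ∀ (i j : J) (x : Obj R (c i ⊓ c j)),
      f i (map R inf_le_left x) = f j (map R inf_le_right x)) :
    ∃ g : Obj R U →ₗ[ℂ] E, Continuous g ∧
      ∀ (i : J) (x : Obj R (c i)), g (map R ((le_iSup c i).trans hc.1.le) x) = f i x := by
  have hle : ∀ i, c i ≤ U := fun i => (le_iSup c i).trans hc.1.le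
  -- The value does not depend on the member of the cover that contains `s`: two such members both
  -- contain `s` in their intersection, where the given maps agree. The default `0` never occurs for
  -- `s ⊆ U`, by the Weiss condition.
  let Q : Finset ℂ → (ℂ → R) → E := fun s a =>
    if h : ∃ i, (s : Set ℂ) ⊆ c i then f h.choose (pt R (c h.choose) s a) else 0
  have hQeq : ∀ (i : J) (s : Finset ℂ) (a : ℂ → R), (s : Set ℂ) ⊆ c i →
      Q s a = f i (pt R (c i) s a) := by
    intro i s a hs
    have h : ∃ i, (s : Set ℂ) ⊆ c i := ⟨i, hs⟩
    have hs' : (s : Set ℂ) ⊆ (c h.choose ⊓ c i : Opens ℂ) := Set.subset_inter h.choose_spec hs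
    have := hcompat h.choose i (pt R _ s a)
    rw [map_pt R _ hs', map_pt R _ hs'] at this
    simp only [Q, dif_pos h, this]
  have hQ : IsPointFunctional U Q :=
    { isMerging := fun t ht => by
        -- A single member contains `t` and, at an admissible radius, the small discs around it, so
        -- merging takes place inside that member.
        obtain ⟨i, hi⟩ := hc.2 t ht
        obtain ⟨ε, hε, h⟩ := isMerging_pt R (c i) t hi
        refine ⟨ε, hε.mono (hle i), fun s a b hs hb => ?_⟩
        have hsi : (s : Set ℂ) ⊆ c i := fun z hz => by
          obtain ⟨w, hw, hzw⟩ := hs z hz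
          exact hε.le w hw hzw
        rw [hQeq i s a hsi, hQeq i t b hi, h s a b hs hb]
      map_update_add := fun s a z x y hs hz => by
        obtain ⟨i, hi⟩ := hc.2 s hs
        simp only [hQeq i s _ hi]
        exact (isPointFunctional_map (f i)).map_update_add s a z x y hi hz
      map_update_smul := fun s a z k x hs hz => by
        obtain ⟨i, hi⟩ := hc.2 s hs
        simp only [hQeq i s _ hi]
        exact (isPointFunctional_map (f i)).map_update_smul s a z k x hi hz }
  refine ⟨hQ.liftPt, continuous_obj_of_separately e fun s a z hs _ => ?_, fun i x => ?_⟩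
  · obtain ⟨i, hi⟩ := hc.2 s hs
    simp only [hQ.liftPt_pt hs, hQeq i s _ hi]
    exact (hf i).comp ((continuous_pt hi).comp (continuous_update_label a z))
  · suffices H : hQ.liftPt ∘ₗ map R (hle i) = f i from LinearMap.congr_fun H x
    refine hom_ext_pt fun s a hs => ?_
    rw [LinearMap.comp_apply, map_pt R _ hs, hQ.liftPt_pt (hs.trans (hle i)), hQeq i s a hs]

/-- A linear map on `F(U)` is determined by its restrictions to the members of a Weiss cover. -/
theorem hom_ext_of_isWeissCover {J : Type} (c : J → Opens ℂ)
    (hc : PrefactorizationData.IsWeissCover U c) {E : Type u} [AddCommGroup E] [Module ℂ E]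
    {g g' : Obj R U →ₗ[ℂ] E}
    (h : ∀ (i : J) (x : Obj R (c i)), g (map R ((le_iSup c i).trans hc.1.le) x) =
      g' (map R ((le_iSup c i).trans hc.1.le) x)) : g = g' :=
  hom_ext_pt fun s a hs => by
    obtain ⟨i, hi⟩ := hc.2 s hs
    rw [← map_pt R ((le_iSup c i).trans hc.1.le) hi, h]

/-- The points of `s` that lie in `U`. -/
def pointsIn (U : Opens ℂ) (s : Finset ℂ) : Finset ℂ := {z ∈ s | z ∈ U}

theorem mem_pointsIn {s : Finset ℂ} {z : ℂ} : z ∈ pointsIn U s ↔ z ∈ s ∧ z ∈ U :=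
  Finset.mem_filter

theorem pointsIn_subset (U : Opens ℂ) (s : Finset ℂ) : (pointsIn U s : Set ℂ) ⊆ U :=
  fun _ hz => (mem_pointsIn.mp (Finset.mem_coe.mp hz)).2

/-- Merging in a larger open set restricts to `U`: small discs around points of `t` in `U` stay in
`U`, and those around the other points contain no points of `U`, by `hU`. -/
theorem pt_pointsIn_eq {s t : Finset ℂ} {a b : ℂ → R} {ε δ : ℝ}
    (hδ : IsAdmissibleRadius U (pointsIn U t) δ) (hεδ : ε ≤ δ)
    (hmerge : ∀ (s : Finset ℂ) (a b : ℂ → R), (∀ z ∈ s, ∃ w ∈ pointsIn U t, z ∈ disc w δ) →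
      (∀ w ∈ pointsIn U t, b w = ∏ z ∈ s with z ∈ disc w δ, a z) →
        pt R U s a = pt R U (pointsIn U t) b)
    (hs : ∀ z ∈ s, ∃ w ∈ t, z ∈ disc w ε) (hb : ∀ w ∈ t, b w = ∏ z ∈ s with z ∈ disc w ε, a z)
    (hU : ∀ w ∈ t, w ∉ U → ∀ z ∈ disc w ε, z ∉ U) :
    pt R U (pointsIn U s) a = pt R U (pointsIn U t) b := by
  refine IsMerging.of_le_radius hδ hmerge hεδ _ _ _ (fun z hz => ?_) fun w hw => ?_
  · obtain ⟨hz, hzU⟩ := mem_pointsIn.mp hz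
    obtain ⟨w, hw, hzw⟩ := hs z hz
    exact ⟨w, mem_pointsIn.mpr ⟨hw, by_contra fun h => hU w hw h z hzw hzU⟩, hzw⟩
  · rw [hb w (mem_pointsIn.mp hw).1, pointsIn, Finset.filter_filter]
    refine Finset.prod_congr (Finset.filter_congr fun z _ => ⟨fun h => ⟨?_, h⟩, And.right⟩)
      fun _ _ => rfl
    exact hδ.le w hw (disc_mono w hεδ h)

/-- For the smallest of the three radii every disc around a point of `t` lies in `U` or in `V`, so
merging respects the two parts. A single label affects only one of the two tensor factors. -/
theorem isPointFunctional_split (h : Disjoint U V) :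
    IsPointFunctional (U ⊔ V) fun s (a : ℂ → R) =>
      pt R U (pointsIn U s) a ⊗ₜ[ℂ] pt R V (pointsIn V s) a where
  isMerging t ht := by
    obtain ⟨ε, hε⟩ := exists_isAdmissibleRadius ht
    obtain ⟨δ, hδ, h1⟩ := isMerging_pt R U (pointsIn U t) (pointsIn_subset U t)
    obtain ⟨η, hη, h2⟩ := isMerging_pt R V (pointsIn V t) (pointsIn_subset V t)
    have hd : min ε (min δ η) ≤ δ := (min_le_right _ _).trans (min_le_left _ _)
    have hd' : min ε (min δ η) ≤ η := (min_le_right _ _).trans (min_le_right _ _)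
    refine ⟨min ε (min δ η), hε.mono_radius (lt_min hε.pos (lt_min hδ.pos hη.pos))
      (min_le_left _ _), fun s a b hs hb => ?_⟩
    beta_reduce
    rw [pt_pointsIn_eq hδ hd h1 hs hb fun w hw hwU z hz => ?_,
      pt_pointsIn_eq hη hd' h2 hs hb fun w hw hwV z hz => ?_]
    · have hwU : w ∈ U := (ht hw).resolve_right hwV
      exact notMem_of_disjoint h (hδ.le w (mem_pointsIn.mpr ⟨hw, hwU⟩) (disc_mono w hd hz))
    · have hwV : w ∈ V := (ht hw).resolve_left hwU
      exact notMem_of_disjoint h.symm (hη.le w (mem_pointsIn.mpr ⟨hw, hwV⟩) (disc_mono w hd' hz))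
  map_update_add s a z x y hs hz := by
    have key : ∀ (U : Opens ℂ) (x : R), z ∉ U →
        pt R U (pointsIn U s) (Function.update a z x) = pt R U (pointsIn U s) a := fun U x hzU =>
      pt_congr R (pointsIn_subset U s) rfl fun w hw => Function.update_of_ne (by
        rintro rfl; exact hzU (mem_pointsIn.mp hw).2) _ _
    rcases hs hz with hzU | hzV
    · simp only [key V _ (notMem_of_disjoint h hzU)]
      rw [isPointFunctional_pt.map_update_add _ a z x y (pointsIn_subset U s)
        (mem_pointsIn.mpr ⟨hz, hzU⟩), TensorProduct.add_tmul]
    · simp only [key U _ (notMem_of_disjoint h.symm hzV)]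
      rw [isPointFunctional_pt.map_update_add _ a z x y (pointsIn_subset V s)
        (mem_pointsIn.mpr ⟨hz, hzV⟩), TensorProduct.tmul_add]
  map_update_smul s a z c x hs hz := by
    have key : ∀ (U : Opens ℂ) (x : R), z ∉ U →
        pt R U (pointsIn U s) (Function.update a z x) = pt R U (pointsIn U s) a := fun U x hzU =>
      pt_congr R (pointsIn_subset U s) rfl fun w hw => Function.update_of_ne (by
        rintro rfl; exact hzU (mem_pointsIn.mp hw).2) _ _
    rcases hs hz with hzU | hzV
    · simp only [key V _ (notMem_of_disjoint h hzU)]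
      rw [isPointFunctional_pt.map_update_smul _ a z c x (pointsIn_subset U s)
        (mem_pointsIn.mpr ⟨hz, hzU⟩), TensorProduct.smul_tmul']
    · simp only [key U _ (notMem_of_disjoint h.symm hzV)]
      rw [isPointFunctional_pt.map_update_smul _ a z c x (pointsIn_subset V s)
        (mem_pointsIn.mpr ⟨hz, hzV⟩), TensorProduct.tmul_smul]

/-- The map `F(U ⊔ V) → F(U) ⊗ F(V)` for disjoint `U`, `V`. -/
def split (h : Disjoint U V) : Obj R (U ⊔ V) →ₗ[ℂ] (Obj R U) ⊗[ℂ] (Obj R V) :=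
  (isPointFunctional_split h).liftPt

theorem split_pt (h : Disjoint U V) {s : Finset ℂ} (hs : (s : Set ℂ) ⊆ (U ⊔ V : Opens ℂ))
    (a : ℂ → R) :
    split h (pt R (U ⊔ V) s a) = pt R U (pointsIn U s) a ⊗ₜ pt R V (pointsIn V s) a :=
  (isPointFunctional_split h).liftPt_pt hs a

theorem mul_split (h : Disjoint U V) (x : Obj R (U ⊔ V)) :
    mul R h (le_refl (U ⊔ V)) (split h x) = x := by
  suffices H : mul R h (le_refl (U ⊔ V)) ∘ₗ split h = (LinearMap.id : Obj R (U ⊔ V) →ₗ[ℂ] _) from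
    LinearMap.congr_fun H x
  refine hom_ext_pt (P := Obj R (U ⊔ V)) fun s a hs => ?_
  rw [LinearMap.comp_apply, split_pt h hs, mul_pt_same R h _ (pointsIn_subset U s)
    (pointsIn_subset V s), LinearMap.id_apply]
  congr 1
  ext z
  rw [Finset.mem_union, mem_pointsIn, mem_pointsIn, ← and_or_left]
  exact ⟨And.left, fun hz => ⟨hz, hs hz⟩⟩

theorem split_mul (h : Disjoint U V) (x : (Obj R U) ⊗[ℂ] (Obj R V)) :
    split h (mul R h (le_refl (U ⊔ V)) x) = x := by
  suffices H : split h ∘ₗ mul R h (le_refl (U ⊔ V)) = LinearMap.id from LinearMap.congr_fun H x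
  refine tensor_hom_ext_pt (P := (Obj R U) ⊗[ℂ] (Obj R V)) R fun s t a b hs ht => ?_
  have hst : ((s ∪ t : Finset ℂ) : Set ℂ) ⊆ (U ⊔ V : Opens ℂ) := by
    rw [Finset.coe_union]
    exact Set.union_subset (hs.trans (le_sup_left : U ≤ U ⊔ V))
      (ht.trans (le_sup_right : V ≤ U ⊔ V))
  rw [LinearMap.comp_apply, mul_pt R h _ hs ht, split_pt h hst, LinearMap.id_apply]
  have hU : pointsIn U (s ∪ t) = s := by
    ext z
    rw [mem_pointsIn, Finset.mem_union]
    exact ⟨fun hz => hz.1.resolve_right fun hz' => notMem_of_disjoint h hz.2 (ht hz'),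
      fun hz => ⟨Or.inl hz, hs hz⟩⟩
  have hV : pointsIn V (s ∪ t) = t := by
    ext z
    rw [mem_pointsIn, Finset.mem_union]
    exact ⟨fun hz => hz.1.resolve_left fun hz' => notMem_of_disjoint h (hs hz') hz.2,
      fun hz => ⟨Or.inr hz, ht hz⟩⟩
  rw [hU, hV]
  congr 1
  · exact pt_congr R hs rfl fun z hz => if_pos hz
  · exact pt_congr R ht rfl fun z hz => if_neg fun hz' : z ∈ s =>
      notMem_of_disjoint h (hs hz') (ht hz)

-- When one label varies, its point lies in `U` or in `V` and only the corresponding tensor factor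
-- moves. So separate continuity of the tensor map is enough, which covers the inductive and the
-- projective topology alike.
include e in
theorem continuous_split (h : Disjoint U V) [t : TopologicalSpace ((Obj R U) ⊗[ℂ] (Obj R V))]
    (ht : IsLocallyConvexTopology t) (h₁ : ∀ x : Obj R U, Continuous fun y : Obj R V => x ⊗ₜ[ℂ] y)
    (h₂ : ∀ y : Obj R V, Continuous fun x : Obj R U => x ⊗ₜ[ℂ] y) :
    Continuous (split (R := R) h) := by
  have := ht.isTopologicalAddGroup
  have := ht.continuousSMul
  have := ht.locallyConvex
  refine continuous_obj_of_separately (E := (Obj R U) ⊗[ℂ] (Obj R V)) e fun s a z hs hz => ?_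
  simp only [split_pt h hs]
  have key : ∀ (U : Opens ℂ) (x : R), z ∉ U →
      pt R U (pointsIn U s) (Function.update a z x) = pt R U (pointsIn U s) a := fun U x hzU =>
    pt_congr R (pointsIn_subset U s) rfl fun w hw => Function.update_of_ne (by
      rintro rfl; exact hzU (mem_pointsIn.mp hw).2) _ _
  rcases hs hz with hzU | hzV
  · simp only [key V _ (notMem_of_disjoint h hzU)]
    exact (h₂ _).comp ((continuous_pt (pointsIn_subset U s)).comp (continuous_update_label a z))
  · simp only [key U _ (notMem_of_disjoint h.symm hzV)]
    exact (h₁ _).comp ((continuous_pt (pointsIn_subset V s)).comp (continuous_update_label a z))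

end Descent

end FLoc

/-! ### Open sets with finitely many connected components -/

namespace FLoc

section Components

open Classical

variable {R : Type u} [CommRing R] [Algebra ℂ R] {U V W : Opens ℂ}

/-- Every connected component of `U` contains exactly one disc of `L`. -/
structure IsComponentSystem (U : Opens ℂ) (L : DiscUnion) : Prop where
  le : L.carrier ≤ U
  existsUnique : ∀ z ∈ U, ∃! d : L.discs,
    connectedComponentIn (U : Set ℂ) d.1.1 = connectedComponentIn (U : Set ℂ) z

theorem isComponentSystem_singleton {L : DiscUnion} (hU : IsPreconnected (U : Set ℂ))
    (hL : L.carrier ≤ U) (d : L.discs) (hd : ∀ d' : L.discs, d' = d) : IsComponentSystem U L :=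
  ⟨hL, fun z hz => ⟨d, by
    beta_reduce
    rw [hU.connectedComponentIn hz, hU.connectedComponentIn (hL (L.disc_le d (L.mem_disc d)))],
    fun d' _ => hd d'⟩⟩

/-- Choose one point in each component and small disjoint discs around these points. -/
theorem exists_isComponentSystem (U : Opens ℂ) [Finite (ConnectedComponents U)] :
    ∃ L, IsComponentSystem U L := by
  have := Fintype.ofFinite (ConnectedComponents U)
  let r : ConnectedComponents U → ℂ := fun c => (Quotient.out c : U).1
  have hr : ∀ c, r c ∈ U := fun c => (Quotient.out c : U).2
  have hcc : ∀ x y : U, connectedComponentIn (U : Set ℂ) x.1 = connectedComponentIn (U : Set ℂ) y.1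
      ↔ (x : ConnectedComponents U) = y := fun x y => by
    rw [ConnectedComponents.coe_eq_coe, connectedComponentIn_eq_image x.2,
      connectedComponentIn_eq_image y.2]
    exact Set.image_injective.mpr Subtype.val_injective |>.eq_iff
  have hout : ∀ c : ConnectedComponents U, ((Quotient.out c : U) : ConnectedComponents U) = c :=
    Quotient.out_eq
  let s : Finset ℂ := Finset.univ.image r
  have hs : (s : Set ℂ) ⊆ U := fun z hz => by
    obtain ⟨c, -, rfl⟩ := Finset.mem_image.mp (Finset.mem_coe.mp hz)
    exact hr c
  obtain ⟨ε, hε⟩ := exists_isAdmissibleRadius hs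
  refine ⟨hε.discUnion, hε.discUnion_le, fun z hz => ?_⟩
  let c : ConnectedComponents U := ((⟨z, hz⟩ : U) : ConnectedComponents U)
  refine ⟨⟨(r c, ε), hε.mem_discs.mpr ⟨Finset.mem_image_of_mem _ (Finset.mem_univ _), rfl⟩⟩,
    (hcc _ ⟨z, hz⟩).mpr (hout c), fun d hd => ?_⟩
  obtain ⟨h1, h2⟩ := hε.mem_discs.mp d.2
  obtain ⟨c', -, hc'⟩ := Finset.mem_image.mp h1
  refine Subtype.ext (Prod.ext ?_ h2)
  change connectedComponentIn (U : Set ℂ) d.1.1 = connectedComponentIn (U : Set ℂ) z at hd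
  rw [← hc'] at hd ⊢
  have := (hcc _ ⟨z, hz⟩).mp hd
  rw [hout] at this
  rw [this]

variable {L : DiscUnion} (hL : IsComponentSystem U L)
include hL

/-- The label at `z` enters only the factor of the component of `z`, multiplied by a constant.
Merging preserves the products over components, since a disc contained in `U` lies in one component.
-/
theorem isPointFunctional_components : IsPointFunctional U fun s (a : ℂ → R) =>
    (PiTensorProduct.tprod ℂ fun d : L.discs => ∏ z ∈ s with
      connectedComponentIn (U : Set ℂ) d.1.1 = connectedComponentIn (U : Set ℂ) z, a z) := by
  have key : ∀ (s : Finset ℂ) (a : ℂ → R) (z : ℂ), (s : Set ℂ) ⊆ U → z ∈ s →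
      ∃ (k : L.discs) (b : L.discs → R) (c : R), ∀ x,
        (fun d : L.discs => ∏ w ∈ s with connectedComponentIn (U : Set ℂ) d.1.1 =
          connectedComponentIn (U : Set ℂ) w, Function.update a z x w) =
        Function.update b k (x * c) := by
    intro s a z hs hz
    obtain ⟨k, hk, huniq⟩ := hL.existsUnique z (hs hz)
    refine ⟨k, fun d => ∏ w ∈ s with connectedComponentIn (U : Set ℂ) d.1.1 =
      connectedComponentIn (U : Set ℂ) w, a w, ∏ w ∈ ({w ∈ s | connectedComponentIn (U : Set ℂ)
        k.1.1 = connectedComponentIn (U : Set ℂ) w} : Finset ℂ) \ {z}, a w, fun x => ?_⟩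
    funext d
    by_cases hd : d = k
    · subst hd
      rw [Function.update_self, Finset.prod_update_of_mem (Finset.mem_filter.mpr ⟨hz, hk⟩)]
    · rw [Function.update_of_ne hd, Finset.prod_update_of_notMem]
      exact fun h => hd (huniq d (Finset.mem_filter.mp h).2)
  refine ⟨fun t ht => ?_, fun s a z x y hs hz => ?_, fun s a z r x hs hz => ?_⟩
  · obtain ⟨ε, hε⟩ := exists_isAdmissibleRadius ht
    refine ⟨ε, hε, fun s a b hs hb => ?_⟩
    congr 1
    funext d
    have h1 : ({z ∈ s | connectedComponentIn (U : Set ℂ) d.1.1 =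
          connectedComponentIn (U : Set ℂ) z} : Finset ℂ) =
        ({w ∈ t | connectedComponentIn (U : Set ℂ) d.1.1 =
          connectedComponentIn (U : Set ℂ) w} : Finset ℂ).biUnion
            fun w => {z ∈ s | z ∈ disc w ε} := by
      ext z
      simp only [Finset.mem_filter, Finset.mem_biUnion]
      constructor
      · rintro ⟨hz, h⟩
        obtain ⟨w, hw, hzw⟩ := hs z hz
        exact ⟨w, ⟨hw, h.trans (connectedComponentIn_eq_of_mem_disc (hε.le w hw) hzw)⟩, hz, hzw⟩
      · rintro ⟨w, ⟨hw, h⟩, hz, hzw⟩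
        exact ⟨hz, h.trans (connectedComponentIn_eq_of_mem_disc (hε.le w hw) hzw).symm⟩
    rw [h1, Finset.prod_biUnion]
    · exact Finset.prod_congr rfl fun w hw => (hb w (Finset.mem_filter.mp hw).1).symm
    · intro w hw w' hw' hne
      rw [Function.onFun, Finset.disjoint_left]
      intro z hz hz'
      exact hne (hε.eq_of_mem (Finset.mem_filter.mp hw).1 (Finset.mem_filter.mp hw').1
        (Finset.mem_filter.mp hz).2 (Finset.mem_filter.mp hz').2)
  · obtain ⟨k, b, c, h⟩ := key s a z hs hz
    simp only [h, add_mul, MultilinearMap.map_update_add]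
  · obtain ⟨k, b, c, h⟩ := key s a z hs hz
    simp only [h, smul_mul_assoc, MultilinearMap.map_update_smul]

/-- The map from `F(U)` to the tensor power of `R` indexed by the connected components of `U`. -/
def toBase : Obj R U →ₗ[ℂ] Base R L := (isPointFunctional_components hL).liftPt

theorem toBase_pt {s : Finset ℂ} (hs : (s : Set ℂ) ⊆ U) (a : ℂ → R) :
    toBase hL (pt R U s a) = PiTensorProduct.tprod ℂ fun d : L.discs => ∏ z ∈ s with
      connectedComponentIn (U : Set ℂ) d.1.1 = connectedComponentIn (U : Set ℂ) z, a z :=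
  (isPointFunctional_components hL).liftPt_pt hs a

/-- By `eq_of_components` every configuration equals the one with a single point in each component,
labelled by the product of the labels there. -/
theorem of_toBase (x : Obj R U) : of R L hL.le (toBase hL x) = x := by
  suffices H : of R L hL.le ∘ₗ toBase hL = LinearMap.id from LinearMap.congr_fun H x
  refine hom_ext_pt (P := Obj R U) fun s a hs => ?_
  rw [LinearMap.comp_apply, toBase_pt hL hs, LinearMap.id_apply, of_tprod]
  refine (isMerging_pt R U).eq_of_components (L.centers_subset.trans hL.le) hs fun z hz => ?_
  obtain ⟨d, hd, huniq⟩ := hL.existsUnique z hz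
  have h1 : ({x ∈ L.centers | connectedComponentIn (U : Set ℂ) x =
      connectedComponentIn (U : Set ℂ) z} : Finset ℂ) = {d.1.1} := by
    ext x
    rw [Finset.mem_filter, Finset.mem_singleton, DiscUnion.mem_centers]
    constructor
    · rintro ⟨⟨e, rfl⟩, he⟩
      rw [huniq e he]
    · rintro rfl
      exact ⟨⟨d, rfl⟩, hd⟩
  rw [h1, Finset.prod_singleton, DiscUnion.label_center]
  refine Finset.prod_congr (Finset.filter_congr fun w _ => ?_) fun _ _ => rfl
  rw [show connectedComponentIn (U : Set ℂ) d.1.1 = connectedComponentIn (U : Set ℂ) z from hd]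
  exact eq_comm

theorem toBase_of (x : Base R L) : toBase hL (of R L hL.le x) = x := by
  suffices H : toBase hL ∘ₗ of R L hL.le = LinearMap.id from LinearMap.congr_fun H x
  refine PiTensorProduct.ext (MultilinearMap.ext fun a => ?_)
  simp only [LinearMap.compMultilinearMap_apply, LinearMap.comp_apply, LinearMap.id_apply]
  rw [of_tprod, toBase_pt hL (L.centers_subset.trans hL.le)]
  congr 1
  funext d
  have h1 : ({z ∈ L.centers | connectedComponentIn (U : Set ℂ) d.1.1 =
      connectedComponentIn (U : Set ℂ) z} : Finset ℂ) = {d.1.1} := by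
    obtain ⟨d', -, huniq⟩ := hL.existsUnique d.1.1 (hL.le (L.disc_le d (L.mem_disc d)))
    ext x
    rw [Finset.mem_filter, Finset.mem_singleton, DiscUnion.mem_centers]
    constructor
    · rintro ⟨⟨e, rfl⟩, he⟩
      rw [huniq e he.symm, huniq d rfl]
    · rintro rfl
      exact ⟨⟨d, rfl⟩, rfl⟩
  rw [h1, Finset.prod_singleton, DiscUnion.label_center]

variable [TopologicalSpace R] [ContinuousMul R] {I : Type*} [Countable I] (e : R ≃L[ℂ] (I → ℂ))
include e

theorem continuous_toBase : Continuous (toBase (R := R) hL) :=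
  continuous_obj_of_separately (E := Base R L) e fun s a z hs _ => by
    simp only [toBase_pt hL hs]
    exact continuous_tprod.comp (continuous_pi fun d => continuous_finsetProd _ fun w _ =>
      (continuous_apply w).comp (continuous_update_label a z))

-- The same discs represent the components of `V` and of `U`, so both spaces are identified with the
-- same tensor power of `R`, compatibly with the structure map.
omit hL in
theorem isHomeomorph_map (h : V ≤ U) {M : DiscUnion} (hM : IsComponentSystem V M)
    (hMU : IsComponentSystem U M) : IsHomeomorph (map R h) := by
  have h1 : ∀ x, map R h (of R M hM.le x) = of R M hMU.le x := fun x => by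
    rw [map, lift_of]
  refine isHomeomorph_iff_exists_inverse.mpr ⟨continuous_map e h,
    fun x => of R M hM.le (toBase hMU x), fun x => ?_, fun x => ?_,
    (continuous_of M hM.le).comp (continuous_toBase hMU e)⟩
  · obtain ⟨y, rfl⟩ : ∃ y, of R M hM.le y = x := ⟨_, of_toBase hM x⟩
    rw [h1]
    exact congrArg (of R M hM.le) (toBase_of hMU y)
  · rw [h1, of_toBase]

/-- Through `toBase` both factors become tensor powers of `R`, where the separate continuity of the
multiplication implies joint continuity. -/
theorem continuous_mul_prod {M : DiscUnion} (hM : IsComponentSystem V M) (h : Disjoint U V)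
    (h' : U ⊔ V ≤ W) :
    Continuous fun p : Obj R U × Obj R V => mul R h h' (p.1 ⊗ₜ p.2) := by
  let B : Base R L →ₗ[ℂ] Base R M →ₗ[ℂ] Obj R W :=
    (TensorProduct.curry (mul R h h')).compl₁₂ (of R L hL.le) (of R M hM.le)
  have hB : Continuous fun u : Base R L × Base R M => B u.1 u.2 := by
    refine continuous_tensorPower_prod_of_separately e B fun a i => ?_
    simp only [B, LinearMap.compl₁₂_apply, TensorProduct.curry_apply, of_tprod]
    rcases i with d | d
    · have hc : ∀ x, (fun j => Function.update a (Sum.inl d) x (Sum.inr j)) =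
          fun j : M.discs => a (Sum.inr j) := fun x => funext fun j =>
        Function.update_of_ne Sum.inr_ne_inl _ _
      simp only [hc]
      refine (continuous_mul_left e h h' _).comp ((continuous_pt
        (L.centers_subset.trans hL.le)).comp ?_)
      have : ∀ x, L.label (fun j => Function.update a (Sum.inl d) x (Sum.inl j)) =
          Function.update (L.label fun j => a (Sum.inl j)) d.1.1 x := fun x => by
        rw [← L.label_update]
        congr 1
        funext j
        by_cases hj : j = d
        · subst hj; simp
        · rw [Function.update_of_ne hj, Function.update_of_ne fun h => hj (Sum.inl_injective h)]
      simp only [this]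
      exact continuous_update_label _ _
    · have hc : ∀ x, (fun j => Function.update a (Sum.inr d) x (Sum.inl j)) =
          fun j : L.discs => a (Sum.inl j) := fun x => funext fun j =>
        Function.update_of_ne Sum.inl_ne_inr _ _
      simp only [hc]
      refine (continuous_mul_right e h h' _).comp ((continuous_pt
        (M.centers_subset.trans hM.le)).comp ?_)
      have : ∀ x, M.label (fun j => Function.update a (Sum.inr d) x (Sum.inr j)) =
          Function.update (M.label fun j => a (Sum.inr j)) d.1.1 x := fun x => by
        rw [← M.label_update]
        congr 1
        funext j
        by_cases hj : j = d
        · subst hj; simp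
        · rw [Function.update_of_ne hj, Function.update_of_ne fun h => hj (Sum.inr_injective h)]
      simp only [this]
      exact continuous_update_label _ _
  refine (hB.comp (((continuous_toBase hL e).comp continuous_fst).prodMk
    ((continuous_toBase hM e).comp continuous_snd))).congr fun p => ?_
  simp only [Function.comp_apply, B, LinearMap.compl₁₂_apply, TensorProduct.curry_apply, of_toBase]

end Components

end FLoc

/-! ### The completion of a commutative graded vertex algebra -/

namespace CommGradedVertexAlgebra

namespace Completion

variable {V : Type u} [AddCommGroup V] [Module ℂ V] {A : CommGradedVertexAlgebra V}

theorem expT_zero (a : A.Completion) : expT 0 a = a := by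
  ext Δ
  rw [expT_apply, finsum_eq_single _ 0]
  · simp only [pow_zero, Nat.factorial_zero, Nat.cast_one, div_one, one_smul, Module.End.one_apply]
    rw [show Δ - ((0 : ℕ) : ℤ) = Δ by simp]
  · intro n hn
    rw [zero_pow hn, zero_div, zero_smul]

theorem expT_expT (z w : ℂ) (a : A.Completion) : expT z (expT w a) = expT (z + w) a := by
  obtain ⟨N, hN⟩ := exists_bound A
  ext Δ
  set K : ℕ := (Δ - N).toNat with hKdef
  have hK : Δ - N ≤ K := Int.self_le_toNat _
  -- The terms of the product of the two exponential series in weight `Δ`. They vanish for `p.1 +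
  -- p.2 > K`, so the sum over the square equals the sum over the triangle, which the binomial
  -- theorem evaluates.
  let f : ℕ × ℕ → V := fun p =>
    (z ^ p.1 / (p.1.factorial : ℂ) * (w ^ p.2 / (p.2.factorial : ℂ))) •
      ((shiftT ^ (p.1 + p.2)) a Δ : V)
  have h1 : (expT z (expT w a) Δ : V) =
      ∑ p ∈ Finset.range (K + 1) ×ˢ Finset.range (K + 1), f p := by
    rw [expT_apply_eq_sum hN z _ hK, sum_apply, Finset.sum_product]
    refine Finset.sum_congr rfl fun n _ => ?_
    rw [smul_apply, shiftT_pow_apply, expT_apply_eq_sum hN w a (K := K) (by omega), sum_apply,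
      map_sum, Finset.smul_sum]
    refine Finset.sum_congr rfl fun m _ => ?_
    simp only [f]
    rw [smul_apply, map_smul, smul_smul, pow_add, Module.End.mul_apply, shiftT_pow_apply,
      shiftT_pow_apply, shiftT_pow_apply]
  have h2 : ∀ p : ℕ × ℕ, K < p.1 + p.2 → f p = 0 := fun p hp => by
    simp only [f]
    rw [shiftT_pow_apply, hN a _ (by push_cast; omega), map_zero, smul_zero]
  have h3 : (expT (z + w) a Δ : V) =
      ∑ n ∈ Finset.range (K + 1), ∑ p ∈ Finset.HasAntidiagonal.antidiagonal n, f p := by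
    rw [expT_apply_eq_sum hN _ a hK, sum_apply]
    refine Finset.sum_congr rfl fun n _ => ?_
    have h4 : ∀ p ∈ Finset.HasAntidiagonal.antidiagonal n, f p =
        (z ^ p.1 / (p.1.factorial : ℂ) * (w ^ p.2 / (p.2.factorial : ℂ))) •
          ((shiftT ^ n) a Δ : V) := fun p hp => by
      simp only [f, Finset.HasAntidiagonal.mem_antidiagonal.mp hp]
    rw [Finset.sum_congr rfl h4, ← Finset.sum_smul, smul_apply]
    congr 1
    rw [(Commute.all z w).add_pow', Finset.sum_div]
    refine Finset.sum_congr rfl fun p hp => ?_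
    have hp := Finset.HasAntidiagonal.mem_antidiagonal.mp hp
    have := Nat.factorial_ne_zero p.1
    have := Nat.factorial_ne_zero p.2
    have := Nat.factorial_ne_zero (p.1 + p.2)
    rw [← hp, Nat.choose_symm_add, nsmul_eq_mul, Nat.add_choose, Nat.cast_div
      (Nat.factorial_mul_factorial_dvd_factorial_add _ _) (Nat.cast_ne_zero.mpr
        (Nat.mul_ne_zero (Nat.factorial_ne_zero _) (Nat.factorial_ne_zero _)))]
    push_cast
    field_simp
  rw [h1, h3, Finset.sum_sigma', eq_comm]
  refine Finset.sum_bij_ne_zero (fun x _ _ => x.2) ?_ ?_ ?_ ?_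
  · rintro ⟨n, p⟩ h _
    simp only [Finset.mem_sigma, Finset.mem_range, Finset.HasAntidiagonal.mem_antidiagonal,
      Finset.mem_product] at h ⊢
    omega
  · rintro ⟨n, p⟩ h _ ⟨m, q⟩ h' _ e
    simp only [Finset.mem_sigma, Finset.mem_range, Finset.HasAntidiagonal.mem_antidiagonal]
      at h h' e
    obtain rfl := e
    obtain rfl : n = m := by omega
    rfl
  · intro p hp h
    refine ⟨⟨p.1 + p.2, p⟩, ?_, h, rfl⟩
    simp only [Finset.mem_sigma, Finset.mem_range, Finset.HasAntidiagonal.mem_antidiagonal,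
      and_true]
    by_contra hh
    exact h (h2 p (by omega))
  · intros; rfl

/-- `T` raises the weight by one, so moving `q^{L₀}` past `T ^ n` costs `q ^ n`. This is the
relation of the semidirect product. -/
theorem rotL_expT (q : Circle) (z : ℂ) (a : A.Completion) :
    rotL q (expT z a) = expT (q * z) (rotL q a) := by
  ext Δ
  rw [rotL_apply, expT_apply, expT_apply, smul_finsum]
  refine finsum_congr fun n => ?_
  rw [rotL_apply, map_smul, smul_smul, smul_smul, mul_pow, zpow_sub₀ q.coe_ne_zero, zpow_natCast]
  congr 1
  have := pow_ne_zero n q.coe_ne_zero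
  field_simp

theorem rotL_rotL (q r : Circle) (a : A.Completion) : rotL q (rotL r a) = rotL (q * r) a := by
  ext Δ
  rw [rotL_apply, rotL_apply, rotL_apply, smul_smul, Circle.coe_mul, mul_zpow]

theorem rotL_one (a : A.Completion) : rotL 1 a = a := by
  ext Δ
  rw [rotL_apply, Circle.coe_one, one_zpow, one_smul]

variable (A) in
/-- The action of a rigid motion on the completion. -/
def motionHom (g : RigidMotion) : A.Completion →ₐ[ℂ] A.Completion :=
  (expTHom g.trans).comp (rotLHom g.rot)

theorem motionHom_apply (g : RigidMotion) (a : A.Completion) :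
    motionHom A g a = expT g.trans (rotL g.rot a) := rfl

theorem motionHom_mul (g h : RigidMotion) (a : A.Completion) :
    motionHom A (g * h) a = motionHom A g (motionHom A h a) := by
  simp only [motionHom_apply, RigidMotion.mul_def]
  rw [rotL_expT, expT_expT, rotL_rotL]

theorem motionHom_one (a : A.Completion) : motionHom A 1 a = a := by
  simp only [motionHom_apply, RigidMotion.one_def]
  rw [rotL_one, expT_zero]

/-! ### The topology of the completion -/

instance weightTopology (Δ : ℤ) : TopologicalSpace (A.gr Δ) := moduleTopology ℂ (A.gr Δ)

instance (Δ : ℤ) : IsModuleTopology ℂ (A.gr Δ) := ⟨rfl⟩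

instance (Δ : ℤ) : IsTopologicalAddGroup (A.gr Δ) := IsModuleTopology.topologicalAddGroup ℂ _

theorem continuous_eval (Δ : ℤ) : Continuous fun a : A.Completion => a Δ :=
  continuous_iInf_dom continuous_induced_dom

theorem continuous_of_eval {X : Type*} [TopologicalSpace X] {f : X → A.Completion}
    (h : ∀ Δ, Continuous fun x => f x Δ) : Continuous f :=
  continuous_iInf_rng.mpr fun Δ => continuous_induced_rng.mpr (h Δ)

theorem continuous_rotLHom (q : Circle) : Continuous (rotLHom q : A.Completion →ₐ[ℂ] _) :=
  continuous_of_eval fun Δ => (continuous_eval Δ).const_smul ((q : ℂ) ^ Δ)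

/-- `T ^ n` as a map between weight spaces. -/
def weightT (n : ℕ) (Δ : ℤ) : A.gr (Δ - n) →ₗ[ℂ] A.gr Δ :=
  ((A.T ^ n).domRestrict _).codRestrict _ fun a => A.T_pow_mem (by omega) a.2

/-- The number of terms depends on `Δ` but not on `a` or `z`. This makes each component visibly
continuous in `a` and polynomial in `z`. -/
theorem expT_apply_eq_weightT {N : ℤ}
    (hN : ∀ (a : A.Completion) (Δ : ℤ), Δ < N → (a Δ : V) = 0) (z : ℂ) (a : A.Completion) (Δ : ℤ) :
    expT z a Δ = ∑ n ∈ Finset.range ((Δ - N).toNat + 1), (z ^ n / (n.factorial : ℂ)) •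
      weightT n Δ (a (Δ - n)) := by
  refine Subtype.ext ?_
  rw [expT_apply_eq_sum hN z a (Int.self_le_toNat _), sum_apply, AddSubmonoidClass.coe_finsetSum]
  refine Finset.sum_congr rfl fun n _ => ?_
  rw [smul_apply, shiftT_pow_apply]
  rfl

theorem continuous_expTHom (z : ℂ) : Continuous (expTHom z : A.Completion →ₐ[ℂ] A.Completion) := by
  obtain ⟨N, hN⟩ := exists_bound A
  refine continuous_of_eval fun Δ => ?_
  change Continuous fun a : A.Completion => expT z a Δ
  simp only [expT_apply_eq_weightT hN]
  exact continuous_finsetSum _ fun n _ =>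
    ((IsModuleTopology.continuous_of_linearMap (R := ℂ) (weightT n Δ)).comp
      (continuous_eval _)).const_smul (z ^ n / (n.factorial : ℂ))

theorem continuous_motionHom (g : RigidMotion) : Continuous (motionHom A g) :=
  (continuous_expTHom g.trans).comp (continuous_rotLHom g.rot)

/-- The multiplication as a bilinear map between weight spaces. -/
def weightMul (i Δ : ℤ) : A.gr i →ₗ[ℂ] A.gr (Δ - i) →ₗ[ℂ] A.gr Δ :=
  LinearMap.mk₂ ℂ (fun a b => ⟨A.prod a b, A.prod_mem (by omega) a.2 b.2⟩)
    (fun a a' b => Subtype.ext (by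
      change A.prod (a + a' : V) b = A.prod a b + A.prod a' b
      rw [A.prod_comm, A.prod_add, A.prod_comm b, A.prod_comm b]))
    (fun c a b => Subtype.ext (by
      change A.prod (c • a : V) b = c • A.prod a b
      rw [A.prod_comm, A.prod_smul, A.prod_comm b]))
    (fun a b b' => Subtype.ext (A.prod_add _ _ _))
    (fun c a b => Subtype.ext (A.prod_smul _ _ _))

theorem mul_apply_eq_weightMul {N : ℤ}
    (hN : ∀ (a : A.Completion) (Δ : ℤ), Δ < N → (a Δ : V) = 0) (a b : A.Completion) (Δ : ℤ) :
    (a * b) Δ = ∑ i ∈ Finset.Icc N (Δ - N), weightMul i Δ (a i) (b (Δ - i)) := by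
  refine Subtype.ext ?_
  rw [mul_apply, AddSubmonoidClass.coe_finsetSum, finsum_eq_sum_of_support_subset
    (s := Finset.Icc N (Δ - N))]
  · rfl
  · intro i hi
    by_contra h
    rw [Finset.coe_Icc, Set.mem_Icc, not_and_or, not_le, not_le] at h
    refine hi ?_
    rcases h with h | h
    · beta_reduce
      rw [hN a i h, A.prod_comm]; exact map_zero _
    · beta_reduce
      rw [hN b (Δ - i) (by omega)]; exact map_zero _

/-! ### Finite-dimensional weight spaces: the completion as a countable product of lines. -/

section Finite

variable [∀ Δ, FiniteDimensional ℂ (A.gr Δ)]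

/-- As the weights are bounded below, each component of a product is a fixed finite sum of bilinear
maps between finite-dimensional spaces. -/
instance : ContinuousMul A.Completion where
  continuous_mul := by
    obtain ⟨N, hN⟩ := exists_bound A
    refine continuous_of_eval fun Δ => ?_
    simp only [mul_apply_eq_weightMul hN]
    exact continuous_finsetSum _ fun i _ =>
      (IsModuleTopology.continuous_bilinear_of_finite_left (R := ℂ) (weightMul i Δ)).comp
        (((continuous_eval i).comp continuous_fst).prodMk
          ((continuous_eval (Δ - i)).comp continuous_snd))

variable (A) in
/-- The index set of the coordinates of the completion. -/
abbrev CoordIndex : Type := Σ Δ : ℤ, Fin (Module.finrank ℂ (A.gr Δ))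

variable (A) in
/-- The completion is isomorphic to a countable product of lines. -/
def coordEquiv : A.Completion ≃L[ℂ] (CoordIndex A → ℂ) where
  toFun a i := (Module.finBasis ℂ (A.gr i.1)).equivFun (a i.1) i.2
  map_add' a b := funext fun i =>
    congrFun (map_add (Module.finBasis ℂ (A.gr i.1)).equivFun (a i.1) (b i.1)) i.2
  map_smul' c a := funext fun i =>
    congrFun (map_smul (Module.finBasis ℂ (A.gr i.1)).equivFun c (a i.1)) i.2
  invFun x := fun Δ => (Module.finBasis ℂ (A.gr Δ)).equivFun.symm fun k => x ⟨Δ, k⟩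
  left_inv a := funext fun Δ => (Module.finBasis ℂ (A.gr Δ)).equivFun.symm_apply_apply (a Δ)
  right_inv x := funext fun i =>
    congrFun ((Module.finBasis ℂ (A.gr i.1)).equivFun.apply_symm_apply fun k => x ⟨i.1, k⟩) i.2
  continuous_toFun := continuous_pi fun i =>
    (IsModuleTopology.continuous_of_linearMap (R := ℂ)
      (LinearMap.proj i.2 ∘ₗ (Module.finBasis ℂ (A.gr i.1)).equivFun.toLinearMap)).comp
        (continuous_eval i.1)
  continuous_invFun := continuous_of_eval fun Δ =>
    (IsModuleTopology.continuous_of_linearMap (R := ℂ)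
      (Module.finBasis ℂ (A.gr Δ)).equivFun.symm.toLinearMap).comp
        (continuous_pi fun k => continuous_apply (⟨Δ, k⟩ : CoordIndex A))

instance : IsTopologicalAddGroup A.Completion :=
  have : IsInducing ((coordEquiv A).toLinearEquiv.toLinearMap :
      A.Completion →ₗ[ℂ] (CoordIndex A → ℂ)) :=
    (coordEquiv A).toHomeomorph.isInducing
  this.topologicalAddGroup

instance : ContinuousSMul ℂ A.Completion :=
  have : IsInducing ((coordEquiv A).toLinearEquiv.toLinearMap :
      A.Completion →ₗ[ℂ] (CoordIndex A → ℂ)) :=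
    (coordEquiv A).toHomeomorph.isInducing
  this.continuousSMul continuous_id (map_smul _ _ _)

instance : LocallyConvexSpace ℝ A.Completion := by
  have h := LocallyConvexSpace.induced (((coordEquiv A).toLinearEquiv.toLinearMap :
      A.Completion →ₗ[ℂ] (CoordIndex A → ℂ)).restrictScalars ℝ)
  convert h
  exact (coordEquiv A).toHomeomorph.isInducing.eq_induced

end Finite

end Completion

end CommGradedVertexAlgebra

/-! ### The factorization algebra axioms -/

/-- The union of discs that consists of one disc. -/
def DiscUnion.single (z : ℂ) {r : ℝ} (hr : 0 < r) : DiscUnion :=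
  ⟨{(z, r)}, by simpa using hr, by simp⟩

namespace FLoc

theorem isComponentSystem_single {z : ℂ} {r : ℝ} (hr : 0 < r) {U : Opens ℂ}
    (hU : IsPreconnected (U : Set ℂ)) (h : disc z r ≤ U) :
    IsComponentSystem U (DiscUnion.single z hr) :=
  isComponentSystem_singleton hU (iSup_le fun d => by
      have hd : d.1 = (z, r) := Finset.mem_singleton.mp d.2
      rwa [hd]) ⟨(z, r), Finset.mem_singleton_self _⟩
    fun d => Subtype.ext (Finset.mem_singleton.mp d.2)

section Axioms

variable {R : Type u} [CommRing R] [Algebra ℂ R] [TopologicalSpace R]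

/-- Used with separate continuity as `P` for the inductive and with joint continuity for the
projective tensor product. -/
theorem continuous_mul_finestLC {U V W : Opens ℂ}
    {P : TopologicalSpace ((Obj R U) ⊗[ℂ] (Obj R V)) → Prop} (h : Disjoint U V) (h' : U ⊔ V ≤ W)
    (hP : P ((objTopology : TopologicalSpace (Obj R W)).induced (mul R h h'))) :
    Continuous[finestLC P, objTopology] (mul R h h') :=
  continuous_finestLC_dom (E := (Obj R U) ⊗[ℂ] (Obj R V)) (mul R h h') hP

variable {I : Type*} [Countable I] (e : R ≃L[ℂ] (I → ℂ)) {φ : RigidMotion → (R →ₐ[ℂ] R)}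
include e

/-- The inverse `split` is continuous for every locally convex topology with separately continuous
tensor map, so only the continuity of the multiplication depends on the choice of tensor product. -/
theorem isHomeomorph_mul {U V : Opens ℂ} (h : Disjoint U V)
    {t : TopologicalSpace ((Obj R U) ⊗[ℂ] (Obj R V))} (ht : IsLocallyConvexTopology t)
    (h₁ : ∀ x : Obj R U, Continuous fun y : Obj R V => x ⊗ₜ[ℂ] y)
    (h₂ : ∀ y : Obj R V, Continuous fun x : Obj R U => x ⊗ₜ[ℂ] y)
    (hmul : Continuous (mul R h (le_refl (U ⊔ V)))) :
    IsHomeomorph (mul R h (le_refl (U ⊔ V))) :=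
  isHomeomorph_iff_exists_inverse.mpr ⟨hmul, split h, split_mul h, mul_split h,
    continuous_split e h ht h₁ h₂⟩

theorem isPrefactorizationAlgebra :
    (_root_.FLoc R φ).toPrefactorizationData.IsPrefactorizationAlgebra where
  continuous_map h := continuous_map e h
  continuous_mul {U V W} h h' :=
    continuous_mul_finestLC h h'
      ⟨fun x => continuous_induced_rng.mpr (continuous_mul_right e h h' x),
        fun y => continuous_induced_rng.mpr (continuous_mul_left e h h' y)⟩
  continuous_unit := by
    let x : Obj R ⊥ := of R DiscUnion.empty DiscUnion.carrier_empty.le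
      (PiTensorProduct.tprod ℂ fun _ => 1)
    exact Continuous.smul (f := fun c : ℂ => c) (g := fun _ => x) continuous_id continuous_const
  map_id := map_id R
  map_comp := map_comp R
  map_mul := map_mul R
  mul_map := mul_map R
  mul_comm := mul_comm R
  mul_assoc := mul_assoc R
  unit_mul := unit_mul R
  mul_unit := mul_unit R

theorem isEquivariantPrefactorizationAlgebra (hφ : ∀ g, Continuous (φ g))
    (hmul : ∀ g h x, φ (g * h) x = φ g (φ h x)) (hone : ∀ x, φ 1 x = x) :
    (_root_.FLoc R φ).IsEquivariantPrefactorizationAlgebra where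
  isPrefactorizationAlgebra := isPrefactorizationAlgebra e
  continuous_act g _ := continuous_act e (φ g) (hφ g) g
  act_map g _ _ h := act_map (φ g) g h
  act_mul_act := act_mul_act hmul
  act_one := act_one hone
  act_mul g _ _ _ h h' := act_mul (φ g) g h h'
  act_unit g := act_unit (φ g) g

theorem isFactorizationAlgebra :
    (_root_.FLoc R φ).toPrefactorizationData.IsFactorizationAlgebra where
  isPrefactorizationAlgebra := isPrefactorizationAlgebra e
  weiss U c hc E f hf := by
    obtain ⟨g, hg, hgf⟩ := exists_glue e c hc (fun i => (f i).toLinearMap)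
      (fun i => (f i).continuous) hf
    refine ⟨⟨g, hg⟩, hgf, fun g' hg' => ContinuousLinearMap.coe_injective ?_⟩
    exact hom_ext_of_isWeissCover c hc fun i x => (hg' i x).trans (hgf i x).symm
  mul_iso {U V} h :=
    isHomeomorph_mul e h (isLocallyConvexTopology_finestLC _)
      (fun x => continuous_finestLC_rng (E := (Obj R U) ⊗[ℂ] (Obj R V)) fun _ ht => ht.1 x)
      (fun y => continuous_finestLC_rng (E := (Obj R U) ⊗[ℂ] (Obj R V)) fun _ ht => ht.2 y)
      ((isPrefactorizationAlgebra (φ := φ) e).continuous_mul h le_rfl)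

variable [ContinuousMul R]

theorem isProjectiveOnFinite :
    (_root_.FLoc R φ).toPrefactorizationData.IsProjectiveOnFinite := by
  have key : ∀ {U V W : Opens ℂ}, Finite (ConnectedComponents U) →
      Finite (ConnectedComponents V) → ∀ (h : Disjoint U V) (h' : U ⊔ V ≤ W),
      Continuous[projectiveTopology (lcs R U) (lcs R V),
        (objTopology : TopologicalSpace (Obj R W))] (mul R h h') := fun {U V W} _ _ h h' => by
    obtain ⟨L, hL⟩ := exists_isComponentSystem U
    obtain ⟨M, hM⟩ := exists_isComponentSystem V
    exact continuous_mul_finestLC h h'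
      (continuous_induced_rng.mpr (continuous_mul_prod hL e hM h h'))
  refine ⟨key, fun {U V} hU hV h => ?_⟩
  exact isHomeomorph_mul e h (isLocallyConvexTopology_finestLC _)
    (fun x => continuous_finestLC_rng (E := (Obj R U) ⊗[ℂ] (Obj R V)) fun _ ht => 
      Continuous.comp (g := fun p : Obj R U × Obj R V => p.1 ⊗ₜ[ℂ] p.2) ht
        (Continuous.prodMk_right x))
    (fun y => continuous_finestLC_rng (E := (Obj R U) ⊗[ℂ] (Obj R V)) fun _ ht => 
      Continuous.comp (g := fun p : Obj R U × Obj R V => p.1 ⊗ₜ[ℂ] p.2) ht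
        (Continuous.prodMk_left y))
    (key hU hV h le_rfl)

theorem isLocallyConstant :
    (_root_.FLoc R φ).toPrefactorizationData.IsLocallyConstant where
  disc_disc z w r _ hr _ h :=
    isHomeomorph_map e h
      (isComponentSystem_single hr (convex_ball z r).isPreconnected le_rfl)
      (isComponentSystem_single hr (convex_ball w _).isPreconnected h)
  disc_top z r hr :=
    isHomeomorph_map e le_top
      (isComponentSystem_single hr (convex_ball z r).isPreconnected le_rfl)
      (isComponentSystem_single hr isPreconnected_univ le_top)

end Axioms

end FLoc

/-! ### Holomorphic functions with values in a product of lines -/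

section Coords

variable {I : Type*}

/-- Convergence in a product of lines is coordinatewise, so the difference quotient may be treated
one coordinate at a time, with no uniformity in the coordinate. The vectors `ξ` consist of the
partial derivatives of the coordinates. -/
theorem isHolomorphicOn_of_coords {n : ℕ} {E : LCS.{u}} (c : E ≃L[ℂ] (I → ℂ))
    {f : (Fin n → ℂ) → E} {S : Set (Fin n → ℂ)} {g : I → (Fin n → ℂ) → ℂ}
    (hg : ∀ i, Differentiable ℂ (g i)) (h : ∀ z ∈ S, ∀ i, c (f z) i = g i z) :
    IsHolomorphicOn f S := by
  intro a ha
  refine ⟨fun j => c.symm fun i => fderiv ℂ (g i) a (Pi.single j 1), ?_⟩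
  rw [← c.symm.map_zero]
  have h0 : Tendsto (fun z : Fin n → ℂ => fun i : I => (‖WithLp.toLp 2 (z - a)‖⁻¹ : ℂ) •
      (g i z - g i a - fderiv ℂ (g i) a (z - a))) (𝓝[S \ {a}] a) (𝓝 0) := by
    refine tendsto_pi_nhds.mpr fun i => ?_
    refine Asymptotics.IsLittleO.tendsto_inv_smul_nhds_zero
      (g := fun z => ((‖WithLp.toLp 2 (z - a)‖ : ℝ) : ℂ)) ?_
    refine (((hg i a).hasFDerivAt.isLittleO).mono nhdsWithin_le_nhds).trans_isBigO ?_
    -- The derivative is taken for the sup norm, whereas `IsHolomorphicOn` divides by the Euclidean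
    -- norm, which is at least as large.
    refine Asymptotics.IsBigO.of_bound 1 (Eventually.of_forall fun z => ?_)
    rw [one_mul, Complex.norm_real, norm_norm]
    exact (pi_norm_le_iff_of_nonneg (norm_nonneg _)).mpr fun j =>
      PiLp.norm_apply_le (WithLp.toLp 2 (z - a)) j
  refine ((c.symm.continuous.tendsto 0).comp h0).congr' ?_
  refine eventually_nhdsWithin_of_forall fun z hz => c.injective ?_
  rw [Function.comp_apply, c.apply_symm_apply]
  funext i
  have h1 : fderiv ℂ (g i) a (z - a) = ∑ j, (z j - a j) * fderiv ℂ (g i) a (Pi.single j 1) := by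
    conv_lhs => rw [← Finset.univ_sum_single (z - a), map_sum]
    refine Finset.sum_congr rfl fun j _ => ?_
    rw [← smul_eq_mul, ← map_smul, ← Pi.single_smul, smul_eq_mul, mul_one, Pi.sub_apply]
  have h2 : c (∑ j, (z j - a j) • c.symm fun i => fderiv ℂ (g i) a (Pi.single j 1)) i =
      ∑ j, (z j - a j) * fderiv ℂ (g i) a (Pi.single j 1) := by
    rw [map_sum, Finset.sum_apply]
    refine Finset.sum_congr rfl fun j _ => ?_
    rw [map_smul, c.apply_symm_apply, Pi.smul_apply, smul_eq_mul]
  rw [h1, map_smul, map_sub, map_sub, Pi.smul_apply, Pi.sub_apply, Pi.sub_apply, h z hz.1, h a ha,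
    h2]

theorem t2Space_of_coords {E : LCS.{u}} (c : E ≃L[ℂ] (I → ℂ)) : T2Space E :=
  c.toHomeomorph.symm.t2Space

/-- A linear homeomorphism is uniform, so completeness is inherited from the product of lines. -/
theorem quasiCompleteSpace_of_coords {E : LCS.{u}} (c : E ≃L[ℂ] (I → ℂ)) :
    @QuasiCompleteSpace ℂ E _ (IsTopologicalAddGroup.rightUniformSpace _) _ _ := by
  let _ : UniformSpace E := IsTopologicalAddGroup.rightUniformSpace _
  have : IsUniformAddGroup E := isUniformAddGroup_of_addCommGroup
  have : CompleteSpace E :=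
    (completeSpace_congr (e := c.toEquiv) c.isUniformEmbedding).mpr inferInstance
  infer_instance

end Coords

/-! ### The product of all labels -/

namespace FLoc

section Total

open Classical

variable {R : Type u} [CommRing R] [Algebra ℂ R] {U V W : Opens ℂ}

theorem isPointFunctional_prod (U : Opens ℂ) :
    IsPointFunctional U fun s (a : ℂ → R) => ∏ z ∈ s, a z where
  isMerging t ht := by
    obtain ⟨ε, hε⟩ := exists_isAdmissibleRadius ht
    refine ⟨ε, hε, fun s a b hs hb => ?_⟩
    have h1 : s = t.biUnion fun w => {z ∈ s | z ∈ disc w ε} := by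
      ext z
      simp only [Finset.mem_filter, Finset.mem_biUnion]
      exact ⟨fun hz => (hs z hz).imp fun w hw => ⟨hw.1, hz, hw.2⟩, fun ⟨_, _, hz, _⟩ => hz⟩
    beta_reduce
    rw [Finset.prod_congr rfl hb, ← Finset.prod_biUnion, ← h1]
    intro w hw w' hw' hne
    rw [Function.onFun, Finset.disjoint_left]
    exact fun z hz hz' => hne (hε.eq_of_mem hw hw' (Finset.mem_filter.mp hz).2
      (Finset.mem_filter.mp hz').2)
  map_update_add s a z x y _ hz := by
    simp only [Finset.prod_update_of_mem hz, add_mul]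
  map_update_smul s a z c x _ hz := by
    simp only [Finset.prod_update_of_mem hz, smul_mul_assoc]

variable (R) in
/-- The linear map `F(U) → R` that multiplies all labels. -/
def total (U : Opens ℂ) : Obj R U →ₗ[ℂ] R := (isPointFunctional_prod U).liftPt

theorem total_pt {s : Finset ℂ} (hs : (s : Set ℂ) ⊆ U) (a : ℂ → R) :
    total R U (pt R U s a) = ∏ z ∈ s, a z :=
  (isPointFunctional_prod U).liftPt_pt hs a

theorem total_map (h : U ≤ W) (x : Obj R U) : total R W (map R h x) = total R U x := by
  suffices H : total R W ∘ₗ map R h = total R U from LinearMap.congr_fun H x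
  refine hom_ext_pt fun s a hs => ?_
  rw [LinearMap.comp_apply, map_pt R h hs, total_pt hs, total_pt (hs.trans h)]

theorem total_mul (h : Disjoint U V) (h' : U ⊔ V ≤ W) (x : Obj R U) (y : Obj R V) :
    total R W (mul R h h' (x ⊗ₜ y)) = total R U x * total R V y := by
  suffices H : total R W ∘ₗ mul R h h' =
      LinearMap.mul' ℂ R ∘ₗ TensorProduct.map (total R U) (total R V) from
    LinearMap.congr_fun H (x ⊗ₜ y)
  refine tensor_hom_ext_pt R fun s t a b hs ht => ?_
  have hdisj : ∀ z ∈ t, z ∉ s := fun z hz hz' => notMem_of_disjoint h (hs hz') (ht hz)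
  rw [LinearMap.comp_apply, LinearMap.comp_apply, TensorProduct.map_tmul, LinearMap.mul'_apply,
    mul_pt R h h' hs ht, total_pt hs, total_pt ht, total_pt, Finset.prod_union
      (Finset.disjoint_left.mpr fun z hz hz' => hdisj z hz' hz)]
  · congr 1
    · exact Finset.prod_congr rfl fun z hz => if_pos hz
    · exact Finset.prod_congr rfl fun z hz => if_neg (hdisj z hz)
  · rw [Finset.coe_union]
    exact Set.union_subset (hs.trans (le_sup_left.trans h')) (ht.trans (le_sup_right.trans h'))

theorem total_act (φ : R →ₐ[ℂ] R) (g : RigidMotion) (x : Obj R U) :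
    total R (smulOpens g U) (act φ g U x) = φ (total R U x) := by
  suffices H : total R (smulOpens g U) ∘ₗ act φ g U = φ.toLinearMap ∘ₗ total R U from
    LinearMap.congr_fun H x
  refine hom_ext_pt fun s a hs => ?_
  rw [LinearMap.comp_apply, LinearMap.comp_apply, act_pt φ g hs, total_pt hs,
    total_pt (coe_image_smul_subset g hs), AlgHom.toLinearMap_apply, map_prod,
    Finset.prod_image fun z _ w _ h => MulAction.injective g h]
  exact Finset.prod_congr rfl fun z _ => by rw [inv_smul_smul]

theorem total_multiMul [TopologicalSpace R] {φ : RigidMotion → (R →ₐ[ℂ] R)} (n : ℕ)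
    (U : Fin (n + 1) → Opens ℂ)
    (hU : Pairwise fun i j => Disjoint (U i) (U j)) (W : Opens ℂ) (hW : ∀ i, U i ≤ W)
    (x : ∀ i, Obj R (U i)) :
    total R W ((_root_.FLoc R φ).toPrefactorizationData.multiMul n U hU W hW x) =
      ∏ i, total R (U i) (x i) := by
  induction n generalizing W with
  | zero =>
    rw [Fin.prod_univ_one]
    exact total_map (hW 0) (x 0)
  | succ n ih =>
    rw [Fin.prod_univ_castSucc, ← ih (fun i => U i.castSucc)
      (fun _ _ hij => hU fun h => hij (Fin.castSucc_injective _ h)) _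
      (le_iSup fun i : Fin (n + 1) => U i.castSucc)]
    exact total_mul _ _ _ _

/-- In a connected open set every configuration merges into one point labelled by the product of all
labels. So `total` is injective there, with this inverse. -/
theorem pt_total (hU : IsPreconnected (U : Set ℂ)) {z : ℂ} (hz : z ∈ U) (x : Obj R U) :
    pt R U {z} (fun _ => total R U x) = x := by
  have hs : (({z} : Finset ℂ) : Set ℂ) ⊆ U := by simpa using hz
  have hf := isPointFunctional_pt (R := R) (U := U)
  have hupd : ∀ y : R, pt R U {z} (fun _ => y) = pt R U {z} (Function.update (fun _ => 1) z y) :=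
    fun y => pt_congr R hs rfl fun w hw => by
      rw [Finset.mem_singleton.mp hw, Function.update_self]
  have hadd : ∀ x y : R, pt R U {z} (fun _ => x + y) = pt R U {z} (fun _ => x) +
      pt R U {z} (fun _ => y) := fun x y => by
    rw [hupd, hupd x, hupd y, hf.map_update_add _ _ _ _ _ hs (Finset.mem_singleton_self z)]
  have hsmul : ∀ (c : ℂ) (x : R), pt R U {z} (fun _ => c • x) = c • pt R U {z} (fun _ => x) :=
    fun c x => by
      rw [hupd, hupd x, hf.map_update_smul _ _ _ _ _ hs (Finset.mem_singleton_self z)]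
  induction x using induction_pt with
  | hpt s a hs' =>
    rw [total_pt hs']
    refine (isMerging_pt R U).eq_of_components hs hs' fun w hw => ?_
    have key : ∀ x ∈ U, connectedComponentIn (U : Set ℂ) x = connectedComponentIn (U : Set ℂ) w :=
      fun x hx => by rw [hU.connectedComponentIn hx, hU.connectedComponentIn hw]
    rw [Finset.filter_true_of_mem fun x hx => key x (hs hx),
      Finset.filter_true_of_mem fun x hx => key x (hs' hx), Finset.prod_singleton]
  | hadd x y hx hy => rw [map_add, hadd, hx, hy]
  | hsmul c x hx => rw [map_smul, hsmul, hx]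

theorem exists_isAdmissible {n : ℕ} {r : ℝ} {z : Fin n → ℂ}
    (hz : z ∈ EquivariantData.conf n r) : ∃ ε, EquivariantData.IsAdmissible r z ε := by
  obtain ⟨ε, hε⟩ := exists_isAdmissibleRadius (U := disc 0 r) (s := Finset.univ.image z)
    fun w hw => by
      obtain ⟨i, -, rfl⟩ := Finset.mem_image.mp (Finset.mem_coe.mp hw)
      exact hz.2 i
  have hmem : ∀ i, z i ∈ Finset.univ.image z := fun i =>
    Finset.mem_image_of_mem z (Finset.mem_univ i)
  exact ⟨ε, hε.pos, fun i j hij => hε.disjoint _ (hmem i) _ (hmem j) fun h => hij (hz.1 h),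
    fun i => hε.le _ (hmem i)⟩

/-! ### Products of translated elements, computed through `total`. -/

section Mu

variable [TopologicalSpace R] {φ : RigidMotion → (R →ₐ[ℂ] R)}

/-- `total` ignores inclusions, turns products over disjoint sets into products in `R` and
intertwines the actions, so the radius chosen in `mu` disappears. -/
theorem total_mu {n : ℕ} {r : ℝ} {z : Fin (n + 1) → ℂ}
    (hz : z ∈ EquivariantData.conf (n + 1) r)
    (a : Fin (n + 1) → ∀ r : {r : ℝ // 0 < r}, Obj R (disc 0 r)) (α : Fin (n + 1) → R)
    (hα : ∀ i r, total R _ (a i r) = α i) :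
    total R _ ((_root_.FLoc R φ).mu n r a z) = ∏ i, φ ⟨1, z i⟩ (α i) := by
  refine (congrArg (total R (disc 0 r)) (dif_pos (exists_isAdmissible hz))).trans ?_
  refine (total_multiMul _ _ _ _ _ _).trans (Finset.prod_congr rfl fun i _ => ?_)
  refine (total_map (trans_disc (z i) _).le _).trans ((total_act _ _ _).trans
    (congrArg _ (hα i _)))

theorem exists_total_eq {Δ : ℤ} {a : ∀ r : {r : ℝ // 0 < r}, Obj R (disc 0 r)}
    (ha : (_root_.FLoc R φ).IsHomogeneous Δ a) : ∃ α, ∀ r, total R _ (a r) = α := by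
  have key : ∀ r s : {r : ℝ // 0 < r}, r < s → total R _ (a r) = total R _ (a s) := fun r s h => by
    exact (total_map (disc_mono 0 (Subtype.coe_lt_coe.mpr h).le) (a r)).symm.trans
      (congrArg (total R _) (ha.2 r s h))
  refine ⟨total R _ (a ⟨1, one_pos⟩), fun r => ?_⟩
  rcases lt_trichotomy r ⟨1, one_pos⟩ with h | h | h
  · exact key _ _ h
  · rw [h]
  · exact (key _ _ h).symm

end Mu

variable [TopologicalSpace R] [IsTopologicalAddGroup R] [ContinuousSMul ℂ R]
  [LocallyConvexSpace ℝ R] [ContinuousMul R] {I : Type*} [Countable I] (e : R ≃L[ℂ] (I → ℂ))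

include e in
theorem continuous_total : Continuous (total R U) :=
  continuous_obj_of_separately e fun s a z hs _ => by
    simp only [total_pt hs]
    exact continuous_finsetProd _ fun w _ =>
      (continuous_apply w).comp (continuous_update_label a z)

/-- For connected `U`, the space `F(U)` is isomorphic to `R`. -/
def totalEquiv (hU : IsPreconnected (U : Set ℂ)) {z : ℂ} (hz : z ∈ U) : Obj R U ≃L[ℂ] R where
  toLinearMap := total R U
  invFun x := pt R U {z} fun _ => x
  left_inv := pt_total hU hz
  right_inv x := by
    change total R U (pt R U {z} fun _ => x) = x
    rw [total_pt (by simpa using hz), Finset.prod_singleton]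
  continuous_toFun := continuous_total e
  continuous_invFun :=
    (continuous_pt (by simpa using hz)).comp (continuous_pi fun _ => continuous_id)

/-- The isomorphism `F(D_r(0)) ≅ R`. -/
def discEquiv {r : ℝ} (hr : 0 < r) : Obj R (disc 0 r) ≃L[ℂ] R :=
  totalEquiv e (convex_ball 0 r).isPreconnected (mem_disc_self hr)

variable {φ : RigidMotion → (R →ₐ[ℂ] R)}

-- `total` is injective on a disc and intertwines rotations with `φ`, so the weight condition can be
-- read off in `R`, independently of the radius.
include e in
theorem mem_weight_iff {r : ℝ} (hr : 0 < r) (Δ : ℤ) (x : Obj R (disc 0 r)) :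
    x ∈ (_root_.FLoc R φ).weight r Δ ↔
      ∀ q : Circle, φ ⟨q, 0⟩ (total R _ x) = (q : ℂ) ^ Δ • total R _ x := by
  refine forall_congr' fun q => ?_
  have h1 : total R (disc 0 r) ((_root_.FLoc R φ).map (rot_disc q r).le
      ((_root_.FLoc R φ).act ⟨q, 0⟩ (disc 0 r) x)) = φ ⟨q, 0⟩ (total R _ x) :=
    (total_map (rot_disc q r).le _).trans (total_act _ _ _)
  have h2 : total R (disc 0 r) ((q : ℂ) ^ Δ • x) = (q : ℂ) ^ Δ • total R _ x := map_smul _ _ _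
  exact ⟨fun h => h1.symm.trans ((congrArg (total R _) h).trans h2),
    fun h => (discEquiv e hr).injective (h1.trans (h.trans h2.symm))⟩

include e in
theorem weight_bijOn {r s : ℝ} (hr : 0 < r) (h : r < s) (Δ : ℤ) :
    Set.BijOn ((_root_.FLoc R φ).map (disc_mono 0 h.le)) ((_root_.FLoc R φ).weight r Δ)
      ((_root_.FLoc R φ).weight s Δ) := by
  have hs := hr.trans h
  have ht : ∀ x : Obj R (disc 0 r), total R (disc 0 s) (map R (disc_mono 0 h.le) x) =
      total R (disc 0 r) x := total_map _
  refine ⟨fun x hx => (mem_weight_iff e hs Δ _).mpr fun q => ?_, fun x _ y _ hxy => ?_,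
    fun y hy => ?_⟩
  · exact (congrArg (φ ⟨q, 0⟩) (ht x)).trans (((mem_weight_iff e hr Δ x).mp hx q).trans
      (congrArg _ (ht x).symm))
  · exact (discEquiv e hr).injective
      ((ht x).symm.trans ((congrArg (total R (disc 0 s)) hxy).trans (ht y)))
  · obtain ⟨x, hx⟩ : ∃ x : Obj R (disc 0 r), total R (disc 0 r) x = total R (disc 0 s) y :=
      (discEquiv e hr).surjective _
    refine ⟨x, (mem_weight_iff e hr Δ x).mpr fun q => ?_,
      (discEquiv e hs).injective ((ht x).trans hx)⟩
    rw [hx]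
    exact (mem_weight_iff e hs Δ y).mp hy q

end Total

end FLoc

/-! ### Holomorphicity -/

namespace CommGradedVertexAlgebra

namespace Completion

variable {V : Type u} [AddCommGroup V] [Module ℂ V] {A : CommGradedVertexAlgebra V}

/-- Every linear functional of every homogeneous component of `f` is holomorphic. -/
def IsWeaklyDifferentiable {n : ℕ} (f : (Fin n → ℂ) → A.Completion) : Prop :=
  ∀ (Δ : ℤ) (l : A.gr Δ →ₗ[ℂ] ℂ), Differentiable ℂ fun z => l (f z Δ)

theorem isWeaklyDifferentiable_expT {n : ℕ} (j : Fin n) (a : A.Completion) :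
    IsWeaklyDifferentiable fun z : Fin n → ℂ => expT (z j) a := by
  obtain ⟨N, hN⟩ := exists_bound A
  intro Δ l
  simp only [expT_apply_eq_weightT hN, map_sum, map_smul, smul_eq_mul, div_eq_mul_inv]
  exact Differentiable.fun_sum fun k _ =>
    (((differentiable_apply j).pow k).mul_const _).mul_const _

/-- Expanding `f z i` in a basis of the weight space writes a functional of the product as a finite
sum of products of functionals of `f z` and `g z`. -/
theorem IsWeaklyDifferentiable.mul [∀ Δ, FiniteDimensional ℂ (A.gr Δ)] {n : ℕ}
    {f g : (Fin n → ℂ) → A.Completion} (hf : IsWeaklyDifferentiable f)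
    (hg : IsWeaklyDifferentiable g) : IsWeaklyDifferentiable fun z => f z * g z := by
  obtain ⟨N, hN⟩ := exists_bound A
  intro Δ l
  have key : ∀ z, l ((f z * g z) Δ) = ∑ i ∈ Finset.Icc N (Δ - N),
      ∑ k, (Module.finBasis ℂ (A.gr i)).coord k (f z i) *
        (l ∘ₗ weightMul i Δ (Module.finBasis ℂ (A.gr i) k)) (g z (Δ - i)) := fun z => by
    rw [mul_apply_eq_weightMul hN, map_sum]
    refine Finset.sum_congr rfl fun i _ => ?_
    conv_lhs => rw [← (Module.finBasis ℂ (A.gr i)).sum_repr (f z i), map_sum, LinearMap.sum_apply,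
      map_sum]
    refine Finset.sum_congr rfl fun k _ => ?_
    rw [map_smul, LinearMap.smul_apply, map_smul, smul_eq_mul]
    rfl
  simp only [key]
  exact Differentiable.fun_sum fun i _ => Differentiable.fun_sum fun k _ =>
    (hf i _).mul (hg (Δ - i) _)

theorem isWeaklyDifferentiable_prod_expT [∀ Δ, FiniteDimensional ℂ (A.gr Δ)] {n : ℕ}
    (s : Finset (Fin n)) (a : Fin n → A.Completion) :
    IsWeaklyDifferentiable fun z => ∏ j ∈ s, expT (z j) (a j) := by
  induction s using Finset.cons_induction with
  | empty =>
    intro Δ l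
    simp only [Finset.prod_empty]
    exact differentiable_const _
  | cons j s hj ih =>
    simp only [Finset.prod_cons]
    exact (isWeaklyDifferentiable_expT j (a j)).mul ih

/-- One rotation separating the characters of weights `Δ` and `Δ'` suffices. -/
theorem apply_eq_zero_of_rotL_eq {Δ : ℤ} {a : A.Completion}
    (h : ∀ q : Circle, rotL q a = (q : ℂ) ^ Δ • a) {Δ' : ℤ} (hne : Δ' ≠ Δ) : (a Δ' : V) = 0 := by
  have hd : ((Δ' - Δ : ℤ) : ℝ) ≠ 0 := Int.cast_ne_zero.mpr (sub_ne_zero.mpr hne)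
  -- Chosen so that `q ^ Δ'` and `q ^ Δ` differ by the factor `-1`.
  let q : Circle := Circle.exp (Real.pi / (Δ' - Δ : ℤ))
  have hq : (q : ℂ) ^ (Δ' - Δ) = -1 := by
    rw [Circle.coe_exp, ← Complex.exp_int_mul, ← mul_assoc, ← Complex.exp_pi_mul_I]
    congr 2
    rw [Complex.ofReal_div, Complex.ofReal_intCast]
    exact mul_div_cancel₀ _ (by exact_mod_cast hd)
  have h1 : (q : ℂ) ^ Δ' • (a Δ' : V) = (q : ℂ) ^ Δ • (a Δ' : V) :=
    congrArg (fun b : A.Completion => (b Δ' : V)) (h q)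
  rw [← sub_eq_zero, ← sub_smul, smul_eq_zero] at h1
  refine h1.resolve_left fun h2 => ?_
  rw [zpow_sub₀ q.coe_ne_zero, sub_eq_zero.mp h2, div_self (zpow_ne_zero _ q.coe_ne_zero)] at hq
  norm_num at hq

end Completion

open Completion

variable {V : Type u} [AddCommGroup V] [Module ℂ V] (A : CommGradedVertexAlgebra V)
  [∀ Δ, FiniteDimensional ℂ (A.gr Δ)]

theorem isEquivariantPrefactorizationAlgebra_FLoc :
    (_root_.FLoc A.Completion (motionHom A)).IsEquivariantPrefactorizationAlgebra :=
  FLoc.isEquivariantPrefactorizationAlgebra (coordEquiv A) continuous_motionHom motionHom_mul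
    motionHom_one

/-- Under `total` a vector of weight `Δ` has only its component in `V_Δ`, and that space is zero for
small `Δ`. -/
theorem weight_bddBelow_FLoc {r : ℝ} (hr : 0 < r) :
    ∃ N : ℤ, ∀ Δ < N, (_root_.FLoc A.Completion (motionHom A)).weight r Δ = {0} := by
  obtain ⟨N, hN⟩ := exists_bound A
  refine ⟨N, fun Δ hΔ => Set.eq_singleton_iff_unique_mem.mpr ⟨fun q => ?_, fun x hx => ?_⟩⟩
  · rw [map_zero, map_zero, smul_zero]
  · have hx := (FLoc.mem_weight_iff (coordEquiv A) hr Δ x).mp hx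
    refine (FLoc.discEquiv (coordEquiv A) hr).injective (Eq.trans ?_ (map_zero _).symm)
    refine ext fun Δ' => ?_
    by_cases h : Δ' = Δ
    · exact hN _ _ (h ▸ hΔ)
    · refine apply_eq_zero_of_rotL_eq (fun q => ?_) h
      refine Eq.trans ?_ (hx q)
      exact (expT_zero _).symm

theorem isHolomorphic_FLoc : (_root_.FLoc A.Completion (motionHom A)).IsHolomorphic where
  isEquivariant := A.isEquivariantPrefactorizationAlgebra_FLoc
  weight_bijOn _ _ hr h Δ := FLoc.weight_bijOn (coordEquiv A) hr h Δ
  weight_bddBelow _ hr := A.weight_bddBelow_FLoc hr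
  quasiComplete _ hr := quasiCompleteSpace_of_coords
    (E := FLoc.lcs A.Completion _) ((FLoc.discEquiv (coordEquiv A) hr).trans (coordEquiv A))
  t2 _ hr := t2Space_of_coords
    (E := FLoc.lcs A.Completion _) ((FLoc.discEquiv (coordEquiv A) hr).trans (coordEquiv A))
  mu_holomorphic r hr n Δ a ha := by
    -- A homogeneous family becomes one element `α i` of the completion, the same for all radii, and
    -- `mu` becomes the product of the `e^{z_i T} α_i`.
    choose α hα using fun i => FLoc.exists_total_eq (ha i)
    refine isHolomorphicOn_of_coords (E := FLoc.lcs A.Completion _)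
      ((FLoc.discEquiv (coordEquiv A) hr).trans (coordEquiv A))
      (fun i => isWeaklyDifferentiable_prod_expT Finset.univ α i.1
        ((Module.finBasis ℂ (A.gr i.1)).coord i.2)) fun z hz i => ?_
    have h := FLoc.total_mu (φ := motionHom A) hz a α hα
    refine (congrFun (congrArg (coordEquiv A) h) i).trans ?_
    have h1 : ∀ j, motionHom A ⟨1, z j⟩ (α j) = expT (z j) (α j) := fun j => by
      rw [motionHom_apply, rotL_one]
    simp only [h1]
    rfl

end CommGradedVertexAlgebra

end

theorem mainTheorem3 {V : Type u} [AddCommGroup V] [Module ℂ V] (A : CommGradedVertexAlgebra V)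
    (hfin : ∀ Δ : ℤ, FiniteDimensional ℂ (A.gr Δ)) :
    A.FLoc.IsEquivariantPrefactorizationAlgebra ∧
      A.FLoc.toPrefactorizationData.IsFactorizationAlgebra ∧
      A.FLoc.toPrefactorizationData.IsLocallyConstant ∧
      A.FLoc.IsHolomorphic ∧
      A.FLoc.toPrefactorizationData.IsProjectiveOnFinite :=
  -- The isomorphism with a countable product of lines, a consequence of `hfin`. The action in
  -- `A.FLoc` is `motionHom A` by definition.
  have e := CommGradedVertexAlgebra.Completion.coordEquiv A
  ⟨A.isEquivariantPrefactorizationAlgebra_FLoc, FLoc.isFactorizationAlgebra e,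
    FLoc.isLocallyConstant e, A.isHolomorphic_FLoc, FLoc.isProjectiveOnFinite e⟩
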